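/- **Setting.** There are $M\ge1$ messages, $K\ge1$ contexts and $T\ge 1$ timeslots. In each timeslot $N\ge1$ users arrive; user $n$ has context $x_t(n)\in[1:K]$. The timeslots are independent and the context vectors $x_t$ are identically distributed. The users of a timeslot are divided uniformly at random, independently of the contexts, into $\tau$ groups $\mathcal N_1,\dots,\mathcal N_\tau$ of size $N/\tau$ (with $\tau\mid N$), and the server, which sees the contexts, sends one message to each group; $a_t(n)$ is the message that user $n$ receives. After the timeslot it observes the payoffs $r_t(n)\in[0,1]$. These are independent across users and timeslots, and the payoff of message $m$ in context $k$ has a fixed unknown law with mean $\mu(k,m)$. For some $\Delta\ge\underline\Delta>0$ all means lie in $\{\Delta,2\Delta,3\Delta,\dots\}$. The messages are partitioned into $L$ nonempty, unknown content types, and in every context two messages have the same mean payoff if and only if they have the same type. The learning regret is $$R(T)=\mathbb E\sum_{t=1}^{T}\sum_{n=1}^{N}\bigl[\mu(x_t(n),a^*(n,x_t))-r_t(n)\bigr],$$ where, for $n\in\mathcal N_s$, $a^*(n,x_t)$ maximizes $m\mapsto\sum_{n'\in\mathcal N_s}\mu(x_t(n'),m)$. At any time, $\bar r(k,m)$ is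 the average payoff observed so far for message $m$ from users with context $k$ ($0$ if there are none), and $Z(k,m)$ is the number of these observations. All logarithms are natural. Ties and other arbitrary choices below are resolved by any fixed rule. The algorithms know neither $L$ nor the means nor the types. **Clustering routine** (input: a distance $\bar d(m_1,m_2)$ on messages). Start from singletons. As long as the smallest value of $\max_{m_1\in\mathcal M',m_2\in\mathcal M''}\bar d(m_1,m_2)$ over pairs of distinct clusters $\mathcal M',\mathcal M''$ is less than $\underline\Delta/2$, unite a pair attaining it. One representative is chosen from each resulting cluster, by a fixed rule. **Algorithm A** (one transmission per user, $\tau=N$). Let $s$ be the smallest integer such that there are $K$ sets $\mathcal S_1,\dots,\mathcal S_K$ of $s$ messages each (not necessarily distinct) such that every pair of distinct messages is contained in some $\mathcal S_k$. Fix such sets, and for every pair a context $x_{m_1,m_2}=k$ with $m_1,m_2\in\mathcal S_k$. In timeslot $t$, with $D(t)=\frac{32}{\underline\Delta^2}\log t$, each user, with context $k$ say, receives the following, determined from the data of timeslots $1,\dots,t-1$. If some $m\in\mathcal S_k$ has $Z(k,m)<D(t)$, then such an $m$. Otherwise the messages are clustered with $\bar d(m_1,m_2)=|\bar r(x_{m_1,m_2},m_1)-\bar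 r(x_{m_1,m_2},m_2)|$; if some representative $m$ has $Z(k,m)<D(t)$, then such an $m$; otherwise a representative maximizing $\bar r(k,\cdot)$. **Algorithm B** ($1\le\tau\le N$, $\tau\mid N$). For the first $\lceil\frac{32KM}{\tau\underline\Delta^2}\log(NTM)\rceil$ timeslots, the consecutive transmissions ($\tau$ per timeslot) go round robin through all messages. Then the messages are clustered, once, with $\bar d(m_1,m_2)=|\bar r(k_0,m_1)-\bar r(k_0,m_2)|$ for a fixed context $k_0$; let $\hat L$ be the number of representatives. For the next $\lceil\frac{16NK\hat L}{\tau^2\underline\Delta^2}\log(\hat LNKT)\rceil$ timeslots the transmissions go round robin through the representatives. In every later timeslot each group $\mathcal N_s$ receives a representative maximizing $\sum_{n\in\mathcal N_s}\bar r(x_t(n),\cdot)$. **Proposition.** In each case the sum in the definition of $R(T)$ is integrable, and the following hold. 1. ($\tau=1$.) For every $\underline\Delta>0$ there is a constant $C$, depending only on $\underline\Delta$, such that, if all contexts have the same arrival rate (the mean number of users with context $k$ per timeslot is $N/K$ for every $k$; the users of one timeslot may be dependent), Algorithm B with $\tau=1$ satisfies, for all $T\ge1$, $$R(T)\le C\,(NKM+LN^2K)\log(NMKT).$$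 2. ($\tau=N$.) For every $\underline\Delta>0$ there is a constant $C$, depending only on $\underline\Delta$, such that, if the contexts of the users of a timeslot are independent and uniform on $[1:K]$, Algorithm A satisfies, for all $T\ge2^N$, $$R(T)\le C\left(KM\sqrt{\frac{\log(MK)}{K}}+KL\right)\log T .$$ 3. (General $\tau$.) There is an absolute constant $C$ such that, if the contexts of the users of a timeslot are independent and uniform on $[1:K]$, then for every $\tau\mid N$ Algorithm B satisfies $$R(T)\le C\left(\frac{NKM}{\tau\underline\Delta^2}\log(NTM)+\frac{LN^2K}{\tau^2\underline\Delta^2}\log(LNKT)\right)$$ for all $T\ge1$ with $\tau\le\frac{KM}{\underline\Delta^2}\log(NTM)$, in particular for all $T\ge e^\tau$. -/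

import Mathlib

open MeasureTheory ProbabilityTheory

namespace LatentBandit

/-! ### Interaction between the server and the users

There are `N` users per timeslot, `K` contexts, `M` messages and `τ` transmissions per timeslot.
Timeslots are numbered `0, 1, 2, …`; slot number `t` is the `(t + 1)`-st timeslot. -/

/-- What the server has seen in one finished timeslot: the context of every user, the message that
every user received, and the payoff of every user. -/
structure Slot (N K M : ℕ) where
  ctx : Fin N → Fin K
  msg : Fin N → Fin M
  pay : Fin N → ℝ

/-- A recommendation strategy. From the finished timeslots (most recent first), the contexts of the
present users and their division into `τ` groups it determines the message for every user. -/
abbrev Policy (N K M τ : ℕ) : Type :=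
  List (Slot N K M) → (Fin N → Fin K) → (Fin N → Fin τ) → Fin N → Fin M

/-- The first `t` timeslots when the policy `π` is run. `X t ω n` is the context of user `n` in slot
`t`, `G t ω n` is the group of this user, and `R t ω n k m` is the payoff that this user would give
to message `m` in context `k`; payoffs are revealed only after the slot is finished, and only for
the context and the message that occurred. -/
def history {N K M τ : ℕ} {Ω : Type*} (π : Policy N K M τ) (X : ℕ → Ω → Fin N → Fin K)
    (G : ℕ → Ω → Fin N → Fin τ) (R : ℕ → Ω → Fin N → Fin K → Fin M → ℝ) :
    ℕ → Ω → List (Slot N K M)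
  | 0, _ => []
  | t + 1, ω =>
    let h := history π X G R t ω
    let a := π h (X t ω) (G t ω)
    ⟨X t ω, a, fun n => R t ω n (X t ω n) (a n)⟩ :: h

/-- The message that user `n` receives in slot `t`. -/
def action {N K M τ : ℕ} {Ω : Type*} (π : Policy N K M τ) (X : ℕ → Ω → Fin N → Fin K)
    (G : ℕ → Ω → Fin N → Fin τ) (R : ℕ → Ω → Fin N → Fin K → Fin M → ℝ) (t : ℕ) (ω : Ω) :
    Fin N → Fin M :=
  π (history π X G R t ω) (X t ω) (G t ω)

/-- A message that maximizes the sum of the mean payoffs over the users of group `s`. -/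
noncomputable def bestMsg {N K M τ : ℕ} [NeZero M] (μ : Fin K → Fin M → ℝ) (x : Fin N → Fin K)
    (g : Fin N → Fin τ) (s : Fin τ) : Fin M :=
  (Finite.exists_max fun m : Fin M => ∑ n with g n = s, μ (x n) m).choose

/-- The payoff lost in the first `T` timeslots with respect to the best strategy that transmits one
message to each group. -/
noncomputable def regretSum {N K M τ : ℕ} [NeZero M] {Ω : Type*} (π : Policy N K M τ)
    (μ : Fin K → Fin M → ℝ) (X : ℕ → Ω → Fin N → Fin K) (G : ℕ → Ω → Fin N → Fin τ)
    (R : ℕ → Ω → Fin N → Fin K → Fin M → ℝ) (T : ℕ) (ω : Ω) : ℝ :=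
  ∑ t ∈ Finset.range T, ∑ n : Fin N,
    (μ (X t ω n) (bestMsg μ (X t ω) (G t ω) (G t ω n))
      - R t ω n (X t ω n) (action π X G R t ω n))

/-- The learning regret `R(T)`. -/
noncomputable def regret {N K M τ : ℕ} [NeZero M] {Ω : Type*} [MeasurableSpace Ω] (P : Measure Ω)
    (π : Policy N K M τ) (μ : Fin K → Fin M → ℝ) (X : ℕ → Ω → Fin N → Fin K)
    (G : ℕ → Ω → Fin N → Fin τ) (R : ℕ → Ω → Fin N → Fin K → Fin M → ℝ) (T : ℕ) : ℝ :=
  ∫ ω, regretSum π μ X G R T ω ∂P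

/-! ### The stochastic model -/

/-- The mean payoff of message `m` in context `k`. -/
noncomputable def meanPayoff {K M : ℕ} (D : Fin K → Fin M → Measure ℝ) (k : Fin K) (m : Fin M) :
    ℝ :=
  ∫ r, r ∂(D k m)

/-- The payoff distributions `D k m`: payoffs in `[0, 1]`, means in `{Δ, 2Δ, 3Δ, …}` for some
`Δ ≥ δ`, and `L` content types (the fibres of `typ`) such that two messages have the same mean
payoff in a context if and only if they have the same content type. -/
structure IsLatentPayoff {K M L : ℕ} (δ : ℝ) (D : Fin K → Fin M → Measure ℝ)
    (typ : Fin M → Fin L) : Prop where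
  prob : ∀ k m, IsProbabilityMeasure (D k m)
  mem_Icc : ∀ k m, ∀ᵐ r ∂(D k m), r ∈ Set.Icc (0 : ℝ) 1
  discrete : ∃ Δ : ℝ, δ ≤ Δ ∧ ∀ k m, ∃ j : ℕ, 1 ≤ j ∧ meanPayoff D k m = j * Δ
  typ_surjective : Function.Surjective typ
  typ_eq_iff : ∀ k a b, typ a = typ b ↔ meanPayoff D k a = meanPayoff D k b

/-- The arrival and payoff processes: the timeslots are independent; the context vectors are
identically distributed; the users are divided uniformly at random into `τ` groups of equal size,
independently of the contexts; the payoffs are independent across users and independent of contexts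
and groups, and the payoff of message `m` in context `k` has law `D k m`. -/
structure IsBroadcastModel {N K M τ : ℕ} {Ω : Type*} [MeasurableSpace Ω] (P : Measure Ω)
    (D : Fin K → Fin M → Measure ℝ) (X : ℕ → Ω → Fin N → Fin K) (G : ℕ → Ω → Fin N → Fin τ)
    (R : ℕ → Ω → Fin N → Fin K → Fin M → ℝ) : Prop where
  prob : IsProbabilityMeasure P
  measurable_ctx : ∀ t, Measurable (X t)
  measurable_grp : ∀ t, Measurable (G t)
  measurable_pay : ∀ t, Measurable (R t)
  indep_slots : iIndepFun (fun (t : ℕ) (ω : Ω) => (X t ω, G t ω, R t ω)) P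
  ctx_identDistrib : ∀ t, P.map (X t) = P.map (X 0)
  grp_law : ∀ t, P.map (G t) =
    uniformOn {g : Fin N → Fin τ | ∀ s, (Finset.univ.filter fun n => g n = s).card * τ = N}
  indep_ctx_grp : ∀ t, IndepFun (X t) (G t) P
  indep_pay : ∀ t, IndepFun (fun ω => (X t ω, G t ω)) (R t) P
  indep_users : ∀ t, iIndepFun (fun (n : Fin N) (ω : Ω) => R t ω n) P
  pay_law : ∀ t n k m, P.map (fun ω => R t ω n k m) = D k m

/-- All contexts have the same arrival rate: the mean number of users per timeslot with context `k`
is `N / K`. The contexts of the users within one timeslot may depend on each other. -/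
def UniformRates {N K : ℕ} {Ω : Type*} [MeasurableSpace Ω] (P : Measure Ω)
    (X : ℕ → Ω → Fin N → Fin K) : Prop :=
  ∀ t k, ∑ n : Fin N, P.real {ω | X t ω n = k} = (N : ℝ) / K

/-- The contexts of the users within one timeslot are independent and uniformly distributed. -/
def UniformUsers {N K : ℕ} {Ω : Type*} [MeasurableSpace Ω] (P : Measure Ω)
    (X : ℕ → Ω → Fin N → Fin K) : Prop :=
  ∀ t, iIndepFun (fun (n : Fin N) (ω : Ω) => X t ω n) P ∧
    ∀ n k, P.real {ω | X t ω n = k} = 1 / (K : ℝ)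

/-! ### Statistics and arbitrary choices -/

/-- The number of users with context `k` that have received message `m`. -/
def count {N K M : ℕ} (h : List (Slot N K M)) (k : Fin K) (m : Fin M) : ℕ :=
  (h.map fun o => (Finset.univ.filter fun n => o.ctx n = k ∧ o.msg n = m).card).sum

/-- The average payoff of message `m` over the users with context `k` (`0` without samples). -/
noncomputable def avg {N K M : ℕ} (h : List (Slot N K M)) (k : Fin K) (m : Fin M) : ℝ :=
  (h.map fun o => ∑ n with o.ctx n = k ∧ o.msg n = m, o.pay n).sum / count h k m

/-- The arbitrary choices of the algorithms: a message from a set of candidate messages, a pair of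
clusters from a set of candidate pairs, and a representative message of a cluster. -/
structure Choices (M : ℕ) where
  msg : Finset (Fin M) → Fin M
  msg_mem : ∀ S, S.Nonempty → msg S ∈ S
  pair : Finset (Finset (Fin M) × Finset (Fin M)) → Finset (Fin M) × Finset (Fin M)
  pair_mem : ∀ S, S.Nonempty → pair S ∈ S
  rep : Finset (Fin M) → Fin M
  rep_mem : ∀ S, S.Nonempty → rep S ∈ S

open Classical in
/-- A message among `S` with the largest score. -/
noncomputable def argmax {M : ℕ} (c : Choices M) (S : Finset (Fin M)) (score : Fin M → ℝ) :
    Fin M :=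
  c.msg (S.filter fun m => ∀ m' ∈ S, score m' ≤ score m)

/-! ### Clustering the messages into content types -/

/-- The distance of two clusters: the largest distance between their messages. -/
noncomputable def clusterDist {M : ℕ} (d : Fin M → Fin M → ℝ)
    (p : Finset (Fin M) × Finset (Fin M)) : ℝ :=
  ⨆ q : ↥(p.1 ×ˢ p.2), d q.1.1 q.1.2

open Classical in
/-- Unite two closest clusters, if their distance is less than `θ`. -/
noncomputable def mergeStep {M : ℕ} (c : Choices M) (θ : ℝ) (d : Fin M → Fin M → ℝ)
    (𝒞 : Finset (Finset (Fin M))) : Finset (Finset (Fin M)) :=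
  let cand := 𝒞.offDiag.filter fun p =>
    clusterDist d p < θ ∧ ∀ q ∈ 𝒞.offDiag, clusterDist d p ≤ clusterDist d q
  if cand.Nonempty then
    insert ((c.pair cand).1 ∪ (c.pair cand).2) ((𝒞.erase (c.pair cand).1).erase (c.pair cand).2)
  else 𝒞

/-- The final clustering. It starts from singletons; every effective step decreases the number of
clusters by one, so that nothing changes any more after `M` steps. -/
noncomputable def cluster {M : ℕ} (c : Choices M) (θ : ℝ) (d : Fin M → Fin M → ℝ) :
    Finset (Finset (Fin M)) :=
  (mergeStep c θ d)^[M] (Finset.univ.image fun m => {m})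

/-- The representatives of the clusters. -/
def reps {M : ℕ} (c : Choices M) (𝒞 : Finset (Finset (Fin M))) : Finset (Fin M) :=
  𝒞.image c.rep

/-! ### The algorithm without broadcasting -/

/-- Every pair of messages is contained in one of the sets `S k`. -/
def CoversPairs {K M : ℕ} (S : Fin K → Finset (Fin M)) : Prop :=
  ∀ a b : Fin M, a ≠ b → ∃ k, a ∈ S k ∧ b ∈ S k

/-- An allocation of the pairs of messages to the contexts: one set of `s` messages for every
context, such that all pairs are covered and `s` is as small as possible, together with a context
`pc s(a, b)` that the pair `{a, b}` is assigned to. -/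
structure IsAllocation {K M : ℕ} (S : Fin K → Finset (Fin M)) (pc : Sym2 (Fin M) → Fin K) :
    Prop where
  covers : CoversPairs S
  minimal : ∃ s : ℕ, (∀ k, (S k).card = s) ∧
    ∀ (s' : ℕ) (S' : Fin K → Finset (Fin M)),
      (∀ k, (S' k).card = s') → CoversPairs S' → s ≤ s'
  pc_mem : ∀ a b : Fin M, a ≠ b → a ∈ S (pc s(a, b)) ∧ b ∈ S (pc s(a, b))

open Classical in
/-- The algorithm that learns the content types across contexts, with one transmission per user.
With `δ` the known lower bound on `Δ` and `thr = (32 / δ ^ 2) * log t` in the `t`-th timeslot, a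
user with context `k` receives: a message of `S k` with fewer than `thr` samples in context `k`, if
there is one; otherwise a representative of the present clusters with fewer than `thr` samples in
context `k`, if there is one; otherwise the representative with the best average in context `k`. -/
noncomputable def latentPolicy (N K M τ : ℕ) (δ : ℝ) (c : Choices M) (S : Fin K → Finset (Fin M))
    (pc : Sym2 (Fin M) → Fin K) : Policy N K M τ := fun h x _ n =>
  let k := x n
  let thr : ℝ := 32 / δ ^ 2 * Real.log (h.length + 1)
  let few₁ := (S k).filter fun m => (count h k m : ℝ) < thr
  let 𝒞 := cluster c (δ / 2) fun a b => |avg h (pc s(a, b)) a - avg h (pc s(a, b)) b|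
  let few₂ := (reps c 𝒞).filter fun m => (count h k m : ℝ) < thr
  if few₁.Nonempty then c.msg few₁
  else if few₂.Nonempty then c.msg few₂
  else argmax c (reps c 𝒞) (avg h k)

/-! ### The algorithm with broadcasting -/

/-- The number of timeslots of the first exploration phase. -/
noncomputable def phase₁ (N K M τ T : ℕ) (δ : ℝ) : ℕ :=
  ⌈32 * K * M / (τ * δ ^ 2) * Real.log (N * T * M)⌉₊

/-- The number of timeslots of the second exploration phase, for `L` clusters. -/
noncomputable def phase₂ (N K L τ T : ℕ) (δ : ℝ) : ℕ :=
  ⌈16 * N * K * L / (τ ^ 2 * δ ^ 2) * Real.log (L * N * K * T)⌉₊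

/-- The algorithm with `τ` transmissions per timeslot, one for each group. In the first exploration
phase the transmissions go round robin through all messages. Then the messages are clustered by
their averages in context `k₀`. In the second exploration phase the transmissions go round robin
through the representatives of the clusters. Afterwards every group receives the representative
with the largest sum of averages over the users of the group. -/
noncomputable def broadcastPolicy (N K M τ : ℕ) [NeZero M] (T : ℕ) (δ : ℝ) (c : Choices M)
    (k₀ : Fin K) : Policy N K M τ := fun h x g n =>
  let t := h.length
  let T₁ := phase₁ N K M τ T δ
  if t < T₁ then Fin.ofNat M (t * τ + g n)
  else
    -- the part of the history that belongs to the first exploration phase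
    let h₁ := h.drop (t - T₁)
    let A := reps c (cluster c (δ / 2) fun a b => |avg h₁ k₀ a - avg h₁ k₀ b|)
    if t < T₁ + phase₂ N K A.card τ T δ then
      (A.sort (· ≤ ·)).getD (((t - T₁) * τ + g n) % A.card) 0
    else argmax c A fun m => ∑ n' with g n' = g n, avg h (x n') m

end LatentBandit

set_option linter.unusedSectionVars false

namespace LatentBandit

/-! ### Finite factorizations and measurability -/

/-! Everything rests on one exponential supermartingale. For a context `k` and a message `m` let `S`
be the sum and `Z` the number of the payoffs seen so far. By Hoeffding's lemma a payoff in `[0, 1]`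
contributes at most `exp (θ ^ 2 / 8)` to the exponential moment of `θ (S - μ Z)`. Whatever the
adaptive policy does, `expStat`, which is `exp (θ (S - μ Z) - (θ ^ 2 / 8 + c) Z)`, therefore changes
in mean during one slot at most by the factor `E exp (-c #samples)` of that slot
(`lintegral_expStat_succ_le`). With `c = 0` this is a Hoeffding inequality for random sample numbers
(`measure_deviation_le`). With `c = 2 ε ^ 2` and `θ = ± 4 ε` a deviation by `ε` forces one of the
two statistics to be large, however few samples there are. Lack of samples and bad averages are thus
controlled together, and only the decay rate `SampleRate` of `E exp (-c #samples)` enters.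

The discreteness of the means turns small errors into none. Errors below `δ / 4` separate equal from
different types, so that the clusters are exactly the content types (`cluster_eq_typeClasses`).
Errors below `ε` in a group of `g` users with `2 ε g ≤ δ` make the chosen representative exactly
optimal, since sums of means are multiples of `Δ ≥ δ` (`sum_gap_group_nonpos`).

For Algorithm B both phases are round robin, so the number of transmissions of each message is
prescribed and `SampleRate` gives the decay. The representatives are random but known when the
second phase begins. Splitting by their value costs nothing, because the restricted integrals add up
to at most one (`measure_phase_two_le`). The exploration phases lose at most `N` per slot and the
failure events contribute a constant (`regret_broadcast_le`).

For Algorithm A the loss of a user is charged to a transmission with too few samples, to an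
inaccurate average, or to a context with too few samples for clustering (`gap_latent_le`).
Transmissions of the first kind are limited by the threshold plus `N` for each pair of context and
message (`sum_lowPlays_le`), and there are `K s + K L` relevant pairs. The third event would require
that hardly anybody with this context arrived between the slots `√t` and `t`
(`arrivals_le_of_undersampled`), which a Chernoff bound excludes after an initial period. A block
design gives `s ≤ 4 M / √K + 2` (`exists_coversPairs`), which is stronger than the stated bound with
its logarithm.

Measurability is not automatic, since a policy is an arbitrary function of lists. Both algorithms
depend on the history only through finitely many comparisons of statistics (`UsesStatistics`), so
their rules are measurable with respect to the past and take finitely many values. -/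

lemma measurable_of_factor {α β γ : Type*} [MeasurableSpace α] [MeasurableSpace β]
    [MeasurableSpace γ] [DiscreteMeasurableSpace γ] {f : α → β} {g : α → γ} (hg : Measurable g)
    (h : ∀ a a', g a = g a' → f a = f a') : Measurable f := by
  intro s _
  have : f ⁻¹' s = g ⁻¹' (g '' (f ⁻¹' s)) := by
    ext a
    constructor
    · intro ha; exact ⟨a, ha, rfl⟩
    · rintro ⟨b, hb, hab⟩
      have := h b a hab
      simp only [Set.mem_preimage] at hb ⊢
      rwa [← this]
  rw [this]
  exact hg (DiscreteMeasurableSpace.forall_measurableSet _)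

/-- A rule assigns messages to the users, given their contexts and groups. -/
abbrev Rule (N K M τ : ℕ) : Type := (Fin N → Fin K) → (Fin N → Fin τ) → Fin N → Fin M

/-- The sum of the payoffs of message `m` over the users with context `k`. -/
def paySum {N K M : ℕ} (h : List (Slot N K M)) (k : Fin K) (m : Fin M) : ℝ :=
  (h.map fun o => ∑ n with o.ctx n = k ∧ o.msg n = m, o.pay n).sum

section

variable {N K M τ : ℕ} {Ω : Type*} (π : Policy N K M τ) (X : ℕ → Ω → Fin N → Fin K)
  (G : ℕ → Ω → Fin N → Fin τ) (R : ℕ → Ω → Fin N → Fin K → Fin M → ℝ)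

/-- The rule that is used in slot `t`. -/
def ruleAt (t : ℕ) (ω : Ω) : Rule N K M τ := π (history π X G R t ω)

/-- The information from the slots before slot `t`. -/
@[reducible] def past (t : ℕ) : MeasurableSpace Ω :=
  ⨆ s ∈ Set.Iio t, MeasurableSpace.comap (fun ω => (X s ω, G s ω, R s ω)) inferInstance

/-- A policy whose rules are measurable with respect to the statistics of the history. -/
def UsesStatistics : Prop :=
  ∀ (m : MeasurableSpace Ω) (t : ℕ),
    (∀ s ≤ t, ∀ k a, Measurable[m] (fun ω => (count (history π X G R s ω) k a : ℝ))) →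
    (∀ s ≤ t, ∀ k a, Measurable[m] (fun ω => avg (history π X G R s ω) k a)) →
    Measurable[m] (ruleAt π X G R t)

lemma action_eq (t : ℕ) (ω : Ω) :
    action π X G R t ω = ruleAt π X G R t ω (X t ω) (G t ω) := rfl

lemma history_length (t : ℕ) (ω : Ω) : (history π X G R t ω).length = t := by
  induction t with
  | zero => rfl
  | succ t ih => simp [history, ih]

lemma history_drop (s j : ℕ) (ω : Ω) :
    (history π X G R (s + j) ω).drop j = history π X G R s ω := by
  induction j with
  | zero => simp
  | succ j ih => rw [← add_assoc, history]; simpa using ih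

lemma count_zero (ω : Ω) (k : Fin K) (m : Fin M) : count (history π X G R 0 ω) k m = 0 := rfl

lemma paySum_zero (ω : Ω) (k : Fin K) (m : Fin M) : paySum (history π X G R 0 ω) k m = 0 := rfl

lemma count_succ (t : ℕ) (ω : Ω) (k : Fin K) (m : Fin M) :
    count (history π X G R (t + 1) ω) k m =
      (Finset.univ.filter fun n => X t ω n = k ∧ action π X G R t ω n = m).card
        + count (history π X G R t ω) k m := by
  simp only [count, history, List.map_cons, List.sum_cons]
  rfl

lemma paySum_succ (t : ℕ) (ω : Ω) (k : Fin K) (m : Fin M) :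
    paySum (history π X G R (t + 1) ω) k m =
      (∑ n with X t ω n = k ∧ action π X G R t ω n = m, R t ω n k m)
        + paySum (history π X G R t ω) k m := by
  have : (∑ n with X t ω n = k ∧ action π X G R t ω n = m, R t ω n k m) =
      ∑ n with X t ω n = k ∧ action π X G R t ω n = m,
        R t ω n (X t ω n) (action π X G R t ω n) := by
    refine Finset.sum_congr rfl fun n hn => ?_
    simp only [Finset.mem_filter] at hn
    rw [hn.2.1, hn.2.2]
  rw [this]
  simp only [paySum, history, List.map_cons, List.sum_cons]
  rfl

lemma avg_eq (h : List (Slot N K M)) (k : Fin K) (m : Fin M) :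
    avg h k m = paySum h k m / count h k m := rfl

lemma count_mono {s t : ℕ} (hst : s ≤ t) (ω : Ω) (k : Fin K) (m : Fin M) :
    count (history π X G R s ω) k m ≤ count (history π X G R t ω) k m := by
  induction t, hst using Nat.le_induction with
  | base => exact le_rfl
  | succ t _ ih => rw [count_succ]; omega

lemma past_mono {s t : ℕ} (hst : s ≤ t) : past X G R s ≤ past X G R t :=
  biSup_mono fun _ hi => lt_of_lt_of_le hi hst

variable {π X G R}

lemma measurable_slot_past {s t : ℕ} (hst : s < t) :
    Measurable[past X G R t] (fun ω => (X s ω, G s ω, R s ω)) := by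
  rw [measurable_iff_comap_le]
  exact le_biSup (fun s => MeasurableSpace.comap (fun ω => (X s ω, G s ω, R s ω)) inferInstance)
    (show s ∈ Set.Iio t from hst)

/-- The induction must be simultaneous for counts and sums: the statistics up to slot `t` make the
rule of slot `t` measurable, the rule makes the actions measurable, and these determine the
increments of both statistics. -/
lemma measurable_stats_aux (hπ : UsesStatistics π X G R) (t : ℕ) :
    (∀ s ≤ t, ∀ k a, Measurable[past X G R t]
      (fun ω => (count (history π X G R s ω) k a : ℝ))) ∧
    (∀ s ≤ t, ∀ k a, Measurable[past X G R t] (fun ω => paySum (history π X G R s ω) k a)) := by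
  induction t with
  | zero =>
    refine ⟨fun s hs k a => ?_, fun s hs k a => ?_⟩ <;> obtain rfl : s = 0 := by omega
    · simp only [count_zero]; exact measurable_const
    · simp only [paySum_zero]; exact measurable_const
  | succ t ih =>
    have hle := past_mono X G R (Nat.le_succ t)
    have hrule : Measurable[past X G R (t + 1)] (ruleAt π X G R t) :=
      (hπ (past X G R t) t ih.1 fun s hs k a => (ih.2 s hs k a).div (ih.1 s hs k a)).mono hle le_rfl
    let _ : MeasurableSpace Ω := past X G R (t + 1)
    have hslot : Measurable (fun ω => (X t ω, G t ω, R t ω)) :=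
      measurable_slot_past (Nat.lt_succ_self t)
    have hX : Measurable (X t) := hslot.fst
    have hG : Measurable (G t) := hslot.snd.fst
    have hR : Measurable (R t) := hslot.snd.snd
    have hact : Measurable (action π X G R t) :=
      measurable_of_factor (g := fun ω => (ruleAt π X G R t ω, X t ω, G t ω))
        (hrule.prodMk (hX.prodMk hG)) fun a a' h => by
          simp only [Prod.mk.injEq] at h
          rw [action_eq, action_eq, h.1, h.2.1, h.2.2]
    have hset : ∀ k a n, MeasurableSet {ω | X t ω n = k ∧ action π X G R t ω n = a} :=
      fun k a n =>
      (measurableSet_eq_fun ((measurable_pi_apply n).comp hX) measurable_const).inter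
        (measurableSet_eq_fun ((measurable_pi_apply n).comp hact) measurable_const)
    refine ⟨fun s hs k a => ?_, fun s hs k a => ?_⟩
    · rcases Nat.lt_or_ge t s with h | h
      · obtain rfl : s = t + 1 := by omega
        simp only [count_succ, Nat.cast_add]
        refine Measurable.add ?_ ((ih.1 t le_rfl k a).mono hle le_rfl)
        simp only [Finset.card_filter, Nat.cast_sum, Nat.cast_ite, Nat.cast_one, Nat.cast_zero]
        exact Finset.measurable_sum _ fun n _ =>
          Measurable.ite (hset k a n) measurable_const measurable_const
      · exact (ih.1 s h k a).mono hle le_rfl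
    · rcases Nat.lt_or_ge t s with h | h
      · obtain rfl : s = t + 1 := by omega
        simp only [paySum_succ]
        refine Measurable.add ?_ ((ih.2 t le_rfl k a).mono hle le_rfl)
        simp only [Finset.sum_filter]
        exact Finset.measurable_sum _ fun n _ =>
          Measurable.ite (hset k a n) (measurable_pi_iff.mp (measurable_pi_iff.mp
            (measurable_pi_iff.mp hR n) k) a) measurable_const
      · exact (ih.2 s h k a).mono hle le_rfl

lemma measurable_count_past (hπ : UsesStatistics π X G R) {s t : ℕ} (hst : s ≤ t) (k : Fin K)
    (a : Fin M) : Measurable[past X G R t] (fun ω => (count (history π X G R s ω) k a : ℝ)) :=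
  (measurable_stats_aux hπ t).1 s hst k a

lemma measurable_paySum_past (hπ : UsesStatistics π X G R) {s t : ℕ} (hst : s ≤ t) (k : Fin K)
    (a : Fin M) : Measurable[past X G R t] (fun ω => paySum (history π X G R s ω) k a) :=
  (measurable_stats_aux hπ t).2 s hst k a

lemma measurable_avg_past (hπ : UsesStatistics π X G R) {s t : ℕ} (hst : s ≤ t) (k : Fin K)
    (a : Fin M) : Measurable[past X G R t] (fun ω => avg (history π X G R s ω) k a) :=
  (measurable_paySum_past hπ hst k a).div (measurable_count_past hπ hst k a)

lemma measurable_ruleAt_past (hπ : UsesStatistics π X G R) (t : ℕ) :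
    Measurable[past X G R t] (ruleAt π X G R t) :=
  hπ _ t (fun _ hs k a => measurable_count_past hπ hs k a)
    fun _ hs k a => measurable_avg_past hπ hs k a

/-! ### Independence of a slot from the past -/

section Model

variable [mΩ : MeasurableSpace Ω] {P : Measure Ω} {D : Fin K → Fin M → Measure ℝ}

lemma IsBroadcastModel.measurable_slot (hB : IsBroadcastModel P D X G R) (t : ℕ) :
    Measurable (fun ω => (X t ω, G t ω, R t ω)) :=
  (hB.measurable_ctx t).prodMk ((hB.measurable_grp t).prodMk (hB.measurable_pay t))

lemma IsBroadcastModel.past_le (hB : IsBroadcastModel P D X G R) (t : ℕ) :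
    past X G R t ≤ mΩ :=
  iSup₂_le fun s _ => (hB.measurable_slot s).comap_le

lemma IsBroadcastModel.indep_past (hB : IsBroadcastModel P D X G R) (t : ℕ) :
    Indep (past X G R t)
      (MeasurableSpace.comap (fun ω => (X t ω, G t ω, R t ω)) inferInstance) P := by
  have h := indep_iSup_of_disjoint (μ := P)
    (m := fun s => MeasurableSpace.comap (fun ω => (X s ω, G s ω, R s ω)) inferInstance)
    (fun s => (hB.measurable_slot s).comap_le) hB.indep_slots (S := Set.Iio t) (T := {t})
    (by simp)
  rwa [iSup_singleton] at h

-- There are only finitely many rules. On each event `α = r` the slot enters through the fixed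
-- function `Ψ r`, which is independent of everything in the past, so the integral factorizes.
open Classical in
lemma IsBroadcastModel.lintegral_past_slot (hB : IsBroadcastModel P D X G R) {t : ℕ}
    {α : Ω → Rule N K M τ} (hα : Measurable[past X G R t] α) {V : Ω → ENNReal}
    (hV : Measurable[past X G R t] V)
    {Ψ : Rule N K M τ → (Fin N → Fin K) × (Fin N → Fin τ) × (Fin N → Fin K → Fin M → ℝ) → ENNReal}
    (hΨ : ∀ r, Measurable (Ψ r)) :
    ∫⁻ ω, V ω * Ψ (α ω) (X t ω, G t ω, R t ω) ∂P =
      ∑ r, (∫⁻ ω, (if α ω = r then V ω else 0) ∂P) * ∫⁻ ω, Ψ r (X t ω, G t ω, R t ω) ∂P := by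
  have hVr : ∀ r, Measurable[past X G R t] (fun ω => if α ω = r then V ω else 0) := fun r =>
    let _ : MeasurableSpace Ω := past X G R t
    Measurable.ite (hα (measurableSet_singleton r)) hV measurable_const
  have hslot : Measurable[MeasurableSpace.comap (fun ω => (X t ω, G t ω, R t ω)) inferInstance]
      (fun ω => (X t ω, G t ω, R t ω)) := comap_measurable _
  calc ∫⁻ ω, V ω * Ψ (α ω) (X t ω, G t ω, R t ω) ∂P
      = ∫⁻ ω, ∑ r, (if α ω = r then V ω else 0) * Ψ r (X t ω, G t ω, R t ω) ∂P := by
        refine lintegral_congr fun ω => ?_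
        simp [ite_mul, Finset.sum_ite_eq]
    _ = ∑ r, ∫⁻ ω, (if α ω = r then V ω else 0) * Ψ r (X t ω, G t ω, R t ω) ∂P := by
        refine lintegral_finsetSum _ fun r _ => ?_
        exact ((hVr r).mono (hB.past_le t) le_rfl).mul ((hΨ r).comp (hB.measurable_slot t))
    _ = _ := by
        refine Finset.sum_congr rfl fun r _ => ?_
        exact lintegral_mul_eq_lintegral_mul_lintegral_of_independent_measurableSpace
          (hB.past_le t) (hB.measurable_slot t).comap_le (hB.indep_past t) (hVr r)
          ((hΨ r).comp hslot)

-- Contexts and groups take finitely many values, and for each value the independent payoffs of the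
-- slot can be replaced by a fresh copy. This is Fubini's theorem without a product space.
open Classical in
lemma IsBroadcastModel.lintegral_slot (hB : IsBroadcastModel P D X G R) (t : ℕ)
    {Ψ : (Fin N → Fin K) → (Fin N → Fin τ) → (Fin N → Fin K → Fin M → ℝ) → ENNReal}
    (hΨ : ∀ x g, Measurable (Ψ x g)) :
    ∫⁻ ω, Ψ (X t ω) (G t ω) (R t ω) ∂P =
      ∫⁻ ω, ∫⁻ ω', Ψ (X t ω) (G t ω) (R t ω') ∂P ∂P := by
  have hXG : Measurable (fun ω => (X t ω, G t ω)) := (hB.measurable_ctx t).prodMk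
    (hB.measurable_grp t)
  have key : ∀ Φ : ((Fin N → Fin K) × (Fin N → Fin τ)) → Ω → ENNReal,
      (∀ p, Measurable (Φ p)) → ∫⁻ ω, Φ (X t ω, G t ω) ω ∂P =
        ∑ p, ∫⁻ ω, (if (X t ω, G t ω) = p then 1 else 0) * Φ p ω ∂P := by
    intro Φ hΦ
    rw [← lintegral_finsetSum]
    · refine lintegral_congr fun ω => ?_
      simp [ite_mul, Finset.sum_ite_eq]
    · intro p _
      exact (Measurable.ite (hXG (measurableSet_singleton p)) measurable_const
        measurable_const).mul (hΦ p)
  rw [key (fun p ω => Ψ p.1 p.2 (R t ω)) fun p => (hΨ p.1 p.2).comp (hB.measurable_pay t),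
    key (fun p _ => ∫⁻ ω', Ψ p.1 p.2 (R t ω') ∂P) fun p => measurable_const]
  refine Finset.sum_congr rfl fun p _ => ?_
  have h1 : Measurable (fun q : (Fin N → Fin K) × (Fin N → Fin τ) =>
    (if q = p then (1 : ENNReal) else 0)) := Measurable.of_discrete
  have h2 := (hB.indep_pay t).comp h1 (hΨ p.1 p.2)
  have h3 : Measurable fun ω => if (X t ω, G t ω) = p then (1 : ENNReal) else 0 := h1.comp hXG
  rw [lintegral_mul_const _ h3]
  exact lintegral_mul_eq_lintegral_mul_lintegral_of_indepFun (h1.comp hXG)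
    ((hΨ p.1 p.2).comp (hB.measurable_pay t)) h2

/-- The payoffs of a slot may be integrated out, the other data being fixed. -/
lemma IsBroadcastModel.lintegral_integrate_pay (hB : IsBroadcastModel P D X G R) {t : ℕ}
    {α : Ω → Rule N K M τ} (hα : Measurable[past X G R t] α) {V : Ω → ENNReal}
    (hV : Measurable[past X G R t] V)
    {Ψ : Rule N K M τ → (Fin N → Fin K) → (Fin N → Fin τ) →
      (Fin N → Fin K → Fin M → ℝ) → ENNReal} (hΨ : ∀ r x g, Measurable (Ψ r x g)) :
    ∫⁻ ω, V ω * Ψ (α ω) (X t ω) (G t ω) (R t ω) ∂P =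
      ∫⁻ ω, V ω * ∫⁻ ω', Ψ (α ω) (X t ω) (G t ω) (R t ω') ∂P ∂P := by
  have h1 := hB.lintegral_past_slot hα hV (Ψ := fun r p => Ψ r p.1 p.2.1 p.2.2) fun r => by
    have : Measurable (fun q : ((Fin N → Fin K) × (Fin N → Fin τ)) ×
        (Fin N → Fin K → Fin M → ℝ) => Ψ r q.1.1 q.1.2 q.2) :=
      measurable_from_prod_countable_right fun p => hΨ r p.1 p.2
    exact this.comp (g := fun q : ((Fin N → Fin K) × (Fin N → Fin τ)) ×
        (Fin N → Fin K → Fin M → ℝ) => Ψ r q.1.1 q.1.2 q.2)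
        ((measurable_fst.prodMk measurable_snd.fst).prodMk measurable_snd.snd)
  have h2 := hB.lintegral_past_slot hα hV
    (Ψ := fun r p => ∫⁻ ω', Ψ r p.1 p.2.1 (R t ω') ∂P) fun r => by
      have : Measurable (fun q : (Fin N → Fin K) × (Fin N → Fin τ) =>
        ∫⁻ ω', Ψ r q.1 q.2 (R t ω') ∂P) := Measurable.of_discrete
      exact this.comp (measurable_fst.prodMk measurable_snd.fst)
  simp only at h1 h2
  rw [h1, h2]
  refine Finset.sum_congr rfl fun r _ => ?_
  rw [hB.lintegral_slot t (hΨ r)]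

/-- A slot contributes at most the factor `b`, if it does so for every rule that can occur. -/
lemma IsBroadcastModel.lintegral_mul_le (hB : IsBroadcastModel P D X G R) {t : ℕ}
    {α : Ω → Rule N K M τ} (hα : Measurable[past X G R t] α) {V : Ω → ENNReal}
    (hV : Measurable[past X G R t] V)
    {w : Rule N K M τ → (Fin N → Fin K) → (Fin N → Fin τ) → ENNReal} {b : ENNReal}
    (hb : ∀ ω, V ω ≠ 0 → ∫⁻ ω', w (α ω) (X t ω') (G t ω') ∂P ≤ b) :
    ∫⁻ ω, V ω * w (α ω) (X t ω) (G t ω) ∂P ≤ b * ∫⁻ ω, V ω ∂P := by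
  classical
  have h1 := hB.lintegral_past_slot hα hV (Ψ := fun r p => w r p.1 p.2.1) fun r => by
    have : Measurable (fun q : (Fin N → Fin K) × (Fin N → Fin τ) => w r q.1 q.2) :=
      Measurable.of_discrete
    exact this.comp (measurable_fst.prodMk measurable_snd.fst)
  have h2 := hB.lintegral_past_slot hα hV (Ψ := fun _ _ => b) fun r => measurable_const
  have := hB.prob
  simp only [lintegral_const, measure_univ, mul_one] at h1 h2
  rw [h1, mul_comm b, ← lintegral_mul_const _ (hV.mono (hB.past_le t) le_rfl), h2]
  refine Finset.sum_le_sum fun r _ => ?_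
  -- The bound is assumed only for rules that occur together with a nonzero weight; all other terms
  -- vanish.
  by_cases hr : ∃ ω, α ω = r ∧ V ω ≠ 0
  · obtain ⟨ω, rfl, hω⟩ := hr
    gcongr
    exact hb ω hω
  · have : ∀ ω, (if α ω = r then V ω else 0) = 0 := by
      intro ω
      split_ifs with h
      · by_contra h'; exact hr ⟨ω, h, h'⟩
      · rfl
    simp [this]

end Model

end

/-! ### Exponential statistics -/

section

variable {N K M τ L : ℕ} {Ω : Type*} [mΩ : MeasurableSpace Ω] {P : Measure Ω}
  {π : Policy N K M τ} {X : ℕ → Ω → Fin N → Fin K}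
  {G : ℕ → Ω → Fin N → Fin τ} {R : ℕ → Ω → Fin N → Fin K → Fin M → ℝ}
  {D : Fin K → Fin M → Measure ℝ} {δ : ℝ} {typ : Fin M → Fin L}

lemma IsBroadcastModel.measurable_pay_apply (hB : IsBroadcastModel P D X G R) (t : ℕ) (n : Fin N)
    (k : Fin K) (m : Fin M) : Measurable (fun ω => R t ω n k m) :=
  measurable_pi_iff.mp (measurable_pi_iff.mp (measurable_pi_iff.mp (hB.measurable_pay t) n) k) m

lemma IsBroadcastModel.pay_mem_Icc (hB : IsBroadcastModel P D X G R) (hD : IsLatentPayoff δ D typ)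
    (t : ℕ) (n : Fin N) (k : Fin K) (m : Fin M) :
    ∀ᵐ ω ∂P, R t ω n k m ∈ Set.Icc (0 : ℝ) 1 := by
  refine ae_of_ae_map (hB.measurable_pay_apply t n k m).aemeasurable (p := (· ∈ Set.Icc (0 : ℝ) 1))
    ?_
  rw [hB.pay_law]
  exact hD.mem_Icc k m

lemma IsBroadcastModel.integral_pay (hB : IsBroadcastModel P D X G R)
    (t : ℕ) (n : Fin N) (k : Fin K) (m : Fin M) :
    ∫ ω, R t ω n k m ∂P = meanPayoff D k m := by
  rw [meanPayoff, ← hB.pay_law t n k m]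
  exact (integral_map (hB.measurable_pay_apply t n k m).aemeasurable
    aestronglyMeasurable_id).symm

lemma IsLatentPayoff.mean_mem_Icc (hD : IsLatentPayoff δ D typ) (k : Fin K) (m : Fin M) :
    meanPayoff D k m ∈ Set.Icc (0 : ℝ) 1 := by
  have := hD.prob k m
  have hint : Integrable (fun r : ℝ => r) (D k m) :=
    Integrable.of_mem_Icc 0 1 aemeasurable_id (hD.mem_Icc k m)
  constructor
  · exact integral_nonneg_of_ae (by filter_upwards [hD.mem_Icc k m] with r hr using hr.1)
  · have : meanPayoff D k m ≤ ∫ _, (1 : ℝ) ∂(D k m) :=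
      integral_mono_ae hint (integrable_const _)
        (by filter_upwards [hD.mem_Icc k m] with r hr using hr.2)
    simpa using this

/-- Hoeffding's lemma: a variable in `[0, 1]` is sub-Gaussian with variance proxy `1 / 4`, and the
proxies of independent users add up. -/
lemma IsBroadcastModel.lintegral_exp_pay_le (hB : IsBroadcastModel P D X G R)
    (hD : IsLatentPayoff δ D typ) (t : ℕ) (k : Fin K) (m : Fin M) (θ : ℝ) (B : Finset (Fin N)) :
    ∫⁻ ω, ENNReal.ofReal (Real.exp (θ * ∑ n ∈ B, (R t ω n k m - meanPayoff D k m))) ∂P ≤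
      ENNReal.ofReal (Real.exp (θ ^ 2 / 8 * B.card)) := by
  have := hB.prob
  have h1 : ∀ n ∈ B, HasSubgaussianMGF (fun ω => R t ω n k m - meanPayoff D k m)
      ((‖(1 : ℝ) - 0‖₊ / 2) ^ 2) P := fun n _ => by
    have := hasSubgaussianMGF_of_mem_Icc (hB.measurable_pay_apply t n k m).aemeasurable
      (hB.pay_mem_Icc hD t n k m)
    rwa [hB.integral_pay] at this
  have h2 : iIndepFun (fun (n : Fin N) (ω : Ω) => R t ω n k m - meanPayoff D k m) P :=
    (hB.indep_users t).comp (fun _ (ρ : Fin K → Fin M → ℝ) => ρ k m - meanPayoff D k m) fun _ =>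
      (((measurable_pi_apply m).comp (measurable_pi_apply k))).sub_const _
  have h3 := HasSubgaussianMGF.sum_of_iIndepFun h2 h1
  have h4 := h3.mgf_le θ
  rw [← ofReal_integral_eq_lintegral_ofReal (h3.integrable_exp_mul θ)
    (Filter.Eventually.of_forall fun _ => (Real.exp_pos _).le)]
  refine ENNReal.ofReal_le_ofReal (h4.trans (Real.exp_le_exp.mpr (le_of_eq ?_)))
  simp
  ring

variable (π X G R D) in
/-- The exponential of the deviation of the payoffs of message `m` in context `k` from their mean,
with a compensation that is linear in the number of samples. -/
noncomputable def expStat (θ c : ℝ) (k : Fin K) (m : Fin M) (t : ℕ) (ω : Ω) : ENNReal :=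
  ENNReal.ofReal (Real.exp (θ * (paySum (history π X G R t ω) k m
    - meanPayoff D k m * count (history π X G R t ω) k m)
      - (θ ^ 2 / 8 + c) * count (history π X G R t ω) k m))

lemma measurable_expStat (hπ : UsesStatistics π X G R) (θ c : ℝ) (k : Fin K) (m : Fin M) (t : ℕ) :
    Measurable[past X G R t] (expStat π X G R D θ c k m t) := by
  let _ : MeasurableSpace Ω := past X G R t
  have h1 := measurable_paySum_past hπ le_rfl k m (t := t)
  have h2 := measurable_count_past hπ le_rfl k m (t := t)
  exact ENNReal.measurable_ofReal.comp (Real.measurable_exp.comp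
    (((h1.sub (h2.const_mul _)).const_mul θ).sub (h2.const_mul _)))

/-- The supermartingale step. The new factor depends on the payoffs only through the users who
receive `m` in context `k`. Integrating these payoffs out cancels `θ ^ 2 / 8` per sample and leaves
`exp (-c #samples)`. The weight `V` allows restriction to an event of the past. -/
lemma lintegral_expStat_succ_le (hB : IsBroadcastModel P D X G R) (hD : IsLatentPayoff δ D typ)
    (hπ : UsesStatistics π X G R) {t : ℕ} (θ c : ℝ) (k : Fin K) (m : Fin M) {V : Ω → ENNReal}
    (hV : Measurable[past X G R t] V) {b : ENNReal}
    (hb : ∀ ω, V ω ≠ 0 → ∫⁻ ω', ENNReal.ofReal (Real.exp (-c * (Finset.univ.filter fun n =>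
      X t ω' n = k ∧ ruleAt π X G R t ω (X t ω') (G t ω') n = m).card)) ∂P ≤ b) :
    ∫⁻ ω, V ω * expStat π X G R D θ c k m (t + 1) ω ∂P ≤
      b * ∫⁻ ω, V ω * expStat π X G R D θ c k m t ω ∂P := by
  let S (r : Rule N K M τ) (x : Fin N → Fin K) (g : Fin N → Fin τ) : Finset (Fin N) :=
    Finset.univ.filter fun n => x n = k ∧ r x g n = m
  let Ψ (r : Rule N K M τ) (x : Fin N → Fin K) (g : Fin N → Fin τ)
      (ρ : Fin N → Fin K → Fin M → ℝ) : ENNReal :=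
    ENNReal.ofReal (Real.exp (θ * ∑ n ∈ S r x g, (ρ n k m - meanPayoff D k m))) *
      ENNReal.ofReal (Real.exp (-(θ ^ 2 / 8 + c) * (S r x g).card))
  have hΨ : ∀ r x g, Measurable (Ψ r x g) := fun r x g => by
    refine Measurable.mul_const ?_ _
    refine ENNReal.measurable_ofReal.comp (Real.measurable_exp.comp (Measurable.const_mul ?_ θ))
    refine Finset.measurable_sum _ fun n _ => Measurable.sub_const ?_ _
    exact (measurable_pi_apply m).comp ((measurable_pi_apply k).comp (measurable_pi_apply n))
  have hstep : ∀ ω, V ω * expStat π X G R D θ c k m (t + 1) ω =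
      (V ω * expStat π X G R D θ c k m t ω) *
        Ψ (ruleAt π X G R t ω) (X t ω) (G t ω) (R t ω) := by
    intro ω
    rw [mul_assoc]
    congr 1
    simp only [expStat, Ψ, count_succ, paySum_succ,
      show (Finset.univ.filter fun n => X t ω n = k ∧ action π X G R t ω n = m) =
        S (ruleAt π X G R t ω) (X t ω) (G t ω) from rfl]
    rw [← ENNReal.ofReal_mul (Real.exp_pos _).le, ← ENNReal.ofReal_mul (Real.exp_pos _).le,
      ← Real.exp_add, ← Real.exp_add, Finset.sum_sub_distrib, Finset.sum_const, nsmul_eq_mul]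
    congr 2
    push_cast
    ring
  have hα := measurable_ruleAt_past hπ t
  have hVU : Measurable[past X G R t] fun ω => V ω * expStat π X G R D θ c k m t ω :=
    Measurable.mul hV (measurable_expStat hπ θ c k m t)
  simp_rw [hstep]
  rw [hB.lintegral_integrate_pay hα hVU hΨ]
  refine le_trans (lintegral_mono fun ω => mul_le_mul_right ?_ _)
    (hB.lintegral_mul_le hα hVU (w := fun r x g =>
      ENNReal.ofReal (Real.exp (-c * (S r x g).card))) (b := b) fun ω hω =>
        hb ω (left_ne_zero_of_mul hω))
  simp only [Ψ]
  rw [lintegral_mul_const' _ _ ENNReal.ofReal_ne_top]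
  refine (mul_le_mul_left (hB.lintegral_exp_pay_le hD t k m θ _) _).trans (le_of_eq ?_)
  rw [← ENNReal.ofReal_mul (Real.exp_pos _).le, ← Real.exp_add]
  congr 2
  ring

lemma IsBroadcastModel.lintegral_exp_neg_le_one (hB : IsBroadcastModel P D X G R) {c : ℝ}
    (hc : 0 ≤ c) (f : Ω → ℕ) :
    ∫⁻ ω, ENNReal.ofReal (Real.exp (-c * f ω)) ∂P ≤ 1 := by
  have := hB.prob
  calc _ ≤ ∫⁻ _, 1 ∂P := lintegral_mono fun ω => by
        rw [← ENNReal.ofReal_one]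
        refine ENNReal.ofReal_le_ofReal (Real.exp_le_one_iff.mpr ?_)
        have : (0 : ℝ) ≤ f ω := Nat.cast_nonneg _
        nlinarith
    _ = 1 := by simp

/-- This keeps averages under control during exploitation, when further samples are collected
adaptively: the bound reached at the end of a prescribed phase persists. -/
lemma lintegral_expStat_antitone (hB : IsBroadcastModel P D X G R) (hD : IsLatentPayoff δ D typ)
    (hπ : UsesStatistics π X G R) {s t : ℕ} (hst : s ≤ t) (θ : ℝ) {c : ℝ} (hc : 0 ≤ c)
    (k : Fin K) (m : Fin M) {V : Ω → ENNReal} (hV : Measurable[past X G R s] V) :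
    ∫⁻ ω, V ω * expStat π X G R D θ c k m t ω ∂P ≤
      ∫⁻ ω, V ω * expStat π X G R D θ c k m s ω ∂P := by
  induction t, hst using Nat.le_induction with
  | base => exact le_rfl
  | succ t hst ih =>
    refine le_trans ?_ ih
    have := lintegral_expStat_succ_le hB hD hπ (t := t) θ c k m
      (hV.mono (past_mono X G R hst) le_rfl) (b := 1)
      fun ω _ => hB.lintegral_exp_neg_le_one hc _
    rwa [one_mul] at this

lemma expStat_zero (θ c : ℝ) (k : Fin K) (m : Fin M) (ω : Ω) :
    expStat π X G R D θ c k m 0 ω = 1 := by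
  simp [expStat, count_zero, paySum_zero]

lemma lintegral_expStat_le_one (hB : IsBroadcastModel P D X G R) (hD : IsLatentPayoff δ D typ)
    (hπ : UsesStatistics π X G R) (t : ℕ) (θ : ℝ) {c : ℝ} (hc : 0 ≤ c) (k : Fin K) (m : Fin M) :
    ∫⁻ ω, expStat π X G R D θ c k m t ω ∂P ≤ 1 := by
  have := hB.prob
  have := lintegral_expStat_antitone hB hD hπ (Nat.zero_le t) θ hc k m (V := fun _ => 1)
    measurable_const
  simpa [expStat_zero] using this

lemma le_abs_paySum_sub {t : ℕ} {ω : Ω} {k : Fin K} {m : Fin M} {ε ν : ℝ}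
    (h : ε ≤ |avg (history π X G R t ω) k m - ν|) :
    ε * count (history π X G R t ω) k m ≤
      |paySum (history π X G R t ω) k m - ν * count (history π X G R t ω) k m| := by
  -- Without samples both sides vanish, so the default value `0` of the average does no harm.
  rcases Nat.eq_zero_or_pos (count (history π X G R t ω) k m) with h0 | h0
  · simp [h0]
  · have h1 : (0 : ℝ) < count (history π X G R t ω) k m := by exact_mod_cast h0
    rw [avg_eq] at h
    calc _ ≤ |paySum (history π X G R t ω) k m / count (history π X G R t ω) k m - ν| *
          |(count (history π X G R t ω) k m : ℝ)| := by
          rw [abs_of_pos h1]; gcongr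
      _ = _ := by
          rw [← abs_mul]; congr 1; field_simp

/-- If an average is off by `ε`, one of two exponential statistics is large. -/
lemma one_le_expStat {t : ℕ} {ω : Ω} {k : Fin K} {m : Fin M} {ε c q : ℝ} (hε : 0 ≤ ε)
    (h : ε ≤ |avg (history π X G R t ω) k m - meanPayoff D k m|)
    (hq : q ≤ (2 * ε ^ 2 - c) * count (history π X G R t ω) k m) :
    ENNReal.ofReal (Real.exp q) ≤ expStat π X G R D (4 * ε) c k m t ω +
      expStat π X G R D (-(4 * ε)) c k m t ω := by
  have h1 := le_abs_paySum_sub h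
  -- The value `θ = 4 ε` maximizes `θ ε - θ ^ 2 / 8`; the maximum is `2 ε ^ 2` per sample.
  have h2 : 4 * ε * (ε * count (history π X G R t ω) k m) ≤ 4 * ε *
      |paySum (history π X G R t ω) k m - meanPayoff D k m * count (history π X G R t ω) k m| := by
    gcongr
  rcases abs_cases (paySum (history π X G R t ω) k m
    - meanPayoff D k m * count (history π X G R t ω) k m) with h3 | h3
  · refine le_add_right (ENNReal.ofReal_le_ofReal (Real.exp_le_exp.mpr ?_))
    rw [h3.1] at h2
    nlinarith
  · refine le_add_left (ENNReal.ofReal_le_ofReal (Real.exp_le_exp.mpr ?_))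
    rw [h3.1] at h2
    nlinarith

/-- An adaptive Hoeffding inequality: it is unlikely that the average of at least `q` samples is off
by `ε`. -/
lemma measure_deviation_le (hB : IsBroadcastModel P D X G R) (hD : IsLatentPayoff δ D typ)
    (hπ : UsesStatistics π X G R) (t : ℕ) (k : Fin K) (m : Fin M) {ε : ℝ} (hε : 0 ≤ ε) (q : ℝ) :
    P {ω | q ≤ count (history π X G R t ω) k m ∧
      ε ≤ |avg (history π X G R t ω) k m - meanPayoff D k m|} ≤
      ENNReal.ofReal (2 * Real.exp (-(2 * ε ^ 2 * q))) := by
  have hm : ∀ θ, Measurable (expStat π X G R D θ 0 k m t) := fun θ =>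
    (measurable_expStat hπ θ 0 k m t).mono (hB.past_le t) le_rfl
  -- Markov's inequality for the sum of the statistics with `θ = ± 4 ε` and `c = 0`, each of mean at
  -- most one.
  have h1 : ENNReal.ofReal (Real.exp (2 * ε ^ 2 * q)) *
      P {ω | q ≤ count (history π X G R t ω) k m ∧
        ε ≤ |avg (history π X G R t ω) k m - meanPayoff D k m|} ≤ 2 := by
    calc _ ≤ ENNReal.ofReal (Real.exp (2 * ε ^ 2 * q)) *
          P {ω | ENNReal.ofReal (Real.exp (2 * ε ^ 2 * q)) ≤
            expStat π X G R D (4 * ε) 0 k m t ω + expStat π X G R D (-(4 * ε)) 0 k m t ω} := by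
          refine mul_le_mul_right (measure_mono fun ω hω => ?_) _
          refine one_le_expStat hε hω.2 ?_
          rw [sub_zero]
          exact mul_le_mul_of_nonneg_left hω.1 (by positivity)
      _ ≤ ∫⁻ ω, (expStat π X G R D (4 * ε) 0 k m t ω +
            expStat π X G R D (-(4 * ε)) 0 k m t ω) ∂P :=
          mul_meas_ge_le_lintegral ((hm _).add (hm _)) _
      _ ≤ 1 + 1 := by
          rw [lintegral_add_left (hm _)]
          exact add_le_add (lintegral_expStat_le_one hB hD hπ t _ le_rfl k m)
            (lintegral_expStat_le_one hB hD hπ t _ le_rfl k m)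
      _ = 2 := one_add_one_eq_two
  rw [mul_comm] at h1
  have h2 := (ENNReal.le_div_iff_mul_le (Or.inl (by simp [Real.exp_pos]))
    (Or.inl ENNReal.ofReal_ne_top)).mpr h1
  refine h2.trans (le_of_eq ?_)
  rw [Real.exp_neg, ← div_eq_mul_inv, ENNReal.ofReal_div_of_pos (Real.exp_pos _)]
  simp

end

/-! ### Clustering by a distance that separates the content types -/

section Clustering

variable {M L : ℕ}

/-- Nonemptiness is essential: the real supremum over an empty family is `0` by convention. -/
lemma clusterDist_lt_iff {d : Fin M → Fin M → ℝ} {p : Finset (Fin M) × Finset (Fin M)} {θ : ℝ}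
    (h1 : p.1.Nonempty) (h2 : p.2.Nonempty) :
    clusterDist d p < θ ↔ ∀ a ∈ p.1, ∀ b ∈ p.2, d a b < θ := by
  have : Nonempty ↥(p.1 ×ˢ p.2) := (h1.product h2).to_subtype
  constructor
  · intro h a ha b hb
    exact lt_of_le_of_lt (le_ciSup (f := fun q : ↥(p.1 ×ˢ p.2) => d q.1.1 q.1.2)
      (Set.finite_range _).bddAbove ⟨(a, b), Finset.mem_product.mpr ⟨ha, hb⟩⟩) h
  · intro h
    obtain ⟨i, hi⟩ := exists_eq_ciSup_of_finite (f := fun q : ↥(p.1 ×ˢ p.2) => d q.1.1 q.1.2)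
    rw [clusterDist, ← hi]
    have := Finset.mem_product.mp i.2
    exact h _ this.1 _ this.2

open Classical in
/-- The pairs of clusters that may be united. -/
noncomputable def mergeCand (θ : ℝ) (d : Fin M → Fin M → ℝ) (𝒞 : Finset (Finset (Fin M))) :
    Finset (Finset (Fin M) × Finset (Fin M)) :=
  𝒞.offDiag.filter fun p =>
    clusterDist d p < θ ∧ ∀ q ∈ 𝒞.offDiag, clusterDist d p ≤ clusterDist d q

lemma mergeStep_of_nonempty {c : Choices M} {θ : ℝ} {d : Fin M → Fin M → ℝ}
    {𝒞 : Finset (Finset (Fin M))} (h : (mergeCand θ d 𝒞).Nonempty) :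
    mergeStep c θ d 𝒞 = insert ((c.pair (mergeCand θ d 𝒞)).1 ∪ (c.pair (mergeCand θ d 𝒞)).2)
      ((𝒞.erase (c.pair (mergeCand θ d 𝒞)).1).erase (c.pair (mergeCand θ d 𝒞)).2) :=
  if_pos h

lemma mergeStep_of_not_nonempty {c : Choices M} {θ : ℝ} {d : Fin M → Fin M → ℝ}
    {𝒞 : Finset (Finset (Fin M))} (h : ¬ (mergeCand θ d 𝒞).Nonempty) :
    mergeStep c θ d 𝒞 = 𝒞 :=
  if_neg h

/-- A partition of the messages into sets of messages of the same type. -/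
structure IsTypePartition (typ : Fin M → Fin L) (𝒞 : Finset (Finset (Fin M))) : Prop where
  nonempty : ∀ C ∈ 𝒞, C.Nonempty
  typ_eq : ∀ C ∈ 𝒞, ∀ a ∈ C, ∀ b ∈ C, typ a = typ b
  disjoint : ∀ C ∈ 𝒞, ∀ C' ∈ 𝒞, C ≠ C' → Disjoint C C'
  cover : ∀ a, ∃ C ∈ 𝒞, a ∈ C

variable {typ : Fin M → Fin L} {c : Choices M} {θ : ℝ} {d : Fin M → Fin M → ℝ}
  {𝒞 : Finset (Finset (Fin M))}

/-- The loop invariant. Two clusters at distance below `θ` have all cross distances below `θ`, hence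
all their messages have one common type. -/
lemma IsTypePartition.mergeStep (h : IsTypePartition typ 𝒞)
    (hd : ∀ a b, a ≠ b → (d a b < θ ↔ typ a = typ b)) :
    IsTypePartition typ (mergeStep c θ d 𝒞) := by
  by_cases hne : (mergeCand θ d 𝒞).Nonempty
  swap
  · rwa [mergeStep_of_not_nonempty hne]
  rw [mergeStep_of_nonempty hne]
  have hp := c.pair_mem _ hne
  set p := c.pair (mergeCand θ d 𝒞)
  simp only [mergeCand, Finset.mem_filter, Finset.mem_offDiag] at hp
  obtain ⟨⟨h1, h2, h12⟩, hlt, -⟩ := hp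
  rw [clusterDist_lt_iff (h.nonempty _ h1) (h.nonempty _ h2)] at hlt
  have hdisj := h.disjoint _ h1 _ h2 h12
  have hcross : ∀ a ∈ p.1, ∀ b ∈ p.2, typ a = typ b := fun a ha b hb =>
    (hd a b (Finset.disjoint_iff_ne.mp hdisj a ha b hb)).mp (hlt a ha b hb)
  have hunion : ∀ C ∈ (𝒞.erase p.1).erase p.2, Disjoint (p.1 ∪ p.2) C := by
    intro C hC
    simp only [Finset.mem_erase] at hC
    exact Finset.disjoint_union_left.mpr ⟨h.disjoint _ h1 _ hC.2.2 (Ne.symm hC.2.1),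
      h.disjoint _ h2 _ hC.2.2 (Ne.symm hC.1)⟩
  refine ⟨?_, ?_, ?_, ?_⟩
  · intro C hC
    rcases Finset.mem_insert.mp hC with rfl | hC
    · exact (h.nonempty _ h1).mono Finset.subset_union_left
    · exact h.nonempty _ (Finset.mem_of_mem_erase (Finset.mem_of_mem_erase hC))
  · intro C hC a ha b hb
    rcases Finset.mem_insert.mp hC with rfl | hC
    · rcases Finset.mem_union.mp ha with ha | ha <;> rcases Finset.mem_union.mp hb with hb | hb
      · exact h.typ_eq _ h1 a ha b hb
      · exact hcross a ha b hb
      · exact (hcross b hb a ha).symm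
      · exact h.typ_eq _ h2 a ha b hb
    · exact h.typ_eq _ (Finset.mem_of_mem_erase (Finset.mem_of_mem_erase hC)) a ha b hb
  · intro C hC C' hC' hne
    rcases Finset.mem_insert.mp hC with rfl | hC <;> rcases Finset.mem_insert.mp hC' with rfl | hC'
    · exact absurd rfl hne
    · exact hunion _ hC'
    · exact (hunion _ hC).symm
    · exact h.disjoint _ (Finset.mem_of_mem_erase (Finset.mem_of_mem_erase hC)) _
        (Finset.mem_of_mem_erase (Finset.mem_of_mem_erase hC')) hne
  · intro a
    obtain ⟨C, hC, ha⟩ := h.cover a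
    by_cases e1 : C = p.1
    · exact ⟨_, Finset.mem_insert_self _ _, Finset.mem_union_left _ (e1 ▸ ha)⟩
    by_cases e2 : C = p.2
    · exact ⟨_, Finset.mem_insert_self _ _, Finset.mem_union_right _ (e2 ▸ ha)⟩
    exact ⟨C, Finset.mem_insert_of_mem (Finset.mem_erase.mpr ⟨e2, Finset.mem_erase.mpr ⟨e1, hC⟩⟩),
      ha⟩

lemma card_mergeStep (hne : (mergeCand θ d 𝒞).Nonempty) :
    (mergeStep c θ d 𝒞).card + 1 ≤ 𝒞.card := by
  rw [mergeStep_of_nonempty hne]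
  have hp := c.pair_mem _ hne
  set p := c.pair (mergeCand θ d 𝒞)
  simp only [mergeCand, Finset.mem_filter, Finset.mem_offDiag] at hp
  obtain ⟨⟨h1, h2, h12⟩, -, -⟩ := hp
  have e1 := Finset.card_erase_add_one h1
  have e2 := Finset.card_erase_add_one (Finset.mem_erase.mpr ⟨Ne.symm h12, h2⟩)
  have e3 := Finset.card_insert_le (p.1 ∪ p.2) ((𝒞.erase p.1).erase p.2)
  omega

/-- The partition of the messages into content types. -/
def typeClasses (typ : Fin M → Fin L) : Finset (Finset (Fin M)) :=
  Finset.univ.image fun l => Finset.univ.filter fun m => typ m = l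

/-- If one type were spread over two clusters, their distance would be below `θ`. A closest pair
would then be below `θ` too and could still be united. -/
lemma IsTypePartition.eq_typeClasses (h : IsTypePartition typ 𝒞)
    (hd : ∀ a b, a ≠ b → (d a b < θ ↔ typ a = typ b)) (hsurj : Function.Surjective typ)
    (h_final : ¬ (mergeCand θ d 𝒞).Nonempty) : 𝒞 = typeClasses typ := by
  have key : ∀ C ∈ 𝒞, ∀ a ∈ C, C = Finset.univ.filter fun m => typ m = typ a := by
    intro C hC a ha
    ext b
    simp only [Finset.mem_filter, Finset.mem_univ, true_and]
    refine ⟨fun hb => h.typ_eq C hC b hb a ha, fun hb => ?_⟩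
    obtain ⟨C', hC', hb'⟩ := h.cover b
    by_contra hbC
    have hne : C ≠ C' := by rintro rfl; exact hbC hb'
    have hlt : clusterDist d (C, C') < θ := by
      rw [clusterDist_lt_iff ⟨a, ha⟩ ⟨b, hb'⟩]
      intro x hx y hy
      rw [hd x y (Finset.disjoint_iff_ne.mp (h.disjoint C hC C' hC' hne) x hx y hy),
        h.typ_eq C hC x hx a ha, ← hb, h.typ_eq C' hC' b hb' y hy]
    have hmem : (C, C') ∈ 𝒞.offDiag := Finset.mem_offDiag.mpr ⟨hC, hC', hne⟩
    obtain ⟨p, hp, hmin⟩ := Finset.exists_min_image 𝒞.offDiag (clusterDist d) ⟨_, hmem⟩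
    exact h_final ⟨p, Finset.mem_filter.mpr ⟨hp, (hmin _ hmem).trans_lt hlt, hmin⟩⟩
  ext C
  simp only [typeClasses, Finset.mem_image, Finset.mem_univ, true_and]
  constructor
  · intro hC
    obtain ⟨a, ha⟩ := h.nonempty C hC
    exact ⟨typ a, (key C hC a ha).symm⟩
  · rintro ⟨l, rfl⟩
    obtain ⟨a, rfl⟩ := hsurj l
    obtain ⟨C, hC, ha⟩ := h.cover a
    rwa [← key C hC a ha]

/-- If small distances characterize equal types, the clusters are the content types. -/
lemma cluster_eq_typeClasses (hd : ∀ a b, a ≠ b → (d a b < θ ↔ typ a = typ b))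
    (hsurj : Function.Surjective typ) : cluster c θ d = typeClasses typ := by
  set 𝒞₀ : Finset (Finset (Fin M)) := Finset.univ.image fun m => {m} with h𝒞₀
  have h0 : IsTypePartition typ 𝒞₀ := by
    refine ⟨?_, ?_, ?_, ?_⟩
    · intro C hC
      obtain ⟨m, -, rfl⟩ := Finset.mem_image.mp hC
      exact Finset.singleton_nonempty m
    · intro C hC a ha b hb
      obtain ⟨m, -, rfl⟩ := Finset.mem_image.mp hC
      rw [Finset.mem_singleton.mp ha, Finset.mem_singleton.mp hb]
    · intro C hC C' hC' hne
      obtain ⟨m, -, rfl⟩ := Finset.mem_image.mp hC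
      obtain ⟨m', -, rfl⟩ := Finset.mem_image.mp hC'
      exact Finset.disjoint_singleton.mpr fun h => hne (by rw [h])
    · exact fun a => ⟨{a}, Finset.mem_image_of_mem _ (Finset.mem_univ a),
        Finset.mem_singleton_self a⟩
  have hcard : 𝒞₀.card ≤ M := Finset.card_image_le.trans (by simp)
  -- Either the process has stopped, or each of the `j` steps has removed a cluster. For `j = M` the
  -- second alternative leaves no cluster, hence no candidate pair either.
  have key : ∀ j : ℕ, IsTypePartition typ ((mergeStep c θ d)^[j] 𝒞₀) ∧
      (¬ (mergeCand θ d ((mergeStep c θ d)^[j] 𝒞₀)).Nonempty ∨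
        ((mergeStep c θ d)^[j] 𝒞₀).card + j ≤ M) := by
    intro j
    induction j with
    | zero => exact ⟨h0, Or.inr hcard⟩
    | succ j ih =>
      rw [Function.iterate_succ_apply']
      refine ⟨ih.1.mergeStep hd, ?_⟩
      by_cases hne : (mergeCand θ d ((mergeStep c θ d)^[j] 𝒞₀)).Nonempty
      · have := card_mergeStep (c := c) hne
        rcases ih.2 with h | h
        · exact absurd hne h
        · right; omega
      · left
        rwa [mergeStep_of_not_nonempty hne]
  obtain ⟨h1, h2⟩ := key M
  refine h1.eq_typeClasses hd hsurj ?_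
  rcases h2 with h2 | h2
  · exact h2
  · rintro ⟨p, hp⟩
    have := (Finset.mem_offDiag.mp (Finset.mem_filter.mp hp).1).1
    rw [Finset.card_eq_zero.mp (by omega : ((mergeStep c θ d)^[M] 𝒞₀).card = 0)] at this
    exact absurd this (Finset.notMem_empty _)

lemma reps_typeClasses (hsurj : Function.Surjective typ) :
    (reps c (typeClasses typ)).card = L ∧
      ∀ l, ∃ m ∈ reps c (typeClasses typ), typ m = l := by
  have hrep : ∀ l, typ (c.rep (Finset.univ.filter fun m => typ m = l)) = l := by
    intro l
    obtain ⟨a, rfl⟩ := hsurj l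
    exact (Finset.mem_filter.mp (c.rep_mem (Finset.univ.filter fun m => typ m = typ a)
      ⟨a, by simp⟩)).2
  constructor
  · rw [reps, typeClasses, Finset.image_image, Finset.card_image_of_injective, Finset.card_univ,
      Fintype.card_fin]
    intro l l' h
    rw [← hrep l, ← hrep l']
    exact congrArg typ h
  · intro l
    exact ⟨_, Finset.mem_image_of_mem _ (Finset.mem_image_of_mem _ (Finset.mem_univ l)), hrep l⟩

/-- The comparisons of distances on which the clustering depends. -/
def clusterTable (θ : ℝ) (d : Fin M → Fin M → ℝ) :
    (Finset (Fin M) × Finset (Fin M) → Prop) ×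
      (Finset (Fin M) × Finset (Fin M) → Finset (Fin M) × Finset (Fin M) → Prop) :=
  (fun p => clusterDist d p < θ, fun p q => clusterDist d p ≤ clusterDist d q)

/-- The clustering sees the distances only through finitely many comparisons. It therefore factors
through a discrete quantity, which gives its measurability. -/
lemma cluster_congr {d' : Fin M → Fin M → ℝ} (h : clusterTable θ d = clusterTable θ d') :
    cluster c θ d = cluster c θ d' := by
  have h1 : ∀ p, (clusterDist d p < θ) = (clusterDist d' p < θ) := fun p =>
    congrFun (congrArg Prod.fst h) p
  have h2 : ∀ p q, (clusterDist d p ≤ clusterDist d q) = (clusterDist d' p ≤ clusterDist d' q) :=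
    fun p q => congrFun (congrFun (congrArg Prod.snd h) p) q
  have h3 : ∀ 𝒞, mergeCand θ d 𝒞 = mergeCand θ d' 𝒞 := by
    intro 𝒞
    simp only [mergeCand, h1, h2]
  have h4 : mergeStep c θ d = mergeStep c θ d' := by
    funext 𝒞
    by_cases hne : (mergeCand θ d 𝒞).Nonempty
    · rw [mergeStep_of_nonempty hne, mergeStep_of_nonempty (h3 𝒞 ▸ hne), h3]
    · rw [mergeStep_of_not_nonempty hne, mergeStep_of_not_nonempty (h3 𝒞 ▸ hne)]
  rw [cluster, cluster, h4]

lemma measurable_clusterTable {Ω : Type*} [MeasurableSpace Ω] {d : Ω → Fin M → Fin M → ℝ}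
    (hd : ∀ a b, Measurable fun ω => d ω a b) : Measurable fun ω => clusterTable θ (d ω) := by
  have h : ∀ p, Measurable fun ω => clusterDist (d ω) p := fun p =>
    Measurable.iSup fun q => hd _ _
  refine Measurable.prodMk (measurable_pi_iff.mpr fun p => ?_)
    (measurable_pi_iff.mpr fun p => measurable_pi_iff.mpr fun q => ?_)
  · exact measurableSet_setOfPred.mp (measurableSet_lt (h p) measurable_const)
  · exact measurableSet_setOfPred.mp (measurableSet_le (h p) (h q))

/-- The selected message depends only on the order of the scores, again a finite amount of
information. -/
lemma argmax_congr {S : Finset (Fin M)} {f f' : Fin M → ℝ}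
    (h : ∀ a b, (f a ≤ f b) = (f' a ≤ f' b)) : argmax c S f = argmax c S f' := by
  simp only [argmax, h]

lemma argmax_spec {S : Finset (Fin M)} (hS : S.Nonempty) (f : Fin M → ℝ) :
    argmax c S f ∈ S ∧ ∀ m ∈ S, f m ≤ f (argmax c S f) := by
  classical
  obtain ⟨a, ha, hmax⟩ := Finset.exists_max_image S f hS
  have := c.msg_mem (S.filter fun m => ∀ m' ∈ S, f m' ≤ f m)
    ⟨a, Finset.mem_filter.mpr ⟨ha, hmax⟩⟩
  have h2 : argmax c S f ∈ S.filter fun m => ∀ m' ∈ S, f m' ≤ f m := by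
    rw [argmax]
    convert this
  exact Finset.mem_filter.mp h2

end Clustering

/-! ### The algorithms use only the statistics -/

section

variable {N K M τ : ℕ} {Ω : Type*} (X : ℕ → Ω → Fin N → Fin K)
  (G : ℕ → Ω → Fin N → Fin τ) (R : ℕ → Ω → Fin N → Fin K → Fin M → ℝ)

lemma usesStatistics_latentPolicy (δ : ℝ) (c : Choices M) (S : Fin K → Finset (Fin M))
    (pc : Sym2 (Fin M) → Fin K) : UsesStatistics (latentPolicy N K M τ δ c S pc) X G R := by
  intro mΩ t hcount havg
  set π := latentPolicy N K M τ δ c S pc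
  let d (ω : Ω) (a b : Fin M) : ℝ := |avg (history π X G R t ω) (pc s(a, b)) a
    - avg (history π X G R t ω) (pc s(a, b)) b|
  let thr : ℝ := 32 / δ ^ 2 * Real.log (t + 1)
  let g1 (ω : Ω) (k : Fin K) (m : Fin M) : Prop := (count (history π X G R t ω) k m : ℝ) < thr
  let g2 (ω : Ω) (k : Fin K) (a b : Fin M) : Prop :=
    avg (history π X G R t ω) k a ≤ avg (history π X G R t ω) k b
  refine measurable_of_factor (g := fun ω => (clusterTable (δ / 2) (d ω), g1 ω, g2 ω)) ?_ ?_
  · refine (measurable_clusterTable fun a b => ?_).prodMk (Measurable.prodMk ?_ ?_)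
    · have h : Measurable fun ω => avg (history π X G R t ω) (pc s(a, b)) a
        - avg (history π X G R t ω) (pc s(a, b)) b := (havg t le_rfl _ _).sub (havg t le_rfl _ _)
      exact measurable_norm.comp h
    · exact measurable_pi_iff.mpr fun k => measurable_pi_iff.mpr fun m =>
        measurableSet_setOfPred.mp (measurableSet_lt (hcount t le_rfl _ _) measurable_const)
    · exact measurable_pi_iff.mpr fun k => measurable_pi_iff.mpr fun a =>
        measurable_pi_iff.mpr fun b =>
          measurableSet_setOfPred.mp (measurableSet_le (havg t le_rfl _ _) (havg t le_rfl _ _))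
  · intro ω ω' h
    simp only [Prod.mk.injEq] at h
    obtain ⟨h1, h2, h3⟩ := h
    have e1 : cluster c (δ / 2) (d ω) = cluster c (δ / 2) (d ω') := cluster_congr h1
    have e2 : ∀ k m, ((count (history π X G R t ω) k m : ℝ) < thr) =
      ((count (history π X G R t ω') k m : ℝ) < thr) := fun k m => congrFun (congrFun h2 k) m
    have e3 : ∀ k (A : Finset (Fin M)), argmax c A (avg (history π X G R t ω) k) =
        argmax c A (avg (history π X G R t ω') k) := fun k A =>
      argmax_congr fun a b => congrFun (congrFun (congrFun h3 k) a) b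
    funext x g n
    simp only [ruleAt, π, latentPolicy, history_length]
    simp only [d, thr, π] at e1 e2 e3
    simp only [e1, e2, e3]

lemma usesStatistics_broadcastPolicy [NeZero M] (T : ℕ) (δ : ℝ) (c : Choices M) (k₀ : Fin K) :
    UsesStatistics (broadcastPolicy N K M τ T δ c k₀) X G R := by
  intro mΩ t hcount havg
  set π := broadcastPolicy N K M τ T δ c k₀
  by_cases ht : t < phase₁ N K M τ T δ
  · refine measurable_of_factor (g := fun _ => ()) measurable_const fun ω ω' _ => ?_
    funext x g n
    simp only [ruleAt, π, broadcastPolicy, history_length, if_pos ht]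
  -- Dropping the later slots recovers the history at the end of the first phase. This is why
  -- `UsesStatistics` admits the statistics at all times `s ≤ t`.
  have hdrop : ∀ ω, (history π X G R t ω).drop (t - phase₁ N K M τ T δ) =
      history π X G R (phase₁ N K M τ T δ) ω := fun ω => by
    have := history_drop π X G R (phase₁ N K M τ T δ) (t - phase₁ N K M τ T δ) ω
    rwa [show phase₁ N K M τ T δ + (t - phase₁ N K M τ T δ) = t by omega] at this
  have hle : phase₁ N K M τ T δ ≤ t := by omega
  let d (ω : Ω) (a b : Fin M) : ℝ := |avg (history π X G R (phase₁ N K M τ T δ) ω) k₀ a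
    - avg (history π X G R (phase₁ N K M τ T δ) ω) k₀ b|
  let f (ω : Ω) (x : Fin N → Fin K) (g : Fin N → Fin τ) (n : Fin N) (m : Fin M) : ℝ :=
    ∑ n' with g n' = g n, avg (history π X G R t ω) (x n') m
  let g1 (ω : Ω) (p : ((Fin N → Fin K) × (Fin N → Fin τ)) × Fin N × Fin M × Fin M) : Prop :=
    f ω p.1.1 p.1.2 p.2.1 p.2.2.1 ≤ f ω p.1.1 p.1.2 p.2.1 p.2.2.2
  refine measurable_of_factor (g := fun ω => (clusterTable (δ / 2) (d ω), g1 ω)) ?_ ?_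
  · refine (measurable_clusterTable fun a b => ?_).prodMk ?_
    · have h : Measurable fun ω => avg (history π X G R (phase₁ N K M τ T δ) ω) k₀ a
        - avg (history π X G R (phase₁ N K M τ T δ) ω) k₀ b :=
        (havg _ hle _ _).sub (havg _ hle _ _)
      exact measurable_norm.comp h
    · have hf : ∀ x g n m, Measurable fun ω => f ω x g n m := fun x g n m =>
        Finset.measurable_sum _ fun n' _ => havg t le_rfl _ _
      exact measurable_pi_iff.mpr fun p =>
        measurableSet_setOfPred.mp (measurableSet_le (hf _ _ _ _) (hf _ _ _ _))
  · intro ω ω' h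
    simp only [Prod.mk.injEq] at h
    obtain ⟨h1, h2⟩ := h
    have e1 : cluster c (δ / 2) (d ω) = cluster c (δ / 2) (d ω') := cluster_congr h1
    have e2 : ∀ x g n (A : Finset (Fin M)), argmax c A (f ω x g n) =
        argmax c A (f ω' x g n) := fun x g n A =>
      argmax_congr fun a b => congrFun h2 ((x, g), n, a, b)
    funext x g n
    have e3 := e2 x g n (reps c (cluster c (δ / 2) (d ω')))
    simp only [d, f] at e1 e3
    simp only [ruleAt]
    simp only [π, broadcastPolicy, history_length, if_neg ht]
    simp only [π] at hdrop e1 e3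
    rw [hdrop, hdrop, e1, e3]

end

/-! ### The regret in terms of the mean payoffs -/

section

variable {N K M τ L : ℕ} [NeZero M] {Ω : Type*} [mΩ : MeasurableSpace Ω] {P : Measure Ω}
  {π : Policy N K M τ} {X : ℕ → Ω → Fin N → Fin K}
  {G : ℕ → Ω → Fin N → Fin τ} {R : ℕ → Ω → Fin N → Fin K → Fin M → ℝ}
  {D : Fin K → Fin M → Measure ℝ} {δ : ℝ} {typ : Fin M → Fin L}

variable (π X G R D) in
/-- The mean payoff that user `n` loses in slot `t`. -/
noncomputable def gap (t : ℕ) (n : Fin N) (ω : Ω) : ℝ :=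
  meanPayoff D (X t ω n) (bestMsg (meanPayoff D) (X t ω) (G t ω) (G t ω n))
    - meanPayoff D (X t ω n) (action π X G R t ω n)

lemma measurable_action (hB : IsBroadcastModel P D X G R) (hπ : UsesStatistics π X G R) (t : ℕ) :
    Measurable (action π X G R t) :=
  measurable_of_factor (g := fun ω => (ruleAt π X G R t ω, X t ω, G t ω))
    (((measurable_ruleAt_past hπ t).mono (hB.past_le t) le_rfl).prodMk
      ((hB.measurable_ctx t).prodMk (hB.measurable_grp t))) fun a a' h => by
        simp only [Prod.mk.injEq] at h
        rw [action_eq, action_eq, h.1, h.2.1, h.2.2]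

lemma measurable_of_slot_action (hB : IsBroadcastModel P D X G R) (hπ : UsesStatistics π X G R)
    (t : ℕ) (f : (Fin N → Fin K) → (Fin N → Fin τ) → (Fin N → Fin M) → ℝ) :
    Measurable fun ω => f (X t ω) (G t ω) (action π X G R t ω) :=
  measurable_of_factor (g := fun ω => (X t ω, G t ω, action π X G R t ω))
    ((hB.measurable_ctx t).prodMk ((hB.measurable_grp t).prodMk (measurable_action hB hπ t)))
    fun a a' h => by
      simp only [Prod.mk.injEq] at h
      rw [h.1, h.2.1, h.2.2]

lemma measurable_gap (hB : IsBroadcastModel P D X G R) (hπ : UsesStatistics π X G R)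
    (t : ℕ) (n : Fin N) : Measurable (gap π X G R D t n) :=
  measurable_of_slot_action hB hπ t fun x g a =>
    meanPayoff D (x n) (bestMsg (meanPayoff D) x g (g n)) - meanPayoff D (x n) (a n)

lemma gap_le_one (hD : IsLatentPayoff δ D typ) (t : ℕ) (n : Fin N) (ω : Ω) :
    gap π X G R D t n ω ≤ 1 := by
  have h1 := (hD.mean_mem_Icc (X t ω n) (bestMsg (meanPayoff D) (X t ω) (G t ω) (G t ω n))).2
  have h2 := (hD.mean_mem_Icc (X t ω n) (action π X G R t ω n)).1
  rw [gap]
  linarith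

lemma neg_one_le_gap (hD : IsLatentPayoff δ D typ) (t : ℕ) (n : Fin N) (ω : Ω) :
    -1 ≤ gap π X G R D t n ω := by
  have h1 := (hD.mean_mem_Icc (X t ω n) (bestMsg (meanPayoff D) (X t ω) (G t ω) (G t ω n))).1
  have h2 := (hD.mean_mem_Icc (X t ω n) (action π X G R t ω n)).2
  rw [gap]
  linarith

lemma sum_gap_le (hD : IsLatentPayoff δ D typ) (t : ℕ) (ω : Ω) :
    ∑ n, gap π X G R D t n ω ≤ N := by
  calc _ ≤ ∑ _n : Fin N, (1 : ℝ) := Finset.sum_le_sum fun n _ => gap_le_one hD t n ω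
    _ = N := by simp

lemma integrable_gap (hB : IsBroadcastModel P D X G R) (hD : IsLatentPayoff δ D typ)
    (hπ : UsesStatistics π X G R) (t : ℕ) (n : Fin N) : Integrable (gap π X G R D t n) P := by
  have := hB.prob
  exact Integrable.of_mem_Icc (-1) 1 (measurable_gap hB hπ t n).aemeasurable
    (Filter.Eventually.of_forall fun ω => ⟨neg_one_le_gap hD t n ω, gap_le_one hD t n ω⟩)

lemma measurable_payoff (hB : IsBroadcastModel P D X G R) (hπ : UsesStatistics π X G R)
    (t : ℕ) (n : Fin N) : Measurable fun ω => R t ω n (X t ω n) (action π X G R t ω n) := by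
  have h1 : Measurable fun ω => (X t ω n, action π X G R t ω n) :=
    ((measurable_pi_apply n).comp (hB.measurable_ctx t)).prodMk
      ((measurable_pi_apply n).comp (measurable_action hB hπ t))
  have h2 : Measurable fun q : (Fin K × Fin M) × (Fin N → Fin K → Fin M → ℝ) =>
      q.2 n q.1.1 q.1.2 :=
    measurable_from_prod_countable_right fun p =>
      (measurable_pi_apply p.2).comp ((measurable_pi_apply p.1).comp (measurable_pi_apply n))
  exact h2.comp (h1.prodMk (hB.measurable_pay t))

lemma ae_payoff_mem_Icc (hB : IsBroadcastModel P D X G R) (hD : IsLatentPayoff δ D typ)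
    (t : ℕ) (n : Fin N) :
    ∀ᵐ ω ∂P, R t ω n (X t ω n) (action π X G R t ω n) ∈ Set.Icc (0 : ℝ) 1 := by
  have : ∀ᵐ ω ∂P, ∀ k m, R t ω n k m ∈ Set.Icc (0 : ℝ) 1 :=
    ae_all_iff.mpr fun k => ae_all_iff.mpr fun m => hB.pay_mem_Icc hD t n k m
  filter_upwards [this] with ω hω using hω _ _

lemma integrable_payoff (hB : IsBroadcastModel P D X G R) (hD : IsLatentPayoff δ D typ)
    (hπ : UsesStatistics π X G R) (t : ℕ) (n : Fin N) :
    Integrable (fun ω => R t ω n (X t ω n) (action π X G R t ω n)) P := by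
  have := hB.prob
  exact Integrable.of_mem_Icc 0 1 (measurable_payoff hB hπ t n).aemeasurable
    (ae_payoff_mem_Icc hB hD t n)

lemma integrable_mean_action (hB : IsBroadcastModel P D X G R) (hD : IsLatentPayoff δ D typ)
    (hπ : UsesStatistics π X G R) (t : ℕ) (n : Fin N) :
    Integrable (fun ω => meanPayoff D (X t ω n) (action π X G R t ω n)) P := by
  have := hB.prob
  exact Integrable.of_mem_Icc 0 1
    (measurable_of_slot_action hB hπ t fun x _ a => meanPayoff D (x n) (a n)).aemeasurable
    (Filter.Eventually.of_forall fun ω => hD.mean_mem_Icc _ _)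

/-- The action is a function of the past and of the present contexts and groups, none of which
carries information on the present payoffs. These may thus be replaced by their means. The lower
integral is applied to one minus the payoff, which is nonnegative almost everywhere. -/
lemma integral_payoff (hB : IsBroadcastModel P D X G R) (hD : IsLatentPayoff δ D typ)
    (hπ : UsesStatistics π X G R) (t : ℕ) (n : Fin N) :
    ∫ ω, R t ω n (X t ω n) (action π X G R t ω n) ∂P =
      ∫ ω, meanPayoff D (X t ω n) (action π X G R t ω n) ∂P := by
  have := hB.prob
  have hinner : ∀ k m, ∫⁻ ω, ENNReal.ofReal (1 - R t ω n k m) ∂P =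
      ENNReal.ofReal (1 - meanPayoff D k m) := by
    intro k m
    have hint : Integrable (fun ω => R t ω n k m) P :=
      Integrable.of_mem_Icc 0 1 (hB.measurable_pay_apply t n k m).aemeasurable
        (hB.pay_mem_Icc hD t n k m)
    have hint' : Integrable (fun ω => 1 - R t ω n k m) P := (integrable_const 1).sub hint
    rw [← ofReal_integral_eq_lintegral_ofReal hint', integral_sub
      (integrable_const 1) hint, hB.integral_pay]
    · simp
    · filter_upwards [hB.pay_mem_Icc hD t n k m] with ω hω
      exact sub_nonneg.mpr hω.2
  have h1 := hB.lintegral_integrate_pay (measurable_ruleAt_past hπ t) (V := fun _ => 1)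
    measurable_const (Ψ := fun r x g ρ => ENNReal.ofReal (1 - ρ n (x n) (r x g n)))
    fun r x g => by
      have h : Measurable fun ρ : Fin N → Fin K → Fin M → ℝ => ρ n (x n) (r x g n) :=
        (measurable_pi_apply _).comp ((measurable_pi_apply _).comp (measurable_pi_apply n))
      exact ENNReal.measurable_ofReal.comp (h.const_sub 1)
  simp only [one_mul, hinner] at h1
  have e1 : ∫ ω, (1 - R t ω n (X t ω n) (action π X G R t ω n)) ∂P =
      ∫ ω, (1 - meanPayoff D (X t ω n) (action π X G R t ω n)) ∂P := by
    rw [integral_eq_lintegral_of_nonneg_ae, integral_eq_lintegral_of_nonneg_ae]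
    · exact congrArg ENNReal.toReal h1
    · exact Filter.Eventually.of_forall fun ω => sub_nonneg.mpr (hD.mean_mem_Icc _ _).2
    · exact ((integrable_const 1).sub (integrable_mean_action hB hD hπ t n)).aestronglyMeasurable
    · filter_upwards [ae_payoff_mem_Icc (π := π) hB hD t n] with ω hω
      exact sub_nonneg.mpr hω.2
    · exact ((integrable_const 1).sub (integrable_payoff hB hD hπ t n)).aestronglyMeasurable
  rw [integral_sub (integrable_const 1) (integrable_payoff hB hD hπ t n),
    integral_sub (integrable_const 1) (integrable_mean_action hB hD hπ t n)] at e1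
  linarith

lemma integrable_regretSum (hB : IsBroadcastModel P D X G R) (hD : IsLatentPayoff δ D typ)
    (hπ : UsesStatistics π X G R) (T : ℕ) :
    Integrable (regretSum π (meanPayoff D) X G R T) P := by
  have := hB.prob
  refine integrable_finsetSum _ fun t _ => integrable_finsetSum _ fun n _ =>
    Integrable.sub ?_ (integrable_payoff hB hD hπ t n)
  exact Integrable.of_mem_Icc 0 1
    (measurable_of_slot_action hB hπ t fun x g _ =>
      meanPayoff D (x n) (bestMsg (meanPayoff D) x g (g n))).aemeasurable
    (Filter.Eventually.of_forall fun ω => hD.mean_mem_Icc _ _)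

lemma regret_eq (hB : IsBroadcastModel P D X G R) (hD : IsLatentPayoff δ D typ)
    (hπ : UsesStatistics π X G R) (T : ℕ) :
    regret P π (meanPayoff D) X G R T =
      ∫ ω, ∑ t ∈ Finset.range T, ∑ n, gap π X G R D t n ω ∂P := by
  have := hB.prob
  have hbest : ∀ t n, Integrable (fun ω =>
      meanPayoff D (X t ω n) (bestMsg (meanPayoff D) (X t ω) (G t ω) (G t ω n))) P := fun t n =>
    Integrable.of_mem_Icc 0 1
      (measurable_of_slot_action hB hπ t fun x g _ =>
        meanPayoff D (x n) (bestMsg (meanPayoff D) x g (g n))).aemeasurable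
      (Filter.Eventually.of_forall fun ω => hD.mean_mem_Icc _ _)
  have hloss : ∀ t n, Integrable (fun ω =>
      meanPayoff D (X t ω n) (bestMsg (meanPayoff D) (X t ω) (G t ω) (G t ω n)) -
        R t ω n (X t ω n) (action π X G R t ω n)) P := fun t n =>
    (hbest t n).sub (integrable_payoff hB hD hπ t n)
  rw [regret]
  unfold regretSum
  rw [integral_finsetSum _ fun t _ => integrable_finsetSum _ fun n _ => hloss t n,
    integral_finsetSum _ fun t _ => integrable_finsetSum _ fun n _ => integrable_gap hB hD hπ t n]
  refine Finset.sum_congr rfl fun t _ => ?_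
  rw [integral_finsetSum _ fun n _ => hloss t n,
    integral_finsetSum _ fun n _ => integrable_gap hB hD hπ t n]
  refine Finset.sum_congr rfl fun n _ => ?_
  unfold gap
  rw [integral_sub (hbest t n) (integrable_payoff hB hD hπ t n),
    integral_sub (hbest t n) (integrable_mean_action hB hD hπ t n), integral_payoff hB hD hπ]

/-- A pathwise bound of the lost mean payoff by a constant and weighted indicators of events. -/
lemma regret_le_of_ae (hB : IsBroadcastModel P D X G R) (hD : IsLatentPayoff δ D typ)
    (hπ : UsesStatistics π X G R) (T : ℕ) {ι : Type*} (s : Finset ι) (w : ι → ℝ) (E : ι → Set Ω)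
    (hE : ∀ i, MeasurableSet (E i)) (a : ℝ)
    (h : ∀ᵐ ω ∂P, ∑ t ∈ Finset.range T, ∑ n, gap π X G R D t n ω ≤
      a + ∑ i ∈ s, w i * (E i).indicator 1 ω) :
    regret P π (meanPayoff D) X G R T ≤ a + ∑ i ∈ s, w i * P.real (E i) := by
  have := hB.prob
  have hi : ∀ i, Integrable (fun ω => w i * (E i).indicator (1 : Ω → ℝ) ω) P := fun i =>
    ((integrable_const (1 : ℝ)).indicator (hE i)).const_mul _
  rw [regret_eq hB hD hπ]
  calc _ ≤ ∫ ω, (a + ∑ i ∈ s, w i * (E i).indicator (1 : Ω → ℝ) ω) ∂P :=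
        integral_mono_ae
          (integrable_finsetSum _ fun t _ => integrable_finsetSum _ fun n _ =>
            integrable_gap hB hD hπ t n)
          ((integrable_const a).add (integrable_finsetSum _ fun i _ => hi i)) h
    _ = _ := by
        rw [integral_add (integrable_const a) (integrable_finsetSum _ fun i _ => hi i),
          integral_finsetSum _ fun i _ => hi i]
        simp [integral_const_mul, integral_indicator_one (hE _)]

/-! ### Decisions with accurate averages -/

lemma IsLatentPayoff.exists_pos (hD : IsLatentPayoff δ D typ) (hδ : 0 < δ) :
    ∃ Δ, δ ≤ Δ ∧ 0 < Δ ∧ ∀ k m, ∃ j : ℕ, 1 ≤ j ∧ meanPayoff D k m = j * Δ := by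
  obtain ⟨Δ, h1, h2⟩ := hD.discrete
  exact ⟨Δ, h1, hδ.trans_le h1, h2⟩

lemma IsLatentPayoff.le_one (hD : IsLatentPayoff δ D typ) (hδ : 0 < δ) (k : Fin K) (m : Fin M) :
    δ ≤ 1 := by
  obtain ⟨Δ, h1, h2, h3⟩ := hD.exists_pos hδ
  obtain ⟨j, hj, h4⟩ := h3 k m
  have h5 := (hD.mean_mem_Icc k m).2
  have : (1 : ℝ) ≤ j := by exact_mod_cast hj
  nlinarith

/-- Sums of mean payoffs are multiples of `Δ`. -/
lemma IsLatentPayoff.sum_sub_nonpos (hD : IsLatentPayoff δ D typ) (hδ : 0 < δ) {ι : Type*}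
    (s : Finset ι) (x : ι → Fin K) (a b : Fin M)
    (h : ∑ i ∈ s, meanPayoff D (x i) a - ∑ i ∈ s, meanPayoff D (x i) b < δ) :
    ∑ i ∈ s, meanPayoff D (x i) a - ∑ i ∈ s, meanPayoff D (x i) b ≤ 0 := by
  obtain ⟨Δ, h1, h2, h3⟩ := hD.exists_pos hδ
  -- The difference is an integer times `Δ`; being less than `δ ≤ Δ` it is at most `0`.
  choose j _ hj using h3
  simp only [hj, ← Finset.sum_mul, ← sub_mul] at h ⊢
  have h4 : ((∑ i ∈ s, (j (x i) a : ℝ)) - ∑ i ∈ s, (j (x i) b : ℝ)) * Δ < 1 * Δ := by linarith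
  have h5 := lt_of_mul_lt_mul_right h4 h2.le
  have h6 : ((∑ i ∈ s, (j (x i) a : ℤ)) - ∑ i ∈ s, (j (x i) b : ℤ)) < 1 := by exact_mod_cast h5
  have h7 : ((∑ i ∈ s, (j (x i) a : ℤ)) - ∑ i ∈ s, (j (x i) b : ℤ)) ≤ 0 := by omega
  have h8 : ((∑ i ∈ s, (j (x i) a : ℝ)) - ∑ i ∈ s, (j (x i) b : ℝ)) ≤ 0 := by exact_mod_cast h7
  exact mul_nonpos_of_nonpos_of_nonneg h8 h2.le

/-- Different means are different multiples of `Δ`; the rounding lemma is applied to both signs of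
the difference. -/
lemma IsLatentPayoff.le_abs_sub (hD : IsLatentPayoff δ D typ) (hδ : 0 < δ) {k : Fin K}
    {a b : Fin M} (h : typ a ≠ typ b) : δ ≤ |meanPayoff D k a - meanPayoff D k b| := by
  have hne : meanPayoff D k a ≠ meanPayoff D k b := fun h' => h ((hD.typ_eq_iff k a b).mpr h')
  by_contra! hlt
  have h1 := hD.sum_sub_nonpos hδ {()} (fun _ => k) a b (by
    simp only [Finset.sum_singleton]; exact (le_abs_self _).trans_lt hlt)
  have h2 := hD.sum_sub_nonpos hδ {()} (fun _ => k) b a (by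
    simp only [Finset.sum_singleton]; rw [abs_sub_comm] at hlt; exact (le_abs_self _).trans_lt hlt)
  simp only [Finset.sum_singleton] at h1 h2
  exact hne (by linarith)

/-- Averages with errors less than `δ / 4` separate the content types. -/
lemma IsLatentPayoff.dist_lt_iff (hD : IsLatentPayoff δ D typ) (hδ : 0 < δ) {k : Fin K}
    {a b : Fin M} {ra rb : ℝ} (ha : |ra - meanPayoff D k a| < δ / 4)
    (hb : |rb - meanPayoff D k b| < δ / 4) : |ra - rb| < δ / 2 ↔ typ a = typ b := by
  constructor
  · intro h
    by_contra hne
    have h1 := hD.le_abs_sub hδ (k := k) hne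
    rw [abs_lt] at ha hb h
    rcases le_abs.mp h1 with h1 | h1 <;> linarith
  · intro h
    have h1 := (hD.typ_eq_iff k a b).mp h
    rw [abs_lt] at ha hb ⊢
    constructor <;> linarith

lemma bestMsg_spec (μ : Fin K → Fin M → ℝ) (x : Fin N → Fin K) (g : Fin N → Fin τ) (s : Fin τ)
    (m : Fin M) : ∑ n with g n = s, μ (x n) m ≤ ∑ n with g n = s, μ (x n) (bestMsg μ x g s) :=
  (Finite.exists_max fun m : Fin M => ∑ n with g n = s, μ (x n) m).choose_spec m

/-- If the averages are accurate, the message with the best average for a group is optimal. -/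
lemma sum_gap_group_nonpos (hD : IsLatentPayoff δ D typ) (hδ : 0 < δ) {A : Finset (Fin M)}
    (hA : ∀ l, ∃ m ∈ A, typ m = l) {x : Fin N → Fin K} {g : Fin N → Fin τ} {s : Fin τ}
    {r : Fin K → Fin M → ℝ} {ε : ℝ} (hr : ∀ n m, m ∈ A → |r (x n) m - meanPayoff D (x n) m| < ε)
    (hcard : 2 * ε * (Finset.univ.filter fun n => g n = s).card ≤ δ) {b : Fin M} (hb : b ∈ A)
    (hmax : ∀ m ∈ A, ∑ n with g n = s, r (x n) m ≤ ∑ n with g n = s, r (x n) b) :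
    ∑ n with g n = s, (meanPayoff D (x n) (bestMsg (meanPayoff D) x g s)
      - meanPayoff D (x n) b) ≤ 0 := by
  rcases (Finset.univ.filter fun n => g n = s).eq_empty_or_nonempty with he | hne
  · rw [he]; simp
  -- The optimal message need not be a representative, but a representative of its type has the same
  -- mean in every context.
  obtain ⟨m, hm, hmt⟩ := hA (typ (bestMsg (meanPayoff D) x g s))
  have h1 : ∀ k, meanPayoff D k (bestMsg (meanPayoff D) x g s) = meanPayoff D k m := fun k =>
    (hD.typ_eq_iff k _ _).mp hmt.symm
  rw [Finset.sum_sub_distrib]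
  simp only [h1]
  refine hD.sum_sub_nonpos hδ _ x m b ?_
  -- The inequalities must be strict for the rounding, because `2 ε` times the group size may equal
  -- `δ`. This uses that the group is not empty.
  have e1 : ∑ n with g n = s, meanPayoff D (x n) m <
      ∑ n with g n = s, (r (x n) m + ε) := by
    refine Finset.sum_lt_sum_of_nonempty hne fun n _ => ?_
    have := (abs_lt.mp (hr n m hm)).1
    linarith
  have e2 : ∑ n with g n = s, (r (x n) b - ε) <
      ∑ n with g n = s, meanPayoff D (x n) b := by
    refine Finset.sum_lt_sum_of_nonempty hne fun n _ => ?_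
    have := (abs_lt.mp (hr n b hb)).2
    linarith
  have e3 := hmax m hm
  simp only [Finset.sum_add_distrib, Finset.sum_sub_distrib, Finset.sum_const, nsmul_eq_mul]
    at e1 e2
  linarith

lemma IsBroadcastModel.ae_group_card (hB : IsBroadcastModel P D X G R) (t : ℕ) :
    ∀ᵐ ω ∂P, ∀ s, (Finset.univ.filter fun n => G t ω n = s).card * τ = N := by
  have hprob := hB.prob
  refine ae_of_ae_map (hB.measurable_grp t).aemeasurable
    (p := fun g => ∀ s, (Finset.univ.filter fun n => g n = s).card * τ = N) ?_
  have h1 := Measure.isProbabilityMeasure_map (μ := P) (hB.measurable_grp t).aemeasurable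
  rw [hB.grp_law] at h1 ⊢
  rw [uniformOn]
  exact ae_cond_mem (Set.to_countable _).measurableSet

end

/-! ### Round robin -/

/-- Transmission `s` of slot `u` has the running number `u * τ + s`, and these numbers exhaust `0,
…, J * τ - 1`. -/
lemma sum_card_mod_eq_count (τ r i J : ℕ) :
    ∑ u ∈ Finset.range J, (Finset.univ.filter fun s : Fin τ => (u * τ + s) % r = i).card =
      Nat.count (fun x => x % r = i) (J * τ) := by
  induction J with
  | zero => simp
  | succ J ih =>
    rw [Finset.sum_range_succ, ih, add_mul, one_mul, Nat.count_add, Finset.card_filter,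
      Fin.sum_univ_eq_sum_range (fun s => if (J * τ + s) % r = i then 1 else 0),
      Nat.count_eq_card_filter_range, Nat.count_eq_card_filter_range, Finset.card_filter,
      Finset.card_filter]

lemma div_le_sum_card_mod {τ r i : ℕ} (hi : i < r) (J : ℕ) :
    J * τ / r ≤
      ∑ u ∈ Finset.range J, (Finset.univ.filter fun s : Fin τ => (u * τ + s) % r = i).card := by
  have h := Nat.count_modEq_card (J * τ) (by omega : 0 < r) i
  have h2 : (fun x => x ≡ i [MOD r]) = fun x => x % r = i := by
    funext x
    rw [Nat.ModEq, Nat.mod_eq_of_lt hi]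
  rw [sum_card_mod_eq_count]
  simp only [h2] at h
  omega

/-- Rounding down loses at most half of a number that is at least one. The case `z = 0` is needed
because the logarithm in the phase length may vanish. -/
lemma half_le_natDiv {a r : ℕ} {z : ℝ} (hz : z ≤ a / r) (h : z = 0 ∨ 1 ≤ z) :
    z / 2 ≤ ((a / r : ℕ) : ℝ) := by
  rcases h with rfl | h
  · simp
  · have h1 := Nat.lt_floor_add_one ((a : ℝ) / r)
    rw [Nat.floor_div_eq_div] at h1
    have h2 : (1 : ℝ) ≤ ((a / r : ℕ) : ℝ) := by
      have : (0 : ℝ) < ((a / r : ℕ) : ℝ) := by linarith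
      exact_mod_cast this
    linarith

lemma half_le_one_sub_exp {u : ℝ} (h0 : 0 ≤ u) (h1 : u ≤ 1) : u / 2 ≤ 1 - Real.exp (-u) := by
  have h2 : Real.exp (-u) ≤ 1 - u / 2 := by
    rw [Real.exp_neg]
    have h3 := Real.add_one_le_exp u
    rw [inv_le_comm₀ (Real.exp_pos u) (by linarith)]
    rw [inv_eq_one_div, div_le_iff₀ (by linarith)]
    nlinarith
  linarith

section

variable {N K M τ L : ℕ} [NeZero M] {Ω : Type*} [mΩ : MeasurableSpace Ω] {P : Measure Ω}
  {π : Policy N K M τ} {X : ℕ → Ω → Fin N → Fin K}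
  {G : ℕ → Ω → Fin N → Fin τ} {R : ℕ → Ω → Fin N → Fin K → Fin M → ℝ}
  {D : Fin K → Fin M → Measure ℝ} {δ : ℝ} {typ : Fin M → Fin L}

/-! ### The number of users of a context -/

variable (P X G) in
/-- A slot in which a message is sent to the groups in `B` multiplies the exponential moment of the
number of its samples in any context by at most `exp (-β |B|)`. -/
def SampleRate (c β : ℝ) : Prop :=
  ∀ t k (B : Finset (Fin τ)), ∫⁻ ω, ENNReal.ofReal (Real.exp (-c * (Finset.univ.filter fun n =>
    X t ω n = k ∧ G t ω n ∈ B).card)) ∂P ≤ ENNReal.ofReal (Real.exp (-(β * B.card)))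

/-- Only the mean `N / K` of the number `z ≤ N` of users with context `k` is known, as users may be
dependent. By convexity `exp (-c z)` lies below the chord over `[0, N]`, whose expectation depends
on this mean alone. The single group makes `B` empty or full. -/
lemma sampleRate_of_uniformRates {G : ℕ → Ω → Fin N → Fin 1}
    {R : ℕ → Ω → Fin N → Fin K → Fin M → ℝ} (hB : IsBroadcastModel P D X G R)
    (hX : UniformRates P X) (hN : 1 ≤ N) {c u : ℝ} (h0 : 0 ≤ u) (h1 : u ≤ 1) (hc : u ≤ c * N) :
    SampleRate P X G c (u / (2 * K)) := by
  have hprob := hB.prob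
  intro t k B
  have hN' : (0 : ℝ) < N := by exact_mod_cast hN
  have hK' : (0 : ℝ) < K := by exact_mod_cast (Fin.pos k)
  have hB01 : B = ∅ ∨ B = Finset.univ := by
    rcases B.eq_empty_or_nonempty with h | ⟨b, hb⟩
    · exact Or.inl h
    · exact Or.inr (Finset.eq_univ_iff_forall.mpr fun a => Subsingleton.elim b a ▸ hb)
  rcases hB01 with rfl | rfl
  · simp
  simp only [Finset.mem_univ, and_true, Finset.card_univ, Fintype.card_fin, Nat.cast_one, mul_one]
  set z : Ω → ℝ := fun ω => ((Finset.univ.filter fun n => X t ω n = k).card : ℝ) with hz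
  have hset : ∀ n, MeasurableSet {ω | X t ω n = k} := fun n =>
    ((measurable_pi_apply n).comp (hB.measurable_ctx t)) (measurableSet_singleton k)
  have hzsum : z = fun ω => ∑ n, ({ω | X t ω n = k}.indicator (1 : Ω → ℝ)) ω := by
    funext ω
    simp [hz, Set.indicator_apply]
  have hzint : Integrable z P := by
    rw [hzsum]
    exact integrable_finsetSum _ fun n _ => (integrable_const (1 : ℝ)).indicator (hset n)
  have hzE : ∫ ω, z ω ∂P = N / K := by
    have hi : ∀ n, Integrable (({ω | X t ω n = k}.indicator (1 : Ω → ℝ))) P := fun n =>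
      (integrable_const (1 : ℝ)).indicator (hset n)
    simp only [hzsum]
    rw [integral_finsetSum _ fun n _ => hi n, ← hX t k]
    exact Finset.sum_congr rfl fun n _ => integral_indicator_one (hset n)
  have hz0 : ∀ ω, 0 ≤ z ω := fun ω => Nat.cast_nonneg _
  have hzN : ∀ ω, z ω ≤ N := fun ω => by
    have := Finset.card_filter_le (Finset.univ : Finset (Fin N)) fun n => X t ω n = k
    rw [Finset.card_univ, Fintype.card_fin] at this
    exact Nat.cast_le.mpr this
  have hpt : ∀ ω, Real.exp (-c * z ω) ≤ 1 - u / (2 * N) * z ω := by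
    intro ω
    -- Here `-c z` is the convex combination of `0` and `-c N` with weights `1 - z / N` and `z / N`.
    have hconv := convexOn_exp.2 (Set.mem_univ (0 : ℝ)) (Set.mem_univ (-(c * N)))
      (show 0 ≤ 1 - z ω / N by rw [sub_nonneg, div_le_one hN']; exact hzN ω)
      (show 0 ≤ z ω / N by have := hz0 ω; positivity) (by ring)
    simp only [smul_eq_mul, mul_zero, zero_add, Real.exp_zero, mul_one] at hconv
    rw [show z ω / N * -(c * N) = -c * z ω by field_simp] at hconv
    have e1 : Real.exp (-(c * N)) ≤ 1 - u / 2 := by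
      have h2 := half_le_one_sub_exp h0 h1
      have h3 : Real.exp (-(c * N)) ≤ Real.exp (-u) := Real.exp_le_exp.mpr (by linarith)
      linarith
    have e2 : z ω / N * Real.exp (-(c * N)) ≤ z ω / N * (1 - u / 2) := by
      have := hz0 ω
      gcongr
    calc _ ≤ _ := hconv
      _ ≤ 1 - z ω / N + z ω / N * (1 - u / 2) := by linarith
      _ = _ := by field_simp; ring
  have hint2 : Integrable (fun ω => 1 - u / (2 * N) * z ω) P :=
    (integrable_const 1).sub (hzint.const_mul _)
  calc _ ≤ ∫⁻ ω, ENNReal.ofReal (1 - u / (2 * N) * z ω) ∂P :=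
        lintegral_mono fun ω => ENNReal.ofReal_le_ofReal (hpt ω)
    _ = ENNReal.ofReal (∫ ω, (1 - u / (2 * N) * z ω) ∂P) :=
        (ofReal_integral_eq_lintegral_ofReal hint2 (Filter.Eventually.of_forall fun ω =>
          (Real.exp_pos _).le.trans (hpt ω))).symm
    _ ≤ _ := by
        refine ENNReal.ofReal_le_ofReal ?_
        rw [integral_sub (integrable_const 1) (hzint.const_mul _), integral_const_mul, hzE]
        have := Real.one_sub_le_exp_neg (u / (2 * K))
        simp only [integral_const, probReal_univ, smul_eq_mul, mul_one]
        calc _ = 1 - u / (2 * K) := by field_simp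
          _ ≤ _ := this

/-- For independent users the exponential moment is a product; each factor is at most `1 - u / (2
K)`, hence at most `exp (-u / (2 K))`. -/
lemma lintegral_exp_users_le (hB : IsBroadcastModel P D X G R) (hX : UniformUsers P X) (t : ℕ)
    (k : Fin K) (S : Finset (Fin N)) {c u : ℝ} (h0 : 0 ≤ u) (h1 : u ≤ 1) (hc : u ≤ c) :
    ∫⁻ ω, ENNReal.ofReal (Real.exp (-c * (S.filter fun n => X t ω n = k).card)) ∂P ≤
      ENNReal.ofReal (Real.exp (-(u / (2 * K) * S.card))) := by
  have hprob := hB.prob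
  have hset : ∀ n, MeasurableSet {ω | X t ω n = k} := fun n =>
    ((measurable_pi_apply n).comp (hB.measurable_ctx t)) (measurableSet_singleton k)
  have hone : ∀ n, mgf (fun ω => if X t ω n = k then (1 : ℝ) else 0) P (-c) ≤
      Real.exp (-(u / (2 * K))) := by
    intro n
    have e1 : ∀ ω, Real.exp (-c * (if X t ω n = k then (1 : ℝ) else 0)) ≤
        1 - u / 2 * ({ω | X t ω n = k}.indicator (1 : Ω → ℝ)) ω := by
      intro ω
      by_cases h : X t ω n = k
      · have h2 := half_le_one_sub_exp h0 h1
        have h3 : Real.exp (-c) ≤ Real.exp (-u) := Real.exp_le_exp.mpr (by linarith)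
        simp [h]
        linarith
      · simp [h]
    have hi : Integrable ({ω | X t ω n = k}.indicator (1 : Ω → ℝ)) P :=
      (integrable_const (1 : ℝ)).indicator (hset n)
    have e2 : ∫ ω, (1 - u / 2 * ({ω | X t ω n = k}.indicator (1 : Ω → ℝ)) ω) ∂P =
        1 - u / (2 * K) := by
      rw [integral_sub (integrable_const 1) (hi.const_mul _), integral_const_mul,
        integral_indicator_one (hset n), (hX t).2 n k]
      simp
      ring
    calc _ ≤ 1 - u / (2 * K) := by
          rw [← e2, mgf]
          exact integral_mono_of_nonneg
            (Filter.Eventually.of_forall fun ω => (Real.exp_pos _).le)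
            ((integrable_const 1).sub (hi.const_mul _)) (Filter.Eventually.of_forall e1)
      _ ≤ _ := Real.one_sub_le_exp_neg _
  have hmeas : ∀ n, Measurable fun ω => if X t ω n = k then (1 : ℝ) else 0 := fun n =>
    Measurable.ite (hset n) measurable_const measurable_const
  have hindep : iIndepFun (fun (n : Fin N) (ω : Ω) => if X t ω n = k then (1 : ℝ) else 0) P :=
    (hX t).1.comp (fun _ x => if x = k then (1 : ℝ) else 0) fun _ => Measurable.of_discrete
  have hsum : ∀ ω, ((S.filter fun n => X t ω n = k).card : ℝ) =
      (∑ n ∈ S, fun ω => if X t ω n = k then (1 : ℝ) else 0) ω := fun ω => by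
    simp
  have hmg := hindep.mgf_sum (t := -c) hmeas S
  simp only [hsum]
  have hle : mgf (∑ n ∈ S, fun ω => if X t ω n = k then (1 : ℝ) else 0) P (-c) ≤
      Real.exp (-(u / (2 * K) * S.card)) := by
    rw [hmg]
    calc _ ≤ ∏ _n ∈ S, Real.exp (-(u / (2 * K))) :=
          Finset.prod_le_prod (fun n _ => mgf_nonneg) fun n _ => hone n
      _ = _ := by rw [Finset.prod_const, ← Real.exp_nat_mul]; congr 1; ring
  refine le_trans (le_of_eq ?_) (ENNReal.ofReal_le_ofReal hle)
  rw [mgf, ofReal_integral_eq_lintegral_ofReal]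
  · refine Integrable.of_mem_Icc 0 (Real.exp (|c| * N)) ?_ (Filter.Eventually.of_forall fun ω =>
      ⟨(Real.exp_pos _).le, Real.exp_le_exp.mpr ?_⟩)
    · have hm := Finset.measurable_sum S fun n _ => hmeas n
      simp only [Finset.sum_apply]
      exact (Real.measurable_exp.comp (hm.const_mul _)).aemeasurable
    · rw [← hsum]
      have h2 : ((S.filter fun n => X t ω n = k).card : ℝ) ≤ N := by
        have := Finset.card_le_univ (S.filter fun n => X t ω n = k)
        rw [Fintype.card_fin] at this
        exact Nat.cast_le.mpr this
      have h3 : (0 : ℝ) ≤ ((S.filter fun n => X t ω n = k).card : ℝ) := Nat.cast_nonneg _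
      calc _ ≤ |c| * ((S.filter fun n => X t ω n = k).card : ℝ) :=
            mul_le_mul_of_nonneg_right (neg_le_abs c) h3
        _ ≤ _ := by gcongr
  · exact Filter.Eventually.of_forall fun ω => (Real.exp_pos _).le

/-- For a fixed division into groups of size `N / τ`, the groups in `B` comprise `|B| N / τ`
independent users. The division is independent of the contexts, so averaging over it preserves the
bound. -/
lemma sampleRate_of_uniformUsers (hB : IsBroadcastModel P D X G R) (hX : UniformUsers P X)
    (hτ : 0 < τ) {c u : ℝ} (h0 : 0 ≤ u) (h1 : u ≤ 1) (hc : u ≤ c) :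
    SampleRate P X G c (u / (2 * K) * (N / τ)) := by
  classical
  have hprob := hB.prob
  intro t k B
  let Ψ (x : Fin N → Fin K) (g : Fin N → Fin τ) : ENNReal := ENNReal.ofReal (Real.exp (-c *
    (Finset.univ.filter fun n => x n = k ∧ g n ∈ B).card))
  have hGm := hB.measurable_grp t
  have hXm := hB.measurable_ctx t
  have hind : ∀ g, Measurable fun q : Fin N → Fin τ => if q = g then (1 : ENNReal) else 0 :=
    fun g => Measurable.of_discrete
  have hΨ : ∀ g, Measurable fun x => Ψ x g := fun g => Measurable.of_discrete
  have hindG : ∀ g, Measurable fun ω => if G t ω = g then (1 : ENNReal) else 0 :=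
    fun g => (hind g).comp hGm
  have hΨX : ∀ g, Measurable fun ω => Ψ (X t ω) g := fun g => (hΨ g).comp hXm
  have hgrp : ∀ g, (¬ ∀ s, (Finset.univ.filter fun n => g n = s).card * τ = N) →
      ∫⁻ ω, (if G t ω = g then (1 : ENNReal) else 0) ∂P = 0 := by
    intro g hg
    rw [lintegral_eq_zero_iff (hindG g)]
    filter_upwards [hB.ae_group_card t] with ω hω
    have : G t ω ≠ g := by rintro rfl; exact hg hω
    simp [this]
  have hfix : ∀ g, (∀ s, (Finset.univ.filter fun n => g n = s).card * τ = N) →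
      ∫⁻ ω, Ψ (X t ω) g ∂P ≤ ENNReal.ofReal (Real.exp (-(u / (2 * K) * (N / τ) * B.card))) := by
    intro g hg
    have h := lintegral_exp_users_le hB hX t k (Finset.univ.filter fun n => g n ∈ B) h0 h1 hc
    have hcard : (((Finset.univ.filter fun n => g n ∈ B).card : ℕ) : ℝ) = N / τ * B.card := by
      have e1 : (Finset.univ.filter fun n => g n ∈ B).card * τ = B.card * N := by
        rw [Finset.card_eq_sum_card_fiberwise (f := g) (t := B) fun n hn => by simpa using hn,
          Finset.sum_mul, ← smul_eq_mul, ← Finset.sum_const]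
        refine Finset.sum_congr rfl fun s hs => ?_
        refine Eq.trans ?_ (hg s)
        rw [Finset.filter_filter]
        congr 2
        ext n
        simp only [Finset.mem_filter, Finset.mem_univ, true_and]
        exact ⟨fun h => h.2, fun h => ⟨h ▸ hs, h⟩⟩
      have e2 : (((Finset.univ.filter fun n => g n ∈ B).card : ℕ) : ℝ) * τ = B.card * N := by
        exact_mod_cast e1
      have hτ' : (0 : ℝ) < τ := by exact_mod_cast hτ
      field_simp
      linarith
    rw [hcard] at h
    refine le_trans (le_of_eq (lintegral_congr fun ω => ?_)) (h.trans (le_of_eq ?_))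
    · simp only [Ψ, Finset.filter_filter]
      congr 5
      ext n
      simp [and_comm]
    · congr 2; ring
  calc _ = ∫⁻ ω, ∑ g, (if G t ω = g then (1 : ENNReal) else 0) * Ψ (X t ω) g ∂P := by
        refine lintegral_congr fun ω => ?_
        simp [ite_mul, Finset.sum_ite_eq, Ψ]
    _ = ∑ g, (∫⁻ ω, (if G t ω = g then (1 : ENNReal) else 0) ∂P) * ∫⁻ ω, Ψ (X t ω) g ∂P := by
        refine (lintegral_finsetSum _ fun g _ => (hindG g).mul (hΨX g)).trans ?_
        refine Finset.sum_congr rfl fun g _ => ?_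
        exact lintegral_mul_eq_lintegral_mul_lintegral_of_indepFun (hindG g)
          (hΨX g) ((hB.indep_ctx_grp t).symm.comp (hind g) (hΨ g))
    _ ≤ ∑ g, (∫⁻ ω, (if G t ω = g then (1 : ENNReal) else 0) ∂P) *
          ENNReal.ofReal (Real.exp (-(u / (2 * K) * (N / τ) * B.card))) := by
        refine Finset.sum_le_sum fun g _ => ?_
        -- Divisions into groups of unequal size have probability zero.
        by_cases hg : ∀ s, (Finset.univ.filter fun n => g n = s).card * τ = N
        · exact mul_le_mul_right (hfix g hg) _
        · rw [hgrp g hg]; simp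
    _ = _ := by
        rw [← Finset.sum_mul, ← lintegral_finsetSum _ fun g _ => hindG g]
        simp

end

section

variable {N K M τ L : ℕ} [NeZero M] {Ω : Type*} [mΩ : MeasurableSpace Ω] {P : Measure Ω}
  {π : Policy N K M τ} {X : ℕ → Ω → Fin N → Fin K}
  {G : ℕ → Ω → Fin N → Fin τ} {R : ℕ → Ω → Fin N → Fin K → Fin M → ℝ}
  {D : Fin K → Fin M → Measure ℝ} {δ : ℝ} {typ : Fin M → Fin L}

/-! ### Exploration with prescribed transmissions -/

/-- The groups in `B u` surely receive `m` in slot `s + u`; receivers outside them only add samples,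
which lowers the exponential since `c ≥ 0`. -/
lemma lintegral_expStat_phase_le (hB : IsBroadcastModel P D X G R) (hD : IsLatentPayoff δ D typ)
    (hπ : UsesStatistics π X G R) {c β : ℝ} (hβ : SampleRate P X G c β) (hc : 0 ≤ c)
    (θ : ℝ) (k : Fin K) (m : Fin M) {s : ℕ} {V : Ω → ENNReal} (hV : Measurable[past X G R s] V)
    (B : ℕ → Finset (Fin τ)) (J : ℕ)
    (hrule : ∀ ω, V ω ≠ 0 → ∀ u < J, ∀ x g n, g n ∈ B u → ruleAt π X G R (s + u) ω x g n = m) :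
    ∫⁻ ω, V ω * expStat π X G R D θ c k m (s + J) ω ∂P ≤
      ENNReal.ofReal (Real.exp (-(β * ∑ u ∈ Finset.range J, ((B u).card : ℝ)))) *
        ∫⁻ ω, V ω * expStat π X G R D θ c k m s ω ∂P := by
  induction J with
  | zero => simp
  | succ J ih =>
    have h1 := lintegral_expStat_succ_le hB hD hπ (t := s + J) θ c k m
      (hV.mono (past_mono X G R (Nat.le_add_right s J)) le_rfl)
      (b := ENNReal.ofReal (Real.exp (-(β * (B J).card)))) fun ω hω => by
        refine le_trans (lintegral_mono fun ω' => ENNReal.ofReal_le_ofReal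
          (Real.exp_le_exp.mpr ?_)) (hβ (s + J) k (B J))
        refine mul_le_mul_of_nonpos_left (Nat.cast_le.mpr (Finset.card_le_card fun n hn => ?_))
          (by linarith)
        simp only [Finset.mem_filter, Finset.mem_univ, true_and] at hn ⊢
        exact ⟨hn.1, hrule ω hω J (Nat.lt_succ_self J) _ _ n hn.2⟩
    refine h1.trans ((mul_le_mul_right (ih fun ω hω u hu => hrule ω hω u (by omega)) _).trans
      (le_of_eq ?_))
    rw [← mul_assoc, ← ENNReal.ofReal_mul (Real.exp_pos _).le, ← Real.exp_add,
      Finset.sum_range_succ]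
    congr 3
    ring

/-- After a phase with prescribed transmissions of a message, its averages are accurate. -/
lemma measure_phase_deviation_le (hB : IsBroadcastModel P D X G R) (hD : IsLatentPayoff δ D typ)
    (hπ : UsesStatistics π X G R) {ε β : ℝ} (hε : 0 ≤ ε) (hβ : SampleRate P X G (2 * ε ^ 2) β)
    (k : Fin K) (m : Fin M) {s : ℕ} {F : Set Ω} (hF : MeasurableSet[past X G R s] F)
    (B : ℕ → Finset (Fin τ)) (J : ℕ) {t : ℕ} (ht : s + J ≤ t)
    (hrule : ∀ ω ∈ F, ∀ u < J, ∀ x g n, g n ∈ B u → ruleAt π X G R (s + u) ω x g n = m) :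
    P (F ∩ {ω | ε ≤ |avg (history π X G R t ω) k m - meanPayoff D k m|}) ≤
      ENNReal.ofReal (Real.exp (-(β * ∑ u ∈ Finset.range J, ((B u).card : ℝ)))) *
        ((∫⁻ ω in F, expStat π X G R D (4 * ε) (2 * ε ^ 2) k m s ω ∂P) +
          ∫⁻ ω in F, expStat π X G R D (-(4 * ε)) (2 * ε ^ 2) k m s ω ∂P) := by
  have hc : 0 ≤ 2 * ε ^ 2 := by positivity
  have hF' : MeasurableSet F := hB.past_le s F hF
  set V : Ω → ENNReal := F.indicator 1 with hVdef
  have hV : Measurable[past X G R s] V :=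
    let _ : MeasurableSpace Ω := past X G R s
    measurable_one.indicator hF
  have hVm : Measurable V := hV.mono (hB.past_le s) le_rfl
  have hU : ∀ θ t, Measurable (expStat π X G R D θ (2 * ε ^ 2) k m t) := fun θ t =>
    (measurable_expStat hπ θ _ k m t).mono (hB.past_le t) le_rfl
  have hVne : ∀ ω, V ω ≠ 0 → ω ∈ F := fun ω h => by
    by_contra h'
    exact h (Set.indicator_of_notMem h' _)
  have hstep : ∀ θ, ∫⁻ ω, V ω * expStat π X G R D θ (2 * ε ^ 2) k m t ω ∂P ≤
      ENNReal.ofReal (Real.exp (-(β * ∑ u ∈ Finset.range J, ((B u).card : ℝ)))) *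
        ∫⁻ ω in F, expStat π X G R D θ (2 * ε ^ 2) k m s ω ∂P := by
    intro θ
    refine (lintegral_expStat_antitone hB hD hπ ht θ hc k m
      (hV.mono (past_mono X G R (Nat.le_add_right s J)) le_rfl)).trans ?_
    refine (lintegral_expStat_phase_le hB hD hπ hβ hc θ k m hV B J fun ω hω =>
      hrule ω (hVne ω hω)).trans (le_of_eq ?_)
    congr 1
    rw [← lintegral_indicator hF']
    refine lintegral_congr fun ω => ?_
    by_cases h : ω ∈ F <;> simp [V, h]
  rw [mul_add]
  calc _ ≤ ∫⁻ ω, (V ω * expStat π X G R D (4 * ε) (2 * ε ^ 2) k m t ω +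
        V ω * expStat π X G R D (-(4 * ε)) (2 * ε ^ 2) k m t ω) ∂P := by
        have h1 := meas_ge_le_lintegral_div (μ := P) (((hVm.mul (hU (4 * ε) t)).add
          (hVm.mul (hU (-(4 * ε)) t))).aemeasurable) one_ne_zero ENNReal.one_ne_top
        rw [div_one] at h1
        refine le_trans (measure_mono fun ω hω => ?_) h1
        -- With `c = 2 ε ^ 2` the gain from the deviation and the compensation cancel for every
        -- number of samples, so Markov's inequality is used at level one.
        have h2 := one_le_expStat (q := 0) (c := 2 * ε ^ 2) hε hω.2 (by simp)
        simpa [V, hω.1] using h2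
    _ = _ := lintegral_add_left (hVm.mul (hU _ t)) _
    _ ≤ _ := add_le_add (hstep _) (hstep _)

/-! ### The broadcasting algorithm -/

variable {T : ℕ} {c : Choices M} {k₀ : Fin K}

variable (X G R T δ c k₀) in
/-- The representatives that the broadcasting algorithm finds after the first phase. -/
noncomputable def bReps (ω : Ω) : Finset (Fin M) :=
  reps c (cluster c (δ / 2) fun a b =>
    |avg (history (broadcastPolicy N K M τ T δ c k₀) X G R (phase₁ N K M τ T δ) ω) k₀ a
      - avg (history (broadcastPolicy N K M τ T δ c k₀) X G R (phase₁ N K M τ T δ) ω) k₀ b|)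

/-- The representatives are known when the second phase begins, so each possible value is an
admissible conditioning event for it. -/
lemma measurableSet_bReps_eq (A : Finset (Fin M)) :
    MeasurableSet[past X G R (phase₁ N K M τ T δ)] {ω | bReps X G R δ T c k₀ ω = A} := by
  let _ : MeasurableSpace Ω := past X G R (phase₁ N K M τ T δ)
  let _ : MeasurableSpace (Finset (Fin M)) := ⊤
  have h : Measurable (bReps X G R δ T c k₀) := by
    have hπ := usesStatistics_broadcastPolicy (τ := τ) X G R T δ c k₀
    refine measurable_of_factor (measurable_clusterTable (θ := δ / 2) (d := fun ω a b =>
      |avg (history (broadcastPolicy N K M τ T δ c k₀) X G R (phase₁ N K M τ T δ) ω) k₀ a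
      - avg (history (broadcastPolicy N K M τ T δ c k₀) X G R (phase₁ N K M τ T δ) ω) k₀ b|)
      fun a b => ?_) fun ω ω' h => ?_
    · have h : Measurable fun ω =>
        avg (history (broadcastPolicy N K M τ T δ c k₀) X G R (phase₁ N K M τ T δ) ω) k₀ a
        - avg (history (broadcastPolicy N K M τ T δ c k₀) X G R (phase₁ N K M τ T δ) ω) k₀ b :=
        (measurable_avg_past hπ le_rfl k₀ a).sub (measurable_avg_past hπ le_rfl k₀ b)
      exact measurable_norm.comp h
    · rw [bReps, bReps, cluster_congr h]
  exact h (MeasurableSpace.measurableSet_top (s := {A}))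

lemma ruleAt_phase_one {t : ℕ} (ht : t < phase₁ N K M τ T δ) (ω : Ω) (x : Fin N → Fin K)
    (g : Fin N → Fin τ) (n : Fin N) :
    ruleAt (broadcastPolicy N K M τ T δ c k₀) X G R t ω x g n = Fin.ofNat M (t * τ + g n) := by
  simp only [ruleAt]
  rw [broadcastPolicy]
  simp only [history_length, if_pos ht]

lemma ruleAt_after {t : ℕ} (ht : phase₁ N K M τ T δ ≤ t) (ω : Ω) (x : Fin N → Fin K)
    (g : Fin N → Fin τ) (n : Fin N) :
    ruleAt (broadcastPolicy N K M τ T δ c k₀) X G R t ω x g n =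
      if t < phase₁ N K M τ T δ + phase₂ N K (bReps X G R δ T c k₀ ω).card τ T δ then
        ((bReps X G R δ T c k₀ ω).sort (· ≤ ·)).getD
          (((t - phase₁ N K M τ T δ) * τ + g n) % (bReps X G R δ T c k₀ ω).card) 0
      else argmax c (bReps X G R δ T c k₀ ω) fun m => ∑ n' with g n' = g n,
        avg (history (broadcastPolicy N K M τ T δ c k₀) X G R t ω) (x n') m := by
  have hdrop := history_drop (broadcastPolicy N K M τ T δ c k₀) X G R (phase₁ N K M τ T δ)
    (t - phase₁ N K M τ T δ) ω
  rw [show phase₁ N K M τ T δ + (t - phase₁ N K M τ T δ) = t by omega] at hdrop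
  have hnt : ¬ t < phase₁ N K M τ T δ := by omega
  simp only [ruleAt]
  conv_lhs => rw [broadcastPolicy]
  simp only [history_length, if_neg hnt, hdrop]
  rfl

lemma measure_phase_one_le (hB : IsBroadcastModel P D X G R) (hD : IsLatentPayoff δ D typ)
    (hδ : 0 < δ) {β : ℝ} (hβ0 : 0 ≤ β) (hβ : SampleRate P X G (2 * (δ / 4) ^ 2) β) (m : Fin M) :
    P {ω | δ / 4 ≤ |avg (history (broadcastPolicy N K M τ T δ c k₀) X G R
        (phase₁ N K M τ T δ) ω) k₀ m - meanPayoff D k₀ m|} ≤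
      ENNReal.ofReal (2 * Real.exp (-(β * (phase₁ N K M τ T δ * τ / M : ℕ)))) := by
  have hprob := hB.prob
  have hπ := usesStatistics_broadcastPolicy (τ := τ) X G R T δ c k₀
  have hc : 0 ≤ 2 * (δ / 4) ^ 2 := by positivity
  have h := measure_phase_deviation_le hB hD hπ (by positivity : 0 ≤ δ / 4) hβ k₀ m (s := 0)
    (F := Set.univ) MeasurableSet.univ
    (fun u => Finset.univ.filter fun s : Fin τ => (u * τ + s) % M = m) (phase₁ N K M τ T δ)
    (t := phase₁ N K M τ T δ) (by omega) fun ω _ u hu x g n hn => by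
      simp only [Finset.mem_filter, Finset.mem_univ, true_and] at hn
      rw [ruleAt_phase_one (by omega)]
      apply Fin.ext
      rw [zero_add, ← hn]
      rfl
  rw [Set.univ_inter] at h
  refine h.trans ?_
  simp only [expStat_zero, Measure.restrict_univ, lintegral_const, measure_univ, one_mul]
  rw [one_add_one_eq_two, mul_comm, ENNReal.ofReal_mul (by norm_num), ENNReal.ofReal_ofNat]
  gcongr
  exact_mod_cast div_le_sum_card_mod m.2 (phase₁ N K M τ T δ)

/-- Given the set of representatives, the second phase is a prescribed schedule and its length is
that for `L` clusters. The failure bounds for the different sets are weighted by integrals over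
disjoint events, so summing over the sets costs no combinatorial factor. -/
lemma measure_phase_two_le (hB : IsBroadcastModel P D X G R) (hD : IsLatentPayoff δ D typ)
    {ε β : ℝ} (hε : 0 ≤ ε) (hβ0 : 0 ≤ β) (hβ : SampleRate P X G (2 * ε ^ 2) β)
    (k : Fin K) (m : Fin M) {t : ℕ} (ht : phase₁ N K M τ T δ + phase₂ N K L τ T δ ≤ t) :
    P {ω | ((bReps X G R δ T c k₀ ω).card = L ∧ m ∈ bReps X G R δ T c k₀ ω) ∧
        ε ≤ |avg (history (broadcastPolicy N K M τ T δ c k₀) X G R t ω) k m - meanPayoff D k m|} ≤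
      ENNReal.ofReal (2 * Real.exp (-(β * (phase₂ N K L τ T δ * τ / L : ℕ)))) := by
  have hprob := hB.prob
  have hπ := usesStatistics_broadcastPolicy (τ := τ) X G R T δ c k₀
  set E := {ω | ε ≤ |avg (history (broadcastPolicy N K M τ T δ c k₀) X G R t ω) k m
    - meanPayoff D k m|}
  set F : Finset (Fin M) → Set Ω := fun A => {ω | bReps X G R δ T c k₀ ω = A} with hF
  set b := ENNReal.ofReal (Real.exp (-(β * (phase₂ N K L τ T δ * τ / L : ℕ))))
  set U := fun θ => expStat (broadcastPolicy N K M τ T δ c k₀) X G R D θ (2 * ε ^ 2) k m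
    (phase₁ N K M τ T δ)
  have hFm : ∀ A, MeasurableSet (F A) := fun A =>
    hB.past_le _ _ (measurableSet_bReps_eq A)
  set 𝒜 : Finset (Finset (Fin M)) := Finset.univ.filter fun A => A.card = L ∧ m ∈ A with h𝒜
  have hone : ∀ A ∈ 𝒜, P (F A ∩ E) ≤
      b * ((∫⁻ ω in F A, U (4 * ε) ω ∂P) + ∫⁻ ω in F A, U (-(4 * ε)) ω ∂P) := by
    intro A hA
    obtain ⟨hcard, hm⟩ := (Finset.mem_filter.mp hA).2
    -- The position `i` of `m` in the sorted list is its residue in the round robin modulo `L`.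
    have hms : m ∈ A.sort (· ≤ ·) := (Finset.mem_sort _).mpr hm
    obtain ⟨i, hi, him⟩ := List.mem_iff_getElem.mp hms
    have hi' : i < A.card := by rwa [Finset.length_sort] at hi
    refine (measure_phase_deviation_le hB hD hπ hε hβ k m (measurableSet_bReps_eq A)
      (fun u => Finset.univ.filter fun s : Fin τ => (u * τ + s) % L = i) (phase₂ N K L τ T δ)
      ht fun ω hω u hu x g n hn => ?_).trans ?_
    · simp only [Finset.mem_filter, Finset.mem_univ, true_and] at hn
      have hω' : bReps X G R δ T c k₀ ω = A := hω
      rw [ruleAt_after (Nat.le_add_right _ _), hω', hcard, if_pos (by omega),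
        Nat.add_sub_cancel_left, hn, List.getD_eq_getElem _ _ hi, him]
    · refine mul_le_mul_left (ENNReal.ofReal_le_ofReal (Real.exp_le_exp.mpr ?_)) _
      have h3 := div_le_sum_card_mod (τ := τ) (hcard ▸ hi') (phase₂ N K L τ T δ)
      have h4 : ((phase₂ N K L τ T δ * τ / L : ℕ) : ℝ) ≤ ∑ u ∈ Finset.range (phase₂ N K L τ T δ),
          ((Finset.univ.filter fun s : Fin τ => (u * τ + s) % L = i).card : ℝ) := by
        exact_mod_cast h3
      have := mul_le_mul_of_nonneg_left h4 hβ0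
      linarith
  have hsum : ∀ θ, ∑ A ∈ 𝒜, ∫⁻ ω in F A, U θ ω ∂P ≤ 1 := by
    intro θ
    rw [← lintegral_biUnion_finset (fun A _ A' _ hne => Set.disjoint_left.mpr
      fun ω h1 h2 => hne (h1.symm.trans h2)) fun A _ => hFm A]
    exact (setLIntegral_le_lintegral _ _).trans
      (lintegral_expStat_le_one hB hD hπ _ θ (by positivity) k m)
  calc _ ≤ P (⋃ A ∈ 𝒜, F A ∩ E) := by
        refine measure_mono fun ω hω => ?_
        simp only [Set.mem_iUnion]
        exact ⟨bReps X G R δ T c k₀ ω, Finset.mem_filter.mpr ⟨Finset.mem_univ _, hω.1⟩, rfl, hω.2⟩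
    _ ≤ ∑ A ∈ 𝒜, P (F A ∩ E) := measure_biUnion_finset_le _ _
    _ ≤ ∑ A ∈ 𝒜, b * ((∫⁻ ω in F A, U (4 * ε) ω ∂P) + ∫⁻ ω in F A, U (-(4 * ε)) ω ∂P) :=
        Finset.sum_le_sum hone
    _ ≤ b * (1 + 1) := by
        rw [← Finset.mul_sum, Finset.sum_add_distrib]
        gcongr
        · exact hsum _
        · exact hsum _
    _ = _ := by
        rw [one_add_one_eq_two, mul_comm, ENNReal.ofReal_mul (by norm_num), ENNReal.ofReal_ofNat]

end

/-! ### Exploitation and regret of the broadcasting algorithm -/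

section

variable {N K M τ L : ℕ} [NeZero M] {Ω : Type*} [mΩ : MeasurableSpace Ω] {P : Measure Ω}
  {X : ℕ → Ω → Fin N → Fin K}
  {G : ℕ → Ω → Fin N → Fin τ} {R : ℕ → Ω → Fin N → Fin K → Fin M → ℝ}
  {D : Fin K → Fin M → Measure ℝ} {δ : ℝ} {typ : Fin M → Fin L}
  {T : ℕ} {c : Choices M} {k₀ : Fin K}

/-- In the exploitation phase no mean payoff is lost if all relevant averages are accurate. -/
lemma sum_gap_broadcast_nonpos (hD : IsLatentPayoff δ D typ) (hδ : 0 < δ) (hN : 1 ≤ N) {t : ℕ}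
    {ω : Ω} (hgrp : ∀ s, (Finset.univ.filter fun n => G t ω n = s).card * τ = N)
    (h1 : ∀ m, |avg (history (broadcastPolicy N K M τ T δ c k₀) X G R
      (phase₁ N K M τ T δ) ω) k₀ m - meanPayoff D k₀ m| < δ / 4)
    (h2 : ∀ k, ∀ m ∈ bReps X G R δ T c k₀ ω, |avg (history (broadcastPolicy N K M τ T δ c k₀) X G R
      t ω) k m - meanPayoff D k m| < δ * τ / (2 * N))
    (ht : phase₁ N K M τ T δ + phase₂ N K L τ T δ ≤ t) :
    (bReps X G R δ T c k₀ ω).card = L ∧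
    ∑ n, gap (broadcastPolicy N K M τ T δ c k₀) X G R D t n ω ≤ 0 := by
  have hreps : bReps X G R δ T c k₀ ω = reps c (typeClasses typ) := by
    rw [bReps, cluster_eq_typeClasses (typ := typ)]
    · exact fun a b _ => hD.dist_lt_iff hδ (h1 a) (h1 b)
    · exact hD.typ_surjective
  obtain ⟨hcard, hA⟩ := reps_typeClasses (c := c) hD.typ_surjective
  refine ⟨hreps ▸ hcard, ?_⟩
  rw [← Finset.sum_fiberwise Finset.univ (G t ω)]
  refine Finset.sum_nonpos fun s _ => ?_
  have hne : (reps c (typeClasses typ)).Nonempty := by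
    obtain ⟨m, hm, -⟩ := hA (typ 0)
    exact ⟨m, hm⟩
  have hspec := argmax_spec (c := c) hne fun m => ∑ n' with G t ω n' = s,
    avg (history (broadcastPolicy N K M τ T δ c k₀) X G R t ω) (X t ω n') m
  set b := argmax c (reps c (typeClasses typ)) fun m => ∑ n' with G t ω n' = s,
    avg (history (broadcastPolicy N K M τ T δ c k₀) X G R t ω) (X t ω n') m with hb
  have hgap : ∀ n ∈ Finset.univ.filter (fun n => G t ω n = s),
      gap (broadcastPolicy N K M τ T δ c k₀) X G R D t n ω =
        meanPayoff D (X t ω n) (bestMsg (meanPayoff D) (X t ω) (G t ω) s)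
          - meanPayoff D (X t ω n) b := by
    intro n hn
    have hn' : G t ω n = s := (Finset.mem_filter.mp hn).2
    rw [gap, action_eq, ruleAt_after (by omega), hreps, hcard, if_neg (by omega), hn', hb]
  rw [Finset.sum_congr rfl hgap]
  rw [hreps] at h2
  -- A group has `N / τ` users, so the accuracy `δ τ / (2 N)` makes `2 ε` times the group size
  -- exactly `δ`.
  refine sum_gap_group_nonpos hD hδ hA (fun n m hm => h2 (X t ω n) m hm) (le_of_eq ?_)
    hspec.1 hspec.2
  have hNr : (0 : ℝ) < N := by exact_mod_cast hN
  have : ((Finset.univ.filter fun n => G t ω n = s).card : ℝ) * τ = N := by exact_mod_cast hgrp s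
  rw [show 2 * (δ * τ / (2 * N)) * ((Finset.univ.filter fun n => G t ω n = s).card : ℝ) =
    δ * (((Finset.univ.filter fun n => G t ω n = s).card : ℝ) * τ) / N by field_simp, this]
  field_simp

/-- This separates the degenerate phases of length zero from those that are long enough to survive
rounding down. -/
lemma log_natCast_eq_zero_or (x : ℕ) : Real.log x = 0 ∨ 1 / 2 ≤ Real.log x := by
  rcases Nat.lt_or_ge x 2 with h | h
  · left
    interval_cases x <;> simp
  · right
    have h2 : Real.log 2 ≤ Real.log x := Real.log_le_log (by norm_num) (by exact_mod_cast h)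
    have := Real.log_two_gt_d9
    linarith

/-- Here `z` is the ideal number of transmissions per message, of which at least `z / 2` take place.
-/
lemma exp_neg_mul_natDiv_le {β z y : ℝ} {J r : ℕ} {x : ℕ} (p : ℕ) (hx : 0 < x) (hβ : 0 ≤ β)
    (hr : 0 < r)
    (hy : y ≤ J) (hz : z = y * τ / r) (hz1 : z = 0 ∨ 1 ≤ z) (hβz : β * (z / 2) = p * Real.log x) :
    Real.exp (-(β * (J * τ / r : ℕ))) ≤ 1 / (x : ℝ) ^ p := by
  have hr' : (0 : ℝ) < r := by exact_mod_cast hr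
  have h1 : z / 2 ≤ ((J * τ / r : ℕ) : ℝ) := by
    refine half_le_natDiv ?_ hz1
    rw [hz]
    push_cast
    gcongr
  have h2 := mul_le_mul_of_nonneg_left h1 hβ
  have hx' : (0 : ℝ) < x := by exact_mod_cast hx
  calc Real.exp (-(β * (J * τ / r : ℕ))) ≤ Real.exp (-(p * Real.log x)) :=
        Real.exp_le_exp.mpr (by linarith)
    _ = _ := by
        rw [Real.exp_neg, Real.exp_nat_mul, Real.exp_log hx', one_div]

-- The ideal number of transmissions per message is `32 K / δ ^ 2` times the logarithm. Half of it,
-- times the rate `δ ^ 2 / (16 K)`, is the logarithm itself.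
variable (N K M τ T δ) in
lemma phase_one_failure_le (hN : 1 ≤ N) (hK : 1 ≤ K) (hT : 1 ≤ T) (hτ : 1 ≤ τ) (hδ : 0 < δ)
    (hδ1 : δ ≤ 1) :
    Real.exp (-(δ ^ 2 / (16 * K) * (phase₁ N K M τ T δ * τ / M : ℕ))) ≤ 1 / (N * T * M) := by
  have hM : 1 ≤ M := NeZero.one_le
  have hK' : (1 : ℝ) ≤ K := by exact_mod_cast hK
  have hM' : (0 : ℝ) < M := by exact_mod_cast hM
  have hτ' : (0 : ℝ) < τ := by exact_mod_cast hτ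
  have h := exp_neg_mul_natDiv_le (τ := τ) (β := δ ^ 2 / (16 * K)) (J := phase₁ N K M τ T δ)
    (r := M) (y := 32 * K * M / (τ * δ ^ 2) * Real.log (N * T * M))
    (z := 32 * K / δ ^ 2 * Real.log (N * T * M)) (x := N * T * M) 1 (by positivity)
    (by positivity) (by omega) (Nat.le_ceil _) (by field_simp) ?_ (by push_cast; field_simp; ring)
  · simpa using h
  · have hl := log_natCast_eq_zero_or (N * T * M)
    push_cast at hl
    rcases hl with hl | hl
    · left; rw [hl, mul_zero]
    · right
      have : (32 : ℝ) ≤ 32 * K / δ ^ 2 := by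
        rw [le_div_iff₀ (by positivity)]
        have : δ ^ 2 ≤ 1 := by nlinarith
        nlinarith
      nlinarith

-- The ideal number `16 N K / (τ δ ^ 2) log x` with `x = L N K T`, halved and multiplied by the
-- rate, is `2 log x`. The square pays for a union over slots, contexts and messages.
variable (N K τ T δ) in
lemma phase_two_failure_le (hN : 1 ≤ N) (hK : 1 ≤ K) (hT : 1 ≤ T) (hτ : 1 ≤ τ) (hτN : τ ≤ N)
    (hL : 1 ≤ L) (hδ : 0 < δ) (hδ1 : δ ≤ 1) :
    Real.exp (-(δ ^ 2 * τ / (4 * N * K) * (phase₂ N K L τ T δ * τ / L : ℕ))) ≤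
      1 / ((L * N * K * T : ℕ) : ℝ) ^ 2 := by
  have hK' : (1 : ℝ) ≤ K := by exact_mod_cast hK
  have hN' : (0 : ℝ) < N := by exact_mod_cast hN
  have hL' : (0 : ℝ) < L := by exact_mod_cast hL
  have hτ' : (0 : ℝ) < τ := by exact_mod_cast hτ
  have hτN' : (τ : ℝ) ≤ N := by exact_mod_cast hτN
  refine exp_neg_mul_natDiv_le (τ := τ) (β := δ ^ 2 * τ / (4 * N * K)) (J := phase₂ N K L τ T δ)
    (r := L) (y := 16 * N * K * L / (τ ^ 2 * δ ^ 2) * Real.log (L * N * K * T))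
    (z := 16 * N * K / (τ * δ ^ 2) * Real.log (L * N * K * T)) (x := L * N * K * T) 2
    (by positivity)
    (by positivity) (by omega) (Nat.le_ceil _) (by field_simp) ?_ (by push_cast; field_simp; ring)
  have hl := log_natCast_eq_zero_or (L * N * K * T)
  push_cast at hl
  rcases hl with hl | hl
  · left; rw [hl, mul_zero]
  · right
    have : (16 : ℝ) ≤ 16 * N * K / (τ * δ ^ 2) := by
      rw [le_div_iff₀ (by positivity)]
      have : δ ^ 2 ≤ 1 := by nlinarith
      have h2 : τ * δ ^ 2 ≤ N * 1 := by gcongr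
      nlinarith
    nlinarith

/-- While the second phase lasts, there are not more messages than users. -/
lemma le_mul_of_phase_one_lt (hK : 1 ≤ K) (hN : 1 ≤ N) (hT : 1 ≤ T) (hτ : 1 ≤ τ) (hτN : τ ≤ N)
    (hδ : 0 < δ) (hδ1 : δ ≤ 1) (h : phase₁ N K M τ T δ < T) : M ≤ N * T := by
  have hM : 1 ≤ M := NeZero.one_le
  rcases Nat.lt_or_ge 1 M with hM1 | hM1
  swap
  · exact hM1.trans (Nat.mul_pos hN hT)
  have hl := log_natCast_eq_zero_or (N * T * M)
  have hpos : 0 < Real.log ((N * T * M : ℕ) : ℝ) := by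
    refine Real.log_pos ?_
    have : 1 * 1 * 1 < N * T * M := by
      rw [one_mul, one_mul]
      exact hM1.trans_le (Nat.le_mul_of_pos_left M (Nat.mul_pos hN hT))
    exact_mod_cast this
  have hl' : 1 / 2 ≤ Real.log (N * T * M) := by
    rcases hl with hl | hl
    · exact absurd hl hpos.ne'
    · exact_mod_cast hl
  have hK' : (1 : ℝ) ≤ K := by exact_mod_cast hK
  have hτ' : (0 : ℝ) < τ := by exact_mod_cast hτ
  have hM' : (0 : ℝ) < M := by exact_mod_cast hM
  have h1 : 32 * K * M / (τ * δ ^ 2) * Real.log (N * T * M) ≤ T :=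
    (Nat.le_ceil _).trans (Nat.cast_le.mpr h.le)
  have h2 : (M : ℝ) / τ ≤ 32 * K * M / (τ * δ ^ 2) * (1 / 2) := by
    rw [div_mul_eq_mul_div, div_le_div_iff₀ (by positivity) (by positivity)]
    have : δ ^ 2 ≤ 1 := by nlinarith
    have h3 : δ ^ 2 ≤ 16 * K := by linarith
    calc (M : ℝ) * (τ * δ ^ 2) ≤ M * (τ * (16 * K)) := by gcongr
      _ = _ := by ring
  have h3 : (M : ℝ) / τ ≤ T := by
    refine h2.trans (le_trans ?_ h1)
    gcongr
  rw [div_le_iff₀ hτ'] at h3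
  have h4 : M ≤ T * τ := by exact_mod_cast h3
  calc M ≤ T * τ := h4
    _ ≤ T * N := Nat.mul_le_mul_left _ hτN
    _ = N * T := mul_comm _ _

/-- A clustering failure of a message is charged with the whole loss `N T`, an inaccurate average in
an exploitation slot with the loss `N` of that slot. Each kind contributes at most `2` in
expectation. -/
lemma regret_broadcast_le (hB : IsBroadcastModel P D X G R) (hD : IsLatentPayoff δ D typ)
    (hδ : 0 < δ) (hN : 1 ≤ N) (hT : 1 ≤ T) (hτN : τ ∣ N)
    (hβ₁ : SampleRate P X G (2 * (δ / 4) ^ 2) (δ ^ 2 / (16 * K)))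
    (hβ₂ : SampleRate P X G (2 * (δ * τ / (2 * N)) ^ 2) (δ ^ 2 * τ / (4 * N * K))) :
    regret P (broadcastPolicy N K M τ T δ c k₀) (meanPayoff D) X G R T ≤
      N * (phase₁ N K M τ T δ + phase₂ N K L τ T δ) + 4 := by
  have hprob := hB.prob
  have hπ := usesStatistics_broadcastPolicy (τ := τ) X G R T δ c k₀
  have hK : 1 ≤ K := Fin.pos k₀
  have hτ : 1 ≤ τ := Nat.pos_of_dvd_of_pos hτN hN
  have hτN' : τ ≤ N := Nat.le_of_dvd hN hτN
  have hL : 1 ≤ L := Fin.pos (typ 0)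
  have hM : 1 ≤ M := NeZero.one_le
  have hδ1 : δ ≤ 1 := hD.le_one hδ k₀ 0
  set π := broadcastPolicy N K M τ T δ c k₀
  set T₁ := phase₁ N K M τ T δ
  set T₂ := phase₂ N K L τ T δ
  let E₁ (m : Fin M) : Set Ω :=
    {ω | δ / 4 ≤ |avg (history π X G R T₁ ω) k₀ m - meanPayoff D k₀ m|}
  let E₂ (p : ℕ × Fin K × Fin M) : Set Ω :=
    {ω | ((bReps X G R δ T c k₀ ω).card = L ∧ p.2.2 ∈ bReps X G R δ T c k₀ ω) ∧
      δ * τ / (2 * N) ≤ |avg (history π X G R p.1 ω) p.2.1 p.2.2 - meanPayoff D p.2.1 p.2.2|}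
  have havg : ∀ t k m, Measurable fun ω => |avg (history π X G R t ω) k m - meanPayoff D k m| :=
    fun t k m => measurable_norm.comp
      (((measurable_avg_past hπ le_rfl k m).mono (hB.past_le t) le_rfl).sub_const _)
  have hE₁ : ∀ m, MeasurableSet (E₁ m) := fun m =>
    measurableSet_le measurable_const (havg T₁ k₀ m)
  have hreps : ∀ Q : Finset (Fin M) → Prop, MeasurableSet {ω | Q (bReps X G R δ T c k₀ ω)} := by
    intro Q
    have : {ω | Q (bReps X G R δ T c k₀ ω)} =
        ⋃ A ∈ {A | Q A}, {ω | bReps X G R δ T c k₀ ω = A} := by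
      ext ω; simp
    rw [this]
    exact MeasurableSet.biUnion (Set.to_countable _) fun A _ =>
      hB.past_le _ _ (measurableSet_bReps_eq A)
  have hE₂ : ∀ p, MeasurableSet (E₂ p) := fun p =>
    (hreps fun A => A.card = L ∧ p.2.2 ∈ A).inter
      (measurableSet_le measurable_const (havg p.1 p.2.1 p.2.2))
  have hP₁ : ∀ m, P.real (E₁ m) ≤ 2 / (N * T * M) := fun m => by
    have h1 := ENNReal.toReal_le_of_le_ofReal (by positivity)
      (measure_phase_one_le (c := c) (k₀ := k₀) (T := T) hB hD hδ (by positivity) hβ₁ m)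
    have h2 := phase_one_failure_le N K M τ δ T hN hK hT hτ hδ hδ1
    calc P.real (E₁ m) ≤ _ := h1
      _ ≤ 2 * (1 / (N * T * M)) := by gcongr
      _ = _ := by ring
  have hP₂ : ∀ p : ℕ × Fin K × Fin M, T₁ + T₂ ≤ p.1 →
      P.real (E₂ p) ≤ 2 / ((L * N * K * T : ℕ) : ℝ) ^ 2 := fun p hp => by
    have h1 := ENNReal.toReal_le_of_le_ofReal (by positivity)
      (measure_phase_two_le (c := c) (k₀ := k₀) (L := L) hB hD (by positivity) (by positivity)
        hβ₂ p.2.1 p.2.2 hp)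
    have h2 := phase_two_failure_le (L := L) N K τ δ T hN hK hT hτ hτN' hL hδ hδ1
    calc P.real (E₂ p) ≤ _ := h1
      _ ≤ 2 * (1 / ((L * N * K * T : ℕ) : ℝ) ^ 2) := by gcongr
      _ = _ := by ring
  set I := (Finset.range T).filter (fun t => T₁ + T₂ ≤ t) with hI
  have hpath := regret_le_of_ae hB hD hπ T
    (Finset.disjSum (Finset.univ : Finset (Fin M))
      (I ×ˢ (Finset.univ : Finset (Fin K × Fin M))))
    (Sum.elim (fun _ => (N * T : ℝ)) fun _ => (N : ℝ)) (Sum.elim E₁ E₂)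
    (by rintro (m | p); exacts [hE₁ m, hE₂ p]) (N * (T₁ + T₂)) ?_
  · refine hpath.trans ?_
    rw [Finset.sum_disjSum]
    simp only [Sum.elim_inl, Sum.elim_inr]
    refine add_le_add_right ?_ _
    have hN0 : (0 : ℝ) < N := by exact_mod_cast hN
    have hT0 : (0 : ℝ) < T := by exact_mod_cast hT
    have hM0 : (0 : ℝ) < M := by exact_mod_cast hM
    have hK0 : (1 : ℝ) ≤ K := by exact_mod_cast hK
    have hL0 : (1 : ℝ) ≤ L := by exact_mod_cast hL
    have h1 : ∑ m, (N * T : ℝ) * P.real (E₁ m) ≤ 2 := by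
      calc _ ≤ ∑ _m : Fin M, (N * T : ℝ) * (2 / (N * T * M)) :=
            Finset.sum_le_sum fun m _ => by gcongr; exact hP₁ m
        _ = 2 := by simp; field_simp
    -- The union over all `M` messages is affordable: if a slot remains after the first phase then
    -- `M ≤ N T`, and the sum is at most `2 / (L ^ 2 K)`.
    have h2 : ∑ p ∈ I ×ˢ (Finset.univ : Finset (Fin K × Fin M)), (N : ℝ) * P.real (E₂ p) ≤ 2 := by
      by_cases hTT : T₁ < T
      · have hMNT : (M : ℝ) ≤ N * T := by
          exact_mod_cast le_mul_of_phase_one_lt hK hN hT hτ hτN' hδ hδ1 hTT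
        have hcard : (I.card : ℝ) ≤ T := by
          exact_mod_cast (Finset.card_filter_le _ _).trans (Finset.card_range T).le
        calc _ ≤ ∑ _p ∈ I ×ˢ (Finset.univ : Finset (Fin K × Fin M)),
              (N : ℝ) * (2 / ((L * N * K * T : ℕ) : ℝ) ^ 2) := by
              refine Finset.sum_le_sum fun p hp => ?_
              gcongr
              exact hP₂ p (Finset.mem_filter.mp (Finset.mem_product.mp hp).1).2
          _ = (I.card * (K * M)) * (N * (2 / (L * N * K * T : ℝ) ^ 2)) := by
              rw [Finset.sum_const, nsmul_eq_mul, Finset.card_product, Finset.card_univ,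
                Fintype.card_prod, Fintype.card_fin, Fintype.card_fin]
              push_cast
              ring
          _ ≤ (T * (K * (N * T))) * (N * (2 / (L * N * K * T : ℝ) ^ 2)) := by gcongr
          _ = 2 / (L ^ 2 * K) := by field_simp
          _ ≤ 2 / 1 := by
              gcongr
              nlinarith
          _ = 2 := by norm_num
      · have : I = ∅ := by
          rw [hI, Finset.filter_eq_empty_iff]
          intro t ht
          have := Finset.mem_range.mp ht
          omega
        rw [this]
        simp
    linarith
  · have hg : ∀ᵐ ω ∂P, ∀ t s, (Finset.univ.filter fun n => G t ω n = s).card * τ = N :=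
      ae_all_iff.mpr hB.ae_group_card
    filter_upwards [hg] with ω hω
    rw [Finset.sum_disjSum, Finset.sum_product]
    simp only [Sum.elim_inl, Sum.elim_inr]
    have hN0 : (0 : ℝ) ≤ N := Nat.cast_nonneg _
    have hind : ∀ E : Set Ω, 0 ≤ E.indicator (1 : Ω → ℝ) ω := fun E =>
      Set.indicator_nonneg (fun _ _ => zero_le_one) _
    set b₁ : ℝ := ∑ m, (E₁ m).indicator (1 : Ω → ℝ) ω with hb₁
    have hb₁0 : 0 ≤ b₁ := Finset.sum_nonneg fun m _ => hind _
    -- The bound is stated with the phase length for `L` clusters. If the true number of clusters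
    -- differs, some event `E₁ m` occurs and the term `N * b₁` covers the slot.
    have hslot : ∀ t ∈ Finset.range T, ∑ n, gap π X G R D t n ω ≤
        (if t < T₁ + T₂ then (N : ℝ) else 0) + N * b₁ + (if T₁ + T₂ ≤ t then
          ∑ q : Fin K × Fin M, (N : ℝ) * (E₂ (t, q)).indicator (1 : Ω → ℝ) ω else 0) := by
      intro t _
      have hle := sum_gap_le (π := π) (X := X) (G := G) (R := R) hD t ω
      have hNb : 0 ≤ N * b₁ := by positivity
      rcases Nat.lt_or_ge t (T₁ + T₂) with ht | ht
      · rw [if_pos ht, if_neg (by omega)]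
        linarith
      rw [if_neg (by omega), if_pos ht, zero_add]
      have hs2 : ∀ q : Fin K × Fin M, 0 ≤ (N : ℝ) * (E₂ (t, q)).indicator (1 : Ω → ℝ) ω :=
        fun q => mul_nonneg hN0 (hind _)
      by_cases hbad : ∃ m, ω ∈ E₁ m
      · obtain ⟨m, hm⟩ := hbad
        have h1 : 1 ≤ b₁ := by
          have := Finset.single_le_sum (f := fun m => (E₁ m).indicator (1 : Ω → ℝ) ω)
            (fun m _ => hind _) (Finset.mem_univ m)
          simpa [hm] using this
        have h2 : (N : ℝ) * 1 ≤ N * b₁ := by gcongr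
        have h3 := Finset.sum_nonneg fun q (_ : q ∈ (Finset.univ : Finset (Fin K × Fin M))) => hs2 q
        linarith
      · push Not at hbad
        have hgood : ∀ m, |avg (history π X G R T₁ ω) k₀ m - meanPayoff D k₀ m| < δ / 4 :=
          fun m => not_le.mp (hbad m)
        by_cases hbad2 : ∃ q, ω ∈ E₂ (t, q)
        · obtain ⟨q, hq⟩ := hbad2
          have := Finset.single_le_sum
            (f := fun q => (N : ℝ) * (E₂ (t, q)).indicator (1 : Ω → ℝ) ω)
            (fun q _ => hs2 q) (Finset.mem_univ q)
          simp only [Set.indicator_of_mem hq, Pi.one_apply, mul_one] at this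
          linarith
        · push Not at hbad2
          have hcard : (bReps X G R δ T c k₀ ω).card = L := by
            rw [bReps, cluster_eq_typeClasses (typ := typ)
              (fun a b _ => hD.dist_lt_iff hδ (hgood a) (hgood b)) hD.typ_surjective]
            exact (reps_typeClasses hD.typ_surjective).1
          have h4 := sum_gap_broadcast_nonpos (T := T) (c := c) (k₀ := k₀) hD hδ hN (hω t) hgood
            (fun k m hm => by
              by_contra h
              exact hbad2 (k, m) ⟨⟨hcard, hm⟩, not_lt.mp h⟩) ht
          have h3 := Finset.sum_nonneg fun q (_ : q ∈ (Finset.univ : Finset (Fin K × Fin M))) =>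
            hs2 q
          linarith [h4.2]
    refine (Finset.sum_le_sum hslot).trans ?_
    rw [Finset.sum_add_distrib, Finset.sum_add_distrib, ← Finset.sum_filter, ← Finset.sum_filter,
      Finset.sum_const, Finset.sum_const, nsmul_eq_mul, nsmul_eq_mul, Finset.card_range, hI,
      ← add_assoc, ← Finset.mul_sum]
    have hcard : (((Finset.range T).filter fun t => t < T₁ + T₂).card : ℝ) ≤ T₁ + T₂ := by
      have : ((Finset.range T).filter fun t => t < T₁ + T₂).card ≤ T₁ + T₂ := by
        refine (Finset.card_le_card fun t ht => ?_).trans (Finset.card_range (T₁ + T₂)).le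
        exact Finset.mem_range.mpr (Finset.mem_filter.mp ht).2
      exact_mod_cast this
    have h5 := mul_le_mul_of_nonneg_right hcard hN0
    have h6 : (T : ℝ) * (N * b₁) = N * T * b₁ := by ring
    linarith

end

/-! ### Explicit constants for the broadcasting algorithm -/

section

variable {N K M τ L : ℕ} [NeZero M] {Ω : Type*} [mΩ : MeasurableSpace Ω] {P : Measure Ω}
  {X : ℕ → Ω → Fin N → Fin K}
  {G : ℕ → Ω → Fin N → Fin τ} {R : ℕ → Ω → Fin N → Fin K → Fin M → ℝ}
  {D : Fin K → Fin M → Measure ℝ} {δ : ℝ} {typ : Fin M → Fin L}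
  {T : ℕ} {c : Choices M} {k₀ : Fin K}

lemma SampleRate.mono {a β β' : ℝ} (h : SampleRate P X G a β) (hβ : β' ≤ β) :
    SampleRate P X G a β' := fun t k B => (h t k B).trans <| by gcongr

/-- With a single message there is nothing to lose. This case is separate since the lower bounds on
the logarithms that absorb additive terms require `M ≥ 2`. -/
lemma regret_nonpos_of_subsingleton [Subsingleton (Fin M)] {π : Policy N K M τ}
    (hB : IsBroadcastModel P D X G R) (hD : IsLatentPayoff δ D typ)
    (hπ : UsesStatistics π X G R) : regret P π (meanPayoff D) X G R T ≤ 0 := by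
  have h := regret_le_of_ae hB hD hπ T (∅ : Finset Unit) (fun _ => 0) (fun _ => ∅)
    (fun _ => MeasurableSet.empty) 0 (Filter.Eventually.of_forall fun ω => by
      refine le_of_eq ?_
      simp only [Finset.sum_empty, add_zero]
      refine Finset.sum_eq_zero fun t _ => Finset.sum_eq_zero fun n _ => ?_
      rw [gap, Subsingleton.elim (bestMsg _ _ _ _) (action π X G R t ω n), sub_self])
  simpa using h

lemma card_types_le (hD : IsLatentPayoff δ D typ) : L ≤ M := by
  simpa using Fintype.card_le_of_surjective typ hD.typ_surjective

/-- The bound for the broadcasting algorithm with the lengths of the phases inserted. -/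
lemma regret_broadcast_le' (hB : IsBroadcastModel P D X G R) (hD : IsLatentPayoff δ D typ)
    (hδ : 0 < δ) (hN : 1 ≤ N) (hT : 1 ≤ T) (hτN : τ ∣ N)
    (hβ₁ : SampleRate P X G (2 * (δ / 4) ^ 2) (δ ^ 2 / (16 * K)))
    (hβ₂ : SampleRate P X G (2 * (δ * τ / (2 * N)) ^ 2) (δ ^ 2 * τ / (4 * N * K))) :
    regret P (broadcastPolicy N K M τ T δ c k₀) (meanPayoff D) X G R T ≤
      32 * (N * K * M / (τ * δ ^ 2) * Real.log (N * T * M))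
        + 16 * (L * N ^ 2 * K / (τ ^ 2 * δ ^ 2) * Real.log (L * N * K * T)) + 6 * N := by
  have h := regret_broadcast_le (c := c) (k₀ := k₀) hB hD hδ hN hT hτN hβ₁ hβ₂
  have hN' : (1 : ℝ) ≤ N := by exact_mod_cast hN
  have hl1 : 0 ≤ Real.log (N * T * M) := by
    have := Real.log_natCast_nonneg (N * T * M)
    push_cast at this
    exact this
  have hl2 : 0 ≤ Real.log (L * N * K * T) := by
    have := Real.log_natCast_nonneg (L * N * K * T)
    push_cast at this
    exact this
  have h1 : (phase₁ N K M τ T δ : ℝ) ≤ 32 * K * M / (τ * δ ^ 2) * Real.log (N * T * M) + 1 :=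
    (Nat.ceil_lt_add_one (by positivity)).le
  have h2 : (phase₂ N K L τ T δ : ℝ) ≤
      16 * N * K * L / (τ ^ 2 * δ ^ 2) * Real.log (L * N * K * T) + 1 :=
    (Nat.ceil_lt_add_one (by positivity)).le
  calc _ ≤ _ := h
    _ ≤ N * ((32 * K * M / (τ * δ ^ 2) * Real.log (N * T * M) + 1) +
        (16 * N * K * L / (τ ^ 2 * δ ^ 2) * Real.log (L * N * K * T) + 1)) + 4 * N := by
        gcongr
        linarith
    _ = _ := by ring

theorem broadcast_single_regret (hδ : 0 < δ) {G : ℕ → Ω → Fin N → Fin 1} (hN : 1 ≤ N) (hT : 1 ≤ T)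
    (hD : IsLatentPayoff δ D typ) (hB : IsBroadcastModel P D X G R) (hX : UniformRates P X) :
    regret P (broadcastPolicy N K M 1 T δ c k₀) (meanPayoff D) X G R T ≤
      (48 / δ ^ 2 + 12) *
        (((N * K * M + L * N ^ 2 * K : ℕ) : ℝ) * Real.log (N * M * K * T)) := by
  have hN' : (1 : ℝ) ≤ N := by exact_mod_cast hN
  have hT' : (1 : ℝ) ≤ T := by exact_mod_cast hT
  have hK : 1 ≤ K := Fin.pos k₀
  have hK' : (1 : ℝ) ≤ K := by exact_mod_cast hK
  have hL : 1 ≤ L := Fin.pos (typ 0)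
  have hL' : (1 : ℝ) ≤ L := by exact_mod_cast hL
  have hM : 1 ≤ M := NeZero.one_le
  have hM' : (1 : ℝ) ≤ M := by exact_mod_cast hM
  have hLM : (L : ℝ) ≤ M := by exact_mod_cast card_types_le hD
  have hδ1 : δ ≤ 1 := hD.le_one hδ k₀ 0
  have hδ2 : δ ^ 2 ≤ 1 := by nlinarith
  have hl := log_natCast_eq_zero_or (N * M * K * T)
  have hl0 := Real.log_natCast_nonneg (N * M * K * T)
  push_cast at hl hl0
  rcases Nat.lt_or_ge 1 M with hM1 | hM1
  swap
  · have : Subsingleton (Fin M) := Fin.subsingleton_iff_le_one.mpr hM1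
    exact (regret_nonpos_of_subsingleton hB hD
      (usesStatistics_broadcastPolicy X G R T δ c k₀)).trans (by positivity)
  have hpos : 0 < Real.log (N * M * K * T) := by
    refine Real.log_pos ?_
    have : (1 : ℝ) < M := by exact_mod_cast hM1
    calc (1 : ℝ) < M := this
      _ = 1 * M * 1 * 1 := by ring
      _ ≤ N * M * K * T := by gcongr
  have hl' : 1 / 2 ≤ Real.log (N * M * K * T) := hl.resolve_left hpos.ne'
  have hβ₁ : SampleRate P X G (2 * (δ / 4) ^ 2) (δ ^ 2 / (16 * K)) := by
    have := sampleRate_of_uniformRates (c := 2 * (δ / 4) ^ 2) (u := δ ^ 2 / 8) hB hX hN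
      (by positivity) (by linarith) (by nlinarith)
    convert this using 1
    ring
  have hβ₂ : SampleRate P X G (2 * (δ * (1 : ℕ) / (2 * N)) ^ 2)
      (δ ^ 2 * (1 : ℕ) / (4 * N * K)) := by
    -- For one group of `N` users the product `c N` equals `δ ^ 2 / (2 N)`, which is the largest
    -- admissible `u`.
    have := sampleRate_of_uniformRates (c := 2 * (δ * (1 : ℕ) / (2 * N)) ^ 2)
      (u := δ ^ 2 / (2 * N)) hB hX hN (by positivity)
      (by rw [div_le_one (by positivity)]; linarith)
      (le_of_eq (by field_simp; simp))
    convert this using 1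
    field_simp
    simp
    ring
  refine (regret_broadcast_le' hB hD hδ hN hT (one_dvd N) hβ₁ hβ₂).trans ?_
  have hlog1 : Real.log (N * T * M) ≤ Real.log (N * M * K * T) := by
    refine Real.log_le_log (by positivity) ?_
    calc (N * T * M : ℝ) = N * M * 1 * T := by ring
      _ ≤ _ := by gcongr
  have hlog2 : Real.log (L * N * K * T) ≤ Real.log (N * M * K * T) := by
    refine Real.log_le_log (by positivity) ?_
    calc (L * N * K * T : ℝ) ≤ M * N * K * T := by gcongr
      _ = _ := by ring
  have e1 : N * K * M / ((1 : ℕ) * δ ^ 2) * Real.log (N * T * M) ≤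
      (N * K * M / δ ^ 2) * Real.log (N * M * K * T) := by
    rw [Nat.cast_one, one_mul]
    gcongr
  have e2 : L * N ^ 2 * K / ((1 : ℕ) ^ 2 * δ ^ 2) * Real.log (L * N * K * T) ≤
      (L * N ^ 2 * K / δ ^ 2) * Real.log (N * M * K * T) := by
    rw [Nat.cast_one, one_pow, one_mul]
    gcongr
  -- The term `6 N` from the two ceilings and the failure events is absorbed using that the
  -- logarithm is at least `1 / 2`; this yields the summand `12` of the constant.
  have e3 : (N : ℝ) ≤ 2 * (N * K * M * Real.log (N * M * K * T)) := by
    calc (N : ℝ) = 2 * (N * 1 * 1 * (1 / 2)) := by ring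
      _ ≤ _ := by gcongr
  have e4 : 0 ≤ (L * N ^ 2 * K : ℝ) * Real.log (N * M * K * T) := by positivity
  have e5 : 0 ≤ (N * K * M / δ ^ 2) * Real.log (N * M * K * T) := by positivity
  have e6 : 0 ≤ (L * N ^ 2 * K / δ ^ 2) * Real.log (N * M * K * T) := by positivity
  push_cast
  have e7 : (48 / δ ^ 2 + 12) * ((N * K * M + L * N ^ 2 * K) * Real.log (N * M * K * T)) =
      48 * ((N * K * M / δ ^ 2) * Real.log (N * M * K * T)) +
      48 * ((L * N ^ 2 * K / δ ^ 2) * Real.log (N * M * K * T)) +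
      12 * (N * K * M * Real.log (N * M * K * T)) +
      12 * ((L * N ^ 2 * K : ℝ) * Real.log (N * M * K * T)) := by ring
  rw [e7]
  push_cast at e1 e2
  linarith

theorem broadcast_regret (hδ : 0 < δ) (hN : 1 ≤ N) (hT : 1 ≤ T) (hτN : τ ∣ N)
    (hτ : (τ : ℝ) ≤ K * M / δ ^ 2 * Real.log (N * T * M))
    (hD : IsLatentPayoff δ D typ) (hB : IsBroadcastModel P D X G R) (hX : UniformUsers P X) :
    regret P (broadcastPolicy N K M τ T δ c k₀) (meanPayoff D) X G R T ≤
      38 * (N * K * M / (τ * δ ^ 2) * Real.log (N * T * M)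
        + L * N ^ 2 * K / (τ ^ 2 * δ ^ 2) * Real.log (L * N * K * T)) := by
  have hτ1 : 1 ≤ τ := Nat.pos_of_dvd_of_pos hτN hN
  have hτN' : (τ : ℝ) ≤ N := by exact_mod_cast Nat.le_of_dvd hN hτN
  have hN' : (1 : ℝ) ≤ N := by exact_mod_cast hN
  have hτ0 : (0 : ℝ) < τ := by exact_mod_cast hτ1
  have hK : 1 ≤ K := Fin.pos k₀
  have hK' : (1 : ℝ) ≤ K := by exact_mod_cast hK
  have hδ1 : δ ≤ 1 := hD.le_one hδ k₀ 0
  have hδ2 : δ ^ 2 ≤ 1 := by nlinarith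
  have hratio : (1 : ℝ) ≤ N / τ := by rwa [le_div_iff₀ hτ0, one_mul]
  have hβ₁ : SampleRate P X G (2 * (δ / 4) ^ 2) (δ ^ 2 / (16 * K)) := by
    refine (sampleRate_of_uniformUsers (c := 2 * (δ / 4) ^ 2) (u := δ ^ 2 / 8) hB hX hτ1
      (by positivity) (by linarith) (by nlinarith)).mono ?_
    calc δ ^ 2 / (16 * K) = δ ^ 2 / 8 / (2 * K) * 1 := by ring
      _ ≤ _ := by gcongr
  have hβ₂ : SampleRate P X G (2 * (δ * τ / (2 * N)) ^ 2) (δ ^ 2 * τ / (4 * N * K)) := by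
    refine (sampleRate_of_uniformUsers (c := 2 * (δ * τ / (2 * N)) ^ 2)
      (u := 2 * (δ * τ / (2 * N)) ^ 2) hB hX hτ1 (by positivity) ?_ le_rfl).mono
      (le_of_eq (by field_simp; norm_num))
    have h1 : δ * τ / (2 * N) ≤ 1 / 2 := by
      rw [div_le_div_iff₀ (by positivity) (by norm_num)]
      nlinarith
    have h2 : 0 ≤ δ * τ / (2 * N) := by positivity
    nlinarith
  refine (regret_broadcast_le' hB hD hδ hN hT hτN hβ₁ hβ₂).trans ?_
  have hl2 : 0 ≤ Real.log (L * N * K * T) := by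
    have := Real.log_natCast_nonneg (L * N * K * T)
    push_cast at this
    exact this
  -- This is where the upper bound on `τ` enters: it lets the first exploration term absorb `6 N`,
  -- whence `38 = 32 + 6`.
  have e1 : (N : ℝ) ≤ N * K * M / (τ * δ ^ 2) * Real.log (N * T * M) := by
    calc (N : ℝ) = N / τ * τ := by field_simp
      _ ≤ N / τ * (K * M / δ ^ 2 * Real.log (N * T * M)) := by gcongr
      _ = _ := by field_simp
  have e2 : 0 ≤ L * N ^ 2 * K / (τ ^ 2 * δ ^ 2) * Real.log (L * N * K * T) := by positivity
  linarith

end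

/-! ### Allocations of the pairs of messages -/

lemma card_residue_le (M b i : ℕ) (hb : 0 < b) :
    (Finset.univ.filter fun m : Fin M => (m : ℕ) % b = i % b).card ≤ M / b + 1 := by
  have h := Nat.count_modEq_card M hb i
  rw [Nat.count_eq_card_filter_range, Finset.card_filter] at h
  rw [Finset.card_filter, Fin.sum_univ_eq_sum_range (fun m => if m % b = i % b then 1 else 0)]
  calc _ = _ := h
    _ ≤ _ := by split_ifs <;> omega

/-- An allocation with small sets: the messages are divided into about `√K` blocks, and every pair
of blocks gets a context of its own. -/
lemma exists_coversPairs {K : ℕ} (M : ℕ) (hK : 1 ≤ K) :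
    ∃ (s : ℕ) (S : Fin K → Finset (Fin M)), (∀ k, (S k).card = s) ∧ CoversPairs S ∧
      (s : ℝ) ≤ 4 * (M / Real.sqrt K) + 2 := by
  set b := Nat.sqrt K with hb
  have hb1 : 0 < b := Nat.sqrt_pos.mpr hK
  have hbK : b * b ≤ K := Nat.sqrt_le K
  have hKb : K < (b + 1) * (b + 1) := Nat.lt_succ_sqrt K
  -- Blocks are residue classes modulo `b`, and the context number `i * b + j` encodes the pair of
  -- blocks `i` and `j`. Contexts beyond `b * b` are superfluous but harmless.
  let U (k : Fin K) : Finset (Fin M) :=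
    (Finset.univ.filter fun m : Fin M => (m : ℕ) % b = (k / b : ℕ) % b) ∪
      Finset.univ.filter fun m : Fin M => (m : ℕ) % b = (k : ℕ) % b
  have hU : ∀ k, (U k).card ≤ min (2 * (M / b + 1)) M := by
    intro k
    refine le_min ?_ ?_
    · have h1 := card_residue_le M b (k / b) hb1
      have h2 := card_residue_le M b k hb1
      exact (Finset.card_union_le _ _).trans (by omega)
    · simpa using Finset.card_le_univ (U k)
  -- An allocation demands sets of equal size, so the unions of two blocks are padded.
  have hex : ∀ k, ∃ S, U k ⊆ S ∧ S.card = min (2 * (M / b + 1)) M := fun k =>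
    Finset.exists_superset_card_eq (hU k) (by simp)
  choose S hUS hS using hex
  refine ⟨_, S, hS, ?_, ?_⟩
  · intro x y _
    have hx : (x : ℕ) % b < b := Nat.mod_lt _ hb1
    have hy : (y : ℕ) % b < b := Nat.mod_lt _ hb1
    have hlt : (x : ℕ) % b * b + (y : ℕ) % b < K := by
      calc (x : ℕ) % b * b + (y : ℕ) % b < (x : ℕ) % b * b + b := by omega
        _ = ((x : ℕ) % b + 1) * b := by ring
        _ ≤ b * b := Nat.mul_le_mul_right _ hx
        _ ≤ K := hbK
    have e1 : ((x : ℕ) % b * b + (y : ℕ) % b) / b = (x : ℕ) % b := by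
      rw [mul_comm, Nat.mul_add_div hb1, Nat.div_eq_of_lt hy, add_zero]
    have e2 : ((x : ℕ) % b * b + (y : ℕ) % b) % b = (y : ℕ) % b := by
      rw [mul_comm, Nat.mul_add_mod, Nat.mod_mod]
    refine ⟨⟨_, hlt⟩, hUS _ ?_, hUS _ ?_⟩
    · simp [U, e1]
    · simp [U, e2]
  · have hK' : (0 : ℝ) < K := by exact_mod_cast hK
    have hb' : (0 : ℝ) < b := by exact_mod_cast hb1
    have hsq : Real.sqrt K ≤ 2 * b := by
      rw [Real.sqrt_le_left (by positivity)]
      have h1 : (K : ℝ) ≤ (b + 1) * (b + 1) := by exact_mod_cast hKb.le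
      have h2 : (1 : ℝ) ≤ b := by exact_mod_cast hb1
      nlinarith
    have h1 : ((M / b : ℕ) : ℝ) ≤ M / b := Nat.cast_div_le
    have h2 : (M : ℝ) / b ≤ 2 * (M / Real.sqrt K) := by
      rw [← mul_div_assoc, div_le_div_iff₀ hb' (Real.sqrt_pos.mpr hK')]
      have : (0 : ℝ) ≤ M := Nat.cast_nonneg _
      nlinarith
    have h3 : ((min (2 * (M / b + 1)) M : ℕ) : ℝ) ≤ ((2 * (M / b + 1) : ℕ) : ℝ) := by
      exact_mod_cast min_le_left _ _
    push_cast at h3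
    push_cast
    linarith

lemma IsAllocation.card_le {K M : ℕ} {S : Fin K → Finset (Fin M)} {pc : Sym2 (Fin M) → Fin K}
    (h : IsAllocation S pc) (hK : 1 ≤ K) :
    ∃ s : ℕ, (∀ k, (S k).card = s) ∧ (s : ℝ) ≤ 4 * (M / Real.sqrt K) + 2 := by
  obtain ⟨s, hs, hmin⟩ := h.minimal
  obtain ⟨s', S', hS', hcov, hle⟩ := exists_coversPairs M hK
  exact ⟨s, hs, (Nat.cast_le.mpr (hmin s' S' hS' hcov)).trans hle⟩

section

variable {N K M τ L : ℕ} {Ω : Type*} [mΩ : MeasurableSpace Ω] {P : Measure Ω}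
  {π : Policy N K M τ} {X : ℕ → Ω → Fin N → Fin K}
  {G : ℕ → Ω → Fin N → Fin τ} {R : ℕ → Ω → Fin N → Fin K → Fin M → ℝ}
  {D : Fin K → Fin M → Measure ℝ} {δ : ℝ} {typ : Fin M → Fin L}

/-! ### Transmissions of messages with few samples -/

open Classical in
variable (π X G R) in
/-- The number of users with context `k` that receive message `m` in slot `t`, provided that there
are fewer than `q` earlier samples. -/
noncomputable def lowPlays (q : ℝ) (k : Fin K) (m : Fin M) (t : ℕ) (ω : Ω) : ℕ :=
  (Finset.univ.filter fun n => (X t ω n = k ∧ action π X G R t ω n = m) ∧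
    (count (history π X G R t ω) k m : ℝ) < q).card

/-- Counts are updated only after a slot, so the required number can be exceeded by the at most `N`
users of the last slot in which it had not been reached. -/
lemma sum_lowPlays_le {q : ℝ} (hq : 0 ≤ q) (k : Fin K) (m : Fin M) (T : ℕ) (ω : Ω) :
    ∑ t ∈ Finset.range T, (lowPlays π X G R q k m t ω : ℝ) ≤ q + N := by
  -- The comparison with the count makes the induction work: when another low play is possible, the
  -- earlier ones number fewer than `q`.
  have key : ∑ t ∈ Finset.range T, (lowPlays π X G R q k m t ω : ℝ) ≤ q + N ∧
      ∑ t ∈ Finset.range T, (lowPlays π X G R q k m t ω : ℝ) ≤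
        count (history π X G R T ω) k m := by
    induction T with
    | zero => simpa [count_zero] using by positivity
    | succ T ih =>
      rw [Finset.sum_range_succ, count_succ]
      push_cast
      by_cases h : (count (history π X G R T ω) k m : ℝ) < q
      · have e : lowPlays π X G R q k m T ω =
            (Finset.univ.filter fun n => X T ω n = k ∧ action π X G R T ω n = m).card := by
          rw [lowPlays]
          congr 1
          ext n
          simp [h]
        have hle : ((Finset.univ.filter fun n =>
            X T ω n = k ∧ action π X G R T ω n = m).card : ℝ) ≤ N := by
          have := Finset.card_le_univ (Finset.univ.filter fun n =>
            X T ω n = k ∧ action π X G R T ω n = m)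
          rw [Fintype.card_fin] at this
          exact Nat.cast_le.mpr this
        rw [e]
        constructor <;> linarith [ih.1, ih.2]
      · have e : lowPlays π X G R q k m T ω = 0 := by
          rw [lowPlays, Finset.card_eq_zero, Finset.filter_eq_empty_iff]
          intro n _ hn
          exact h hn.2
        rw [e]
        have : (0 : ℝ) ≤ ((Finset.univ.filter fun n =>
            X T ω n = k ∧ action π X G R T ω n = m).card : ℝ) := Nat.cast_nonneg _
        constructor
        · simpa using ih.1
        · push_cast
          linarith [ih.2]
  exact key.1

/-! ### The number of arrivals of a context -/

lemma lintegral_exp_arrivals_le [NeZero M] (hB : IsBroadcastModel P D X G R)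
    (hX : UniformUsers P X)
    (k : Fin K) (s J : ℕ) :
    ∫⁻ ω, ∏ u ∈ Finset.range J, ENNReal.ofReal
        (Real.exp (-(Finset.univ.filter fun n => X (s + u) ω n = k).card)) ∂P ≤
      ENNReal.ofReal (Real.exp (-(N / (2 * K) * J))) := by
  have hprob := hB.prob
  induction J with
  | zero => simp
  | succ J ih =>
    have hV : Measurable[past X G R (s + J)] fun ω => ∏ u ∈ Finset.range J, ENNReal.ofReal
        (Real.exp (-(Finset.univ.filter fun n => X (s + u) ω n = k).card)) := by
      let _ : MeasurableSpace Ω := past X G R (s + J)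
      refine Finset.measurable_prod _ fun u hu => ?_
      have h1 : Measurable (X (s + u)) :=
        (measurable_slot_past (X := X) (G := G) (R := R)
          (Nat.add_lt_add_left (Finset.mem_range.mp hu) s)).fst
      have h2 : Measurable fun x : Fin N → Fin K => ENNReal.ofReal
        (Real.exp (-((Finset.univ.filter fun n => x n = k).card : ℝ))) := Measurable.of_discrete
      exact h2.comp h1
    -- Arrivals do not depend on the policy, so a constant dummy rule is inserted.
    have h := hB.lintegral_mul_le (t := s + J) (α := fun _ _ _ _ => 0) measurable_const hV
      (w := fun _ x _ => ENNReal.ofReal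
        (Real.exp (-((Finset.univ.filter fun n => x n = k).card : ℝ))))
      (b := ENNReal.ofReal (Real.exp (-(N / (2 * K))))) fun ω _ => by
        have := lintegral_exp_users_le hB hX (s + J) k Finset.univ (c := 1) (u := 1)
          zero_le_one le_rfl le_rfl
        simp only [neg_mul, one_mul, Finset.card_univ, Fintype.card_fin] at this
        refine this.trans (le_of_eq ?_)
        congr 3
        ring
    simp only [Finset.prod_range_succ]
    refine h.trans ((mul_le_mul_right ih _).trans (le_of_eq ?_))
    rw [← ENNReal.ofReal_mul (Real.exp_pos _).le, ← Real.exp_add]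
    congr 2
    push_cast
    ring

/-- A Chernoff bound with exponential parameter one for the arrivals over `J` independent slots. -/
lemma measure_arrivals_le [NeZero M] (hB : IsBroadcastModel P D X G R) (hX : UniformUsers P X)
    (k : Fin K) (s J : ℕ) (a : ℝ) :
    P {ω | ∑ u ∈ Finset.range J,
        ((Finset.univ.filter fun n => X (s + u) ω n = k).card : ℝ) ≤ a} ≤
      ENNReal.ofReal (Real.exp (a - N / (2 * K) * J)) := by
  have hm : Measurable fun ω => ∏ u ∈ Finset.range J, ENNReal.ofReal
      (Real.exp (-((Finset.univ.filter fun n => X (s + u) ω n = k).card : ℝ))) := by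
    refine Finset.measurable_prod _ fun u hu => ?_
    have h2 : Measurable fun x : Fin N → Fin K => ENNReal.ofReal
      (Real.exp (-((Finset.univ.filter fun n => x n = k).card : ℝ))) := Measurable.of_discrete
    exact h2.comp (hB.measurable_ctx (s + u))
  have h1 := meas_ge_le_lintegral_div (μ := P) hm.aemeasurable (ε := ENNReal.ofReal (Real.exp (-a)))
    (by simp [Real.exp_pos]) ENNReal.ofReal_ne_top
  refine le_trans (measure_mono fun ω hω => ?_) (h1.trans ?_)
  · simp only [Set.mem_ofPred_eq] at hω ⊢
    rw [← ENNReal.ofReal_prod_of_nonneg fun u _ => (Real.exp_pos _).le, ← Real.exp_sum,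
      Finset.sum_neg_distrib]
    exact ENNReal.ofReal_le_ofReal (Real.exp_le_exp.mpr (neg_le_neg hω))
  · refine (ENNReal.div_le_div_right (lintegral_exp_arrivals_le hB hX k s J) _).trans
      (le_of_eq ?_)
    rw [← ENNReal.ofReal_div_of_pos (Real.exp_pos _), ← Real.exp_sub]
    congr 2
    ring

/-! ### The algorithm without broadcasting -/

variable {c : Choices M} {S : Fin K → Finset (Fin M)} {pc : Sym2 (Fin M) → Fin K}

variable (δ) in
/-- The number of samples that is required in slot number `t`. -/
noncomputable def threshold (t : ℕ) : ℝ := 32 / δ ^ 2 * Real.log (t + 1)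

lemma threshold_nonneg (t : ℕ) : 0 ≤ threshold δ t := by
  have : 0 ≤ Real.log ((t : ℝ) + 1) := Real.log_nonneg (by linarith [Nat.cast_nonneg (α := ℝ) t])
  rw [threshold]
  positivity

lemma threshold_mono {s t : ℕ} (h : s ≤ t) : threshold δ s ≤ threshold δ t := by
  have h1 : (s : ℝ) ≤ t := Nat.cast_le.mpr h
  rw [threshold, threshold]
  gcongr

/-- Squaring the time doubles the logarithm. Hence from slot `√t` on, the requirement is at least
half of that in slot `t`. -/
lemma threshold_le_two_mul {s t : ℕ} (h : t < (s + 1) * (s + 1)) :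
    threshold δ t / 2 ≤ threshold δ s := by
  have h1 : (t : ℝ) + 1 ≤ (s + 1) * (s + 1) := by exact_mod_cast h
  have h2 : Real.log ((t : ℝ) + 1) ≤ 2 * Real.log ((s : ℝ) + 1) := by
    have hs : (s : ℝ) + 1 ≠ 0 := by positivity
    calc _ ≤ Real.log (((s : ℝ) + 1) * (s + 1)) := Real.log_le_log (by positivity) h1
      _ = _ := by rw [Real.log_mul hs hs]; ring
  have h3 : (0 : ℝ) ≤ 32 / δ ^ 2 := by positivity
  rw [threshold, threshold]
  nlinarith

variable (X G R δ c S pc) in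
/-- The representatives of the clusters in slot `t`. -/
noncomputable def lReps (t : ℕ) (ω : Ω) : Finset (Fin M) :=
  reps c (cluster c (δ / 2) fun a b =>
    |avg (history (latentPolicy N K M τ δ c S pc) X G R t ω) (pc s(a, b)) a
      - avg (history (latentPolicy N K M τ δ c S pc) X G R t ω) (pc s(a, b)) b|)

/-- The three kinds of decisions of the algorithm without broadcasting. -/
lemma latent_cases (t : ℕ) (ω : Ω) (n : Fin N) :
    let π := latentPolicy N K M τ δ c S pc
    let h := history π X G R t ω
    let a := action π X G R t ω n
    let k := X t ω n
    (a ∈ S k ∧ (count h k a : ℝ) < threshold δ t) ∨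
    ((∀ m ∈ S k, threshold δ t ≤ count h k m) ∧ a ∈ lReps X G R δ c S pc t ω ∧
      (count h k a : ℝ) < threshold δ t) ∨
    ((∀ m ∈ S k, threshold δ t ≤ count h k m) ∧
      (∀ m ∈ lReps X G R δ c S pc t ω, threshold δ t ≤ count h k m) ∧
      a = argmax c (lReps X G R δ c S pc t ω) (avg h k)) := by
  classical
  intro π h a k
  set few₁ := (S k).filter fun m => (count h k m : ℝ) < threshold δ t with hf1
  set few₂ := (lReps X G R δ c S pc t ω).filter fun m => (count h k m : ℝ) < threshold δ t
    with hf2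
  have ha : a = if few₁.Nonempty then c.msg few₁ else if few₂.Nonempty then c.msg few₂
      else argmax c (lReps X G R δ c S pc t ω) (avg h k) := by
    have hlen : ((h.length : ℕ) : ℝ) = t := by rw [history_length]
    have h0 : a = latentPolicy N K M τ δ c S pc h (X t ω) (G t ω) n := rfl
    rw [h0, latentPolicy]
    simp only [hlen]
    rw [hf1, hf2, threshold]
    congr!
  by_cases h1 : few₁.Nonempty
  · left
    rw [if_pos h1] at ha
    have := c.msg_mem few₁ h1
    rw [← ha] at this
    exact Finset.mem_filter.mp this
  · have h1' : ∀ m ∈ S k, threshold δ t ≤ count h k m := fun m hm => by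
      by_contra hlt
      exact h1 ⟨m, Finset.mem_filter.mpr ⟨hm, not_le.mp hlt⟩⟩
    rw [if_neg h1] at ha
    by_cases h2 : few₂.Nonempty
    · right; left
      rw [if_pos h2] at ha
      have := c.msg_mem few₂ h2
      rw [← ha] at this
      exact ⟨h1', Finset.mem_filter.mp this⟩
    · right; right
      rw [if_neg h2] at ha
      refine ⟨h1', fun m hm => ?_, ha⟩
      by_contra hlt
      exact h2 ⟨m, Finset.mem_filter.mpr ⟨hm, not_le.mp hlt⟩⟩

/-- A context with too few samples has had few arrivals recently. -/
lemma arrivals_le_of_undersampled {s : ℕ} (hS : ∀ k, (S k).card = s) {t T : ℕ} (htT : t < T)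
    {ω : Ω} {k : Fin K} {m : Fin M} (hm : m ∈ S k)
    (hcount : (count (history (latentPolicy N K M τ δ c S pc) X G R t ω) k m : ℝ)
      < threshold δ t / 2) :
    ∑ u ∈ Finset.range (t - Nat.sqrt t),
      ((Finset.univ.filter fun n => X (Nat.sqrt t + u) ω n = k).card : ℝ) ≤
        s * (threshold δ T + N) := by
  set π := latentPolicy N K M τ δ c S pc
  -- Throughout the window `m` is below the current threshold, so the first branch of the algorithm
  -- is never skipped in context `k`. Every arrival there receives some undersampled message of `S
  -- k`.
  have hslot : ∀ u, Nat.sqrt t ≤ u → u < t →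
      ((Finset.univ.filter fun n => X u ω n = k).card : ℝ) ≤
        ∑ m' ∈ S k, (lowPlays π X G R (threshold δ T) k m' u ω : ℝ) := by
    intro u hu1 hu2
    have hlow : (count (history π X G R u ω) k m : ℝ) < threshold δ u := by
      have h1 : (count (history π X G R u ω) k m : ℝ) ≤ count (history π X G R t ω) k m :=
        Nat.cast_le.mpr (count_mono π X G R hu2.le ω k m)
      have h2 : threshold δ t / 2 ≤ threshold δ u :=
        threshold_le_two_mul ((Nat.lt_succ_sqrt t).trans_le
          (Nat.mul_le_mul (Nat.succ_le_succ hu1) (Nat.succ_le_succ hu1)))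
      linarith
    have hsub : (Finset.univ.filter fun n => X u ω n = k).card ≤
        ∑ m' ∈ S k, lowPlays π X G R (threshold δ T) k m' u ω := by
      refine (Finset.card_le_card (t := (S k).biUnion fun m' => Finset.univ.filter fun n =>
        (X u ω n = k ∧ action π X G R u ω n = m') ∧
          (count (history π X G R u ω) k m' : ℝ) < threshold δ T) fun n hn => ?_).trans ?_
      · have hk : X u ω n = k := (Finset.mem_filter.mp hn).2
        have hcases := latent_cases (X := X) (G := G) (R := R) (c := c) (S := S) (pc := pc)
          (δ := δ) u ω n
        simp only [hk] at hcases
        rcases hcases with h | h | h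
        · exact Finset.mem_biUnion.mpr ⟨_, h.1, Finset.mem_filter.mpr ⟨Finset.mem_univ n,
            ⟨hk, rfl⟩, h.2.trans_le (threshold_mono (by omega))⟩⟩
        · exact absurd (h.1 m hm) (not_le.mpr hlow)
        · exact absurd (h.1 m hm) (not_le.mpr hlow)
      · refine Finset.card_biUnion_le.trans (le_of_eq (Finset.sum_congr rfl fun m' _ => ?_))
        rw [lowPlays]
    exact_mod_cast hsub
  calc _ ≤ ∑ u ∈ Finset.range (t - Nat.sqrt t), ∑ m' ∈ S k,
        (lowPlays π X G R (threshold δ T) k m' (Nat.sqrt t + u) ω : ℝ) :=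
        Finset.sum_le_sum fun u hu => hslot _ (Nat.le_add_right _ _) (by
          have := Finset.mem_range.mp hu
          omega)
    _ = ∑ m' ∈ S k, ∑ u ∈ Finset.range (t - Nat.sqrt t),
        (lowPlays π X G R (threshold δ T) k m' (Nat.sqrt t + u) ω : ℝ) := Finset.sum_comm
    _ ≤ ∑ m' ∈ S k, (threshold δ T + N) := by
        refine Finset.sum_le_sum fun m' _ => ?_
        refine le_trans ?_ (sum_lowPlays_le (π := π) (X := X) (G := G) (R := R)
          (threshold_nonneg T) k m' t ω)
        have h := Finset.sum_range_add (fun u =>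
          (lowPlays π X G R (threshold δ T) k m' u ω : ℝ)) (Nat.sqrt t) (t - Nat.sqrt t)
        rw [Nat.add_sub_cancel' (Nat.sqrt_le_self t)] at h
        rw [h]
        exact le_add_of_nonneg_left (Finset.sum_nonneg fun _ _ => Nat.cast_nonneg _)
    _ = _ := by rw [Finset.sum_const, hS, nsmul_eq_mul]

end

/-! ### Failure events of the algorithm without broadcasting -/

section

variable {N K M L : ℕ} [NeZero M] {Ω : Type*} [mΩ : MeasurableSpace Ω] {P : Measure Ω}
  {X : ℕ → Ω → Fin N → Fin K}
  {G : ℕ → Ω → Fin N → Fin N} {R : ℕ → Ω → Fin N → Fin K → Fin M → ℝ}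
  {D : Fin K → Fin M → Measure ℝ} {δ : ℝ} {typ : Fin M → Fin L}
  {c : Choices M} {S : Fin K → Finset (Fin M)} {pc : Sym2 (Fin M) → Fin K}

variable (X G R D δ c S pc) in
/-- Message `m` has half the required samples in context `k`, but its average is inaccurate. -/
def Deviates (t : ℕ) (k : Fin K) (m : Fin M) : Set Ω :=
  {ω | threshold δ t / 2 ≤ count (history (latentPolicy N K M N δ c S pc) X G R t ω) k m ∧
    δ / 4 ≤ |avg (history (latentPolicy N K M N δ c S pc) X G R t ω) k m - meanPayoff D k m|}

variable (X G R δ c S pc) in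
/-- Some message of `S k` has less than half the required samples in context `k`. -/
def Undersampled (t : ℕ) (k : Fin K) : Set Ω :=
  {ω | ∃ m ∈ S k, (count (history (latentPolicy N K M N δ c S pc) X G R t ω) k m : ℝ)
    < threshold δ t / 2}

/-- Half the threshold suffices for a summable failure probability: `2 (δ / 4) ^ 2` times `16 / δ ^
2 log (t + 1)` is `2 log (t + 1)`. -/
lemma measure_deviates_le (hB : IsBroadcastModel P D X G R) (hD : IsLatentPayoff δ D typ)
    (hδ : 0 < δ) (t : ℕ) (k : Fin K) (m : Fin M) :
    P.real (Deviates X G R D δ c S pc t k m) ≤ 2 / ((t : ℝ) + 1) ^ 2 := by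
  have h := ENNReal.toReal_le_of_le_ofReal (by positivity)
    (measure_deviation_le hB hD (usesStatistics_latentPolicy (τ := N) X G R δ c S pc) t k m
      (by positivity : 0 ≤ δ / 4) (threshold δ t / 2))
  have ht : (0 : ℝ) < (t : ℝ) + 1 := by positivity
  refine h.trans (le_of_eq ?_)
  rw [show 2 * (δ / 4) ^ 2 * (threshold δ t / 2) = (2 : ℕ) * Real.log (t + 1) by
    rw [threshold]; field_simp; ring, Real.exp_neg, Real.exp_nat_mul, Real.exp_log ht]
  rfl

lemma sum_inv_sq_le (T : ℕ) :
    ∑ t ∈ Finset.range T, 2 / ((t : ℝ) + 1) ^ 2 ≤ 4 := by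
  -- Telescoping comparison with `2 / (T + 1)`; the first term is kept apart.
  have key : ∑ t ∈ Finset.range (T + 1), 2 / ((t : ℝ) + 1) ^ 2 ≤ 4 - 2 / ((T : ℝ) + 1) := by
    induction T with
    | zero => norm_num
    | succ T ih =>
      rw [Finset.sum_range_succ]
      have h1 : (0 : ℝ) < (T : ℝ) + 1 := by positivity
      have h2 : 2 / (((T + 1 : ℕ) : ℝ) + 1) ^ 2 ≤
          2 / ((T : ℝ) + 1) - 2 / (((T + 1 : ℕ) : ℝ) + 1) := by
        push_cast
        rw [div_sub_div _ _ (by positivity) (by positivity), div_le_div_iff₀ (by positivity)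
          (by positivity)]
        nlinarith
      linarith
  have h0 : ∑ t ∈ Finset.range T, 2 / ((t : ℝ) + 1) ^ 2 ≤
      ∑ t ∈ Finset.range (T + 1), 2 / ((t : ℝ) + 1) ^ 2 := by
    rw [Finset.sum_range_succ]
    exact le_add_of_nonneg_right (by positivity)
  have : (0 : ℝ) ≤ 2 / ((T : ℝ) + 1) := by positivity
  linarith

lemma threshold_ge_log (hδ : 0 < δ) (hδ1 : δ ≤ 1) {T : ℕ} (hT : 1 ≤ T) :
    Real.log T ≤ threshold δ T := by
  have hT' : (1 : ℝ) ≤ T := by exact_mod_cast hT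
  have h1 : Real.log (T : ℝ) ≤ Real.log ((T : ℝ) + 1) := Real.log_le_log (by linarith) (by linarith)
  have h2 : 0 ≤ Real.log (T : ℝ) := Real.log_nonneg hT'
  have h3 : (1 : ℝ) ≤ 32 / δ ^ 2 := by
    rw [le_div_iff₀ (by positivity)]
    nlinarith
  rw [threshold]
  nlinarith

/-- Clustering needs data from all contexts, whereas a user triggers sampling only in the own
context. After the initial period the window from `√t` to `t` would need at most `a` arrivals of
context `k`, while the exponent `N J / (2 K)` of the Chernoff bound is at least `2 a`. -/
lemma measure_undersampled_le (hB : IsBroadcastModel P D X G R)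
    (hX : UniformUsers P X) (hδ : 0 < δ) (hδ1 : δ ≤ 1) (hN : 1 ≤ N) (hK : 1 ≤ K) {s : ℕ}
    (hs : 1 ≤ s) (hS : ∀ k, (S k).card = s) {t T : ℕ} (htT : t < T)
    (ht : 16 * K * (s * (threshold δ T + N)) / N ≤ t) (k : Fin K) :
    P.real (Undersampled X G R δ c S pc t k) ≤ 1 / T := by
  set a : ℝ := s * (threshold δ T + N) with ha
  have hN' : (1 : ℝ) ≤ N := by exact_mod_cast hN
  have hK' : (1 : ℝ) ≤ K := by exact_mod_cast hK
  have hs' : (1 : ℝ) ≤ s := by exact_mod_cast hs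
  have hT : 1 ≤ T := by omega
  have hT' : (0 : ℝ) < T := by exact_mod_cast hT
  have hthr := threshold_nonneg (δ := δ) T
  have haN : threshold δ T + N ≤ a := by nlinarith
  have h1 : P.real (Undersampled X G R δ c S pc t k) ≤
      Real.exp (a - N / (2 * K) * ((t - Nat.sqrt t : ℕ) : ℝ)) := by
    refine ENNReal.toReal_le_of_le_ofReal (Real.exp_pos _).le (le_trans (measure_mono ?_)
      (measure_arrivals_le hB hX k (Nat.sqrt t) (t - Nat.sqrt t) a))
    rintro ω ⟨m, hm, hlt⟩
    exact arrivals_le_of_undersampled hS htT hm hlt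
  have ht16 : (16 : ℝ) ≤ t := by
    refine le_trans ?_ ht
    rw [le_div_iff₀ (by linarith)]
    have : (N : ℝ) ≤ a := by linarith
    nlinarith
  have hsub : (t : ℝ) / 4 ≤ ((t - Nat.sqrt t : ℕ) : ℝ) := by
    have h2 : 16 ≤ t := by exact_mod_cast ht16
    have h3 : 2 * Nat.sqrt t ≤ t := by
      have h4 : Nat.sqrt t * Nat.sqrt t ≤ t := Nat.sqrt_le t
      have h5 : 4 ≤ Nat.sqrt t := Nat.le_sqrt.mpr (by omega)
      nlinarith
    rw [Nat.cast_sub (Nat.sqrt_le_self t)]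
    have h6 : (2 : ℝ) * (Nat.sqrt t : ℝ) ≤ t := by exact_mod_cast h3
    have h7 : (0 : ℝ) ≤ t := by positivity
    linarith
  have h2a : 2 * a ≤ N / (2 * K) * ((t - Nat.sqrt t : ℕ) : ℝ) := by
    calc 2 * a = N / (2 * K) * (16 * K * a / N / 4) := by field_simp; ring
      _ ≤ N / (2 * K) * ((t : ℝ) / 4) := by gcongr
      _ ≤ _ := by gcongr
  calc _ ≤ _ := h1
    _ ≤ Real.exp (-Real.log T) := by
        refine Real.exp_le_exp.mpr ?_
        have := threshold_ge_log hδ hδ1 hT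
        linarith
    _ = 1 / T := by rw [Real.exp_neg, Real.exp_log hT', one_div]

/-- With sufficient and accurate samples the clusters are the content types. -/
lemma lReps_eq (hD : IsLatentPayoff δ D typ) (hδ : 0 < δ) (hS : IsAllocation S pc) {t : ℕ} {ω : Ω}
    (hU : ∀ k, ω ∉ Undersampled X G R δ c S pc t k)
    (hdev : ∀ k, ∀ m ∈ S k, ω ∉ Deviates X G R D δ c S pc t k m) :
    lReps X G R δ c S pc t ω = reps c (typeClasses typ) := by
  have hacc : ∀ k, ∀ m ∈ S k, |avg (history (latentPolicy N K M N δ c S pc) X G R t ω) k m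
      - meanPayoff D k m| < δ / 4 := by
    intro k m hm
    by_contra h
    refine hdev k m hm ⟨?_, not_lt.mp h⟩
    by_contra h'
    exact hU k ⟨m, hm, not_le.mp h'⟩
  rw [lReps, cluster_eq_typeClasses (typ := typ)]
  · intro a b hab
    obtain ⟨ha, hb⟩ := hS.pc_mem a b hab
    exact hD.dist_lt_iff hδ (hacc _ a ha) (hacc _ b hb)
  · exact hD.typ_surjective

open Classical in
/-- The loss of a user, bounded by the events that can cause it. -/
lemma gap_latent_le (hD : IsLatentPayoff δ D typ) (hδ : 0 < δ) (hS : IsAllocation S pc)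
    {t T : ℕ} (htT : t < T) {ω : Ω}
    (hgrp : ∀ s, (Finset.univ.filter fun n => G t ω n = s).card = 1) (n : Fin N)
    {A : Finset (Fin M)} (hA : A = reps c (typeClasses typ)) :
    gap (latentPolicy N K M N δ c S pc) X G R D t n ω ≤
      (∑ k, ∑ m, ((if m ∈ S k then 1 else 0) + (if m ∈ A then 1 else 0)) *
        (if (X t ω n = k ∧ action (latentPolicy N K M N δ c S pc) X G R t ω n = m) ∧
          (count (history (latentPolicy N K M N δ c S pc) X G R t ω) k m : ℝ) < threshold δ T
          then (1 : ℝ) else 0)) +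
      (∑ k, (Undersampled X G R δ c S pc t k).indicator (1 : Ω → ℝ) ω) +
      ∑ k, ∑ m, ((if m ∈ S k then 1 else 0) + (if m ∈ A then 1 else 0)) *
        (Deviates X G R D δ c S pc t k m).indicator (1 : Ω → ℝ) ω := by
  set π := latentPolicy N K M N δ c S pc with hπ
  set w : Fin K → Fin M → ℝ := fun k m => (if m ∈ S k then 1 else 0) + (if m ∈ A then 1 else 0)
    with hw
  have hw0 : ∀ k m, 0 ≤ w k m := fun k m => by simp only [hw]; positivity
  have hwS : ∀ k, ∀ m ∈ S k, 1 ≤ w k m := fun k m hm => by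
    simp only [hw, if_pos hm]
    exact le_add_of_nonneg_right (by positivity)
  have hwA : ∀ k, ∀ m ∈ A, 1 ≤ w k m := fun k m hm => by
    simp only [hw, if_pos hm]
    exact le_add_of_nonneg_left (by positivity)
  set low : Fin K → Fin M → ℝ := fun k m =>
    if (X t ω n = k ∧ action π X G R t ω n = m) ∧
      (count (history π X G R t ω) k m : ℝ) < threshold δ T then 1 else 0 with hlow
  have hlow0 : ∀ k m, 0 ≤ w k m * low k m := fun k m =>
    mul_nonneg (hw0 k m) (by simp only [hlow]; positivity)
  have hind : ∀ E : Set Ω, 0 ≤ E.indicator (1 : Ω → ℝ) ω := fun E =>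
    Set.indicator_nonneg (fun _ _ => zero_le_one) _
  have hdev0 : ∀ k m, 0 ≤ w k m * (Deviates X G R D δ c S pc t k m).indicator (1 : Ω → ℝ) ω :=
    fun k m => mul_nonneg (hw0 k m) (hind _)
  have s1 : 0 ≤ ∑ k, ∑ m, w k m * low k m :=
    Finset.sum_nonneg fun k _ => Finset.sum_nonneg fun m _ => hlow0 k m
  have s2 : 0 ≤ ∑ k, (Undersampled X G R δ c S pc t k).indicator (1 : Ω → ℝ) ω :=
    Finset.sum_nonneg fun k _ => hind _
  have s3 : 0 ≤ ∑ k, ∑ m, w k m * (Deviates X G R D δ c S pc t k m).indicator (1 : Ω → ℝ) ω :=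
    Finset.sum_nonneg fun k _ => Finset.sum_nonneg fun m _ => hdev0 k m
  have hgap := gap_le_one (π := π) (X := X) (G := G) (R := R) hD t n ω
  have hthr : threshold δ t ≤ threshold δ T := threshold_mono htT.le
  have hdouble : ∀ (f : Fin K → Fin M → ℝ), (∀ k m, 0 ≤ f k m) → ∀ k m, f k m ≤ ∑ k, ∑ m, f k m :=
    fun f hf k m => (Finset.single_le_sum (fun m _ => hf k m) (Finset.mem_univ m)).trans
      (Finset.single_le_sum (f := fun k => ∑ m, f k m)
        (fun k _ => Finset.sum_nonneg fun m _ => hf k m) (Finset.mem_univ k))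
  have hcase_low : ∀ a, action π X G R t ω n = a →
      (count (history π X G R t ω) (X t ω n) a : ℝ) < threshold δ t → 1 ≤ w (X t ω n) a →
      1 ≤ ∑ k, ∑ m, w k m * low k m := by
    intro a ha hc hwa
    refine le_trans ?_ (hdouble _ hlow0 (X t ω n) a)
    have : low (X t ω n) a = 1 := if_pos ⟨⟨rfl, ha⟩, hc.trans_le hthr⟩
    rw [this, mul_one]
    exact hwa
  have hcase_dev : ∀ k m, 1 ≤ w k m → ω ∈ Deviates X G R D δ c S pc t k m →
      1 ≤ ∑ k, ∑ m, w k m * (Deviates X G R D δ c S pc t k m).indicator (1 : Ω → ℝ) ω := by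
    intro k m hwk hω
    refine le_trans ?_ (hdouble _ hdev0 k m)
    simpa [hω] using hwk
  have hcases := latent_cases (X := X) (G := G) (R := R) (c := c) (S := S) (pc := pc)
    (δ := δ) t ω n
  simp only [← hπ] at hcases
  rcases hcases with h | hcases
  · have := hcase_low _ rfl h.2 (hwS _ _ h.1)
    linarith
  by_cases hU : ∃ k, ω ∈ Undersampled X G R δ c S pc t k
  · obtain ⟨k, hk⟩ := hU
    have := Finset.single_le_sum
      (f := fun k => (Undersampled X G R δ c S pc t k).indicator (1 : Ω → ℝ) ω)
      (fun k _ => hind _) (Finset.mem_univ k)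
    simp only [Set.indicator_of_mem hk, Pi.one_apply] at this
    linarith
  push Not at hU
  by_cases hdS : ∃ k, ∃ m ∈ S k, ω ∈ Deviates X G R D δ c S pc t k m
  · obtain ⟨k, m, hm, hω⟩ := hdS
    have := hcase_dev k m (hwS k m hm) hω
    linarith
  push Not at hdS
  have hreps : lReps X G R δ c S pc t ω = A := (lReps_eq hD hδ hS hU hdS).trans hA.symm
  rw [hreps] at hcases
  rcases hcases with h | h
  · have := hcase_low _ rfl h.2.2 (hwA _ _ h.2.1)
    linarith
  by_cases hdA : ∃ m ∈ A, ω ∈ Deviates X G R D δ c S pc t (X t ω n) m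
  · obtain ⟨m, hm, hω⟩ := hdA
    have := hcase_dev _ m (hwA _ m hm) hω
    linarith
  push Not at hdA
  have hacc : ∀ m ∈ A, |avg (history π X G R t ω) (X t ω n) m
      - meanPayoff D (X t ω n) m| < δ / 4 := by
    intro m hm
    by_contra hlt
    refine hdA m hm ⟨?_, not_lt.mp hlt⟩
    have := h.2.1 m hm
    have h0 := threshold_nonneg (δ := δ) t
    rw [← hπ]
    linarith
  obtain ⟨-, hAt⟩ := reps_typeClasses (c := c) hD.typ_surjective
  rw [← hA] at hAt
  have hne : A.Nonempty := by
    obtain ⟨m, hm, -⟩ := hAt (typ 0)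
    exact ⟨m, hm⟩
  have hsing : (Finset.univ.filter fun n' => G t ω n' = G t ω n) = {n} := by
    obtain ⟨b, hb⟩ := Finset.card_eq_one.mp (hgrp (G t ω n))
    have : n ∈ (Finset.univ.filter fun n' => G t ω n' = G t ω n) := by simp
    rw [hb] at this ⊢
    rw [Finset.mem_singleton.mp this]
  have hspec := argmax_spec (c := c) hne (avg (history π X G R t ω) (X t ω n))
  rw [← h.2.2] at hspec
  have hx : ∀ n' ∈ (Finset.univ.filter fun n' => G t ω n' = G t ω n), n' = n := fun n' hn' => by
    rw [hsing] at hn'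
    exact Finset.mem_singleton.mp hn'
  -- The group is the single user `n`. The contexts are replaced by the constant context of `n`,
  -- since accuracy is known only there.
  have hnonpos := sum_gap_group_nonpos (x := fun _ => X t ω n) (g := G t ω) (s := G t ω n)
    (r := avg (history π X G R t ω)) (ε := δ / 4) hD hδ hAt (fun _ m hm => hacc m hm)
    (by rw [hsing, Finset.card_singleton]; push_cast; linarith) hspec.1
    (by simpa only [hsing, Finset.sum_singleton] using hspec.2)
  rw [hsing, Finset.sum_singleton] at hnonpos
  have hbest : gap π X G R D t n ω ≤ 0 := by
    refine le_trans ?_ hnonpos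
    rw [gap]
    refine sub_le_sub_right ?_ _
    have := bestMsg_spec (meanPayoff D) (fun _ => X t ω n) (G t ω) (G t ω n)
      (bestMsg (meanPayoff D) (X t ω) (G t ω) (G t ω n))
    rw [hsing, Finset.sum_singleton, Finset.sum_singleton] at this
    exact this
  linarith

end

/-! ### Regret of the algorithm without broadcasting -/

section

variable {N K M L : ℕ} [NeZero M] {Ω : Type*} [mΩ : MeasurableSpace Ω] {P : Measure Ω}
  {X : ℕ → Ω → Fin N → Fin K}
  {G : ℕ → Ω → Fin N → Fin N} {R : ℕ → Ω → Fin N → Fin K → Fin M → ℝ}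
  {D : Fin K → Fin M → Measure ℝ} {δ : ℝ} {typ : Fin M → Fin L}
  {c : Choices M} {S : Fin K → Finset (Fin M)} {pc : Sym2 (Fin M) → Fin K}

lemma measurableSet_deviates (hB : IsBroadcastModel P D X G R) (t : ℕ) (k : Fin K) (m : Fin M) :
    MeasurableSet (Deviates X G R D δ c S pc t k m) := by
  have hπ := usesStatistics_latentPolicy (τ := N) X G R δ c S pc
  exact (measurableSet_le measurable_const
      ((measurable_count_past hπ le_rfl k m).mono (hB.past_le t) le_rfl)).inter
    (measurableSet_le measurable_const (measurable_norm.comp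
      (((measurable_avg_past hπ le_rfl k m).mono (hB.past_le t) le_rfl).sub_const _)))

lemma measurableSet_undersampled (hB : IsBroadcastModel P D X G R) (t : ℕ) (k : Fin K) :
    MeasurableSet (Undersampled X G R δ c S pc t k) := by
  have hπ := usesStatistics_latentPolicy (τ := N) X G R δ c S pc
  have : Undersampled X G R δ c S pc t k = ⋃ m ∈ S k,
      {ω | (count (history (latentPolicy N K M N δ c S pc) X G R t ω) k m : ℝ)
        < threshold δ t / 2} := by
    ext ω
    simp [Undersampled]
  rw [this]
  exact Finset.measurableSet_biUnion _ fun m _ => measurableSet_lt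
    ((measurable_count_past hπ le_rfl k m).mono (hB.past_le t) le_rfl) measurable_const

lemma sum_sum_mul_lowPlays_le (w : Fin K → Fin M → ℝ) (hw : ∀ k m, 0 ≤ w k m) {q : ℝ} (hq : 0 ≤ q)
    (π : Policy N K M N) (T : ℕ) (ω : Ω) :
    ∑ t ∈ Finset.range T, ∑ k, ∑ m, w k m * (lowPlays π X G R q k m t ω : ℝ) ≤
      (∑ k, ∑ m, w k m) * (q + N) := by
  rw [Finset.sum_comm, Finset.sum_mul]
  refine Finset.sum_le_sum fun k _ => ?_
  rw [Finset.sum_comm, Finset.sum_mul]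
  refine Finset.sum_le_sum fun m _ => ?_
  rw [← Finset.mul_sum]
  exact mul_le_mul_of_nonneg_left (sum_lowPlays_le hq k m T ω) (hw k m)

/-- The regret of the algorithm without broadcasting in terms of the size of the allocation. -/
lemma regret_latent_le (hB : IsBroadcastModel P D X G R) (hD : IsLatentPayoff δ D typ)
    (hX : UniformUsers P X) (hδ : 0 < δ) (hN : 1 ≤ N) (hK : 1 ≤ K)
    (hS : IsAllocation S pc) {s : ℕ} (hs : 1 ≤ s) (hcard : ∀ k, (S k).card = s) (T : ℕ) :
    regret P (latentPolicy N K M N δ c S pc) (meanPayoff D) X G R T ≤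
      (16 * K * (s * (threshold δ T + N)) + N) + (K * s + K * L) * (threshold δ T + N)
        + N * K + N * (K * s + K * L) * 4 := by
  classical
  have hprob := hB.prob
  have hπ := usesStatistics_latentPolicy (τ := N) X G R δ c S pc
  have hN' : (1 : ℝ) ≤ N := by exact_mod_cast hN
  have hK' : (1 : ℝ) ≤ K := by exact_mod_cast hK
  have hδ1 : δ ≤ 1 := hD.le_one hδ ⟨0, hK⟩ 0
  have hthr := threshold_nonneg (δ := δ) T
  set π := latentPolicy N K M N δ c S pc
  set A := reps c (typeClasses typ) with hA
  have hAcard : A.card = L := (reps_typeClasses hD.typ_surjective).1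
  -- The weights single out the pairs that can cause a loss: messages of `S k`, and the fixed
  -- representatives `A` of the true types. The random representatives equal `A` outside the failure
  -- events.
  set w : Fin K → Fin M → ℝ := fun k m => (if m ∈ S k then 1 else 0) + (if m ∈ A then 1 else 0)
    with hw
  have hw0 : ∀ k m, 0 ≤ w k m := fun k m => by simp only [hw]; positivity
  have hwsum : ∑ k, ∑ m, w k m = K * s + K * L := by
    simp only [hw, Finset.sum_add_distrib, Finset.sum_ite_mem, Finset.univ_inter,
      Finset.sum_const, hcard, hAcard, Finset.card_univ, Fintype.card_fin, nsmul_eq_mul, mul_one]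
  -- The length of the initial period is that required by `measure_undersampled_le`; its slots are
  -- charged with the full loss `N`.
  set a : ℝ := 16 * K * (s * (threshold δ T + N)) / N with ha
  set n₀ := ⌈a⌉₊
  have ha0 : 0 ≤ a := by positivity
  have hn₀ : (N : ℝ) * n₀ ≤ 16 * K * (s * (threshold δ T + N)) + N := by
    have h1 : (n₀ : ℝ) ≤ a + 1 := (Nat.ceil_lt_add_one ha0).le
    calc (N : ℝ) * n₀ ≤ N * (a + 1) := by gcongr
      _ = _ := by rw [ha]; field_simp
  set I := (Finset.range T).filter (fun t => n₀ ≤ t) with hI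
  have hpath := regret_le_of_ae hB hD hπ T
    (Finset.disjSum (I ×ˢ (Finset.univ : Finset (Fin K)))
      (Finset.range T ×ˢ (Finset.univ : Finset (Fin K × Fin M))))
    (Sum.elim (fun _ => (N : ℝ)) fun p => N * w p.2.1 p.2.2)
    (Sum.elim (fun p => Undersampled X G R δ c S pc p.1 p.2)
      fun p => Deviates X G R D δ c S pc p.1 p.2.1 p.2.2)
    (by
      rintro (p | p)
      exacts [measurableSet_undersampled hB _ _, measurableSet_deviates hB _ _ _])
    (N * n₀ + (∑ k, ∑ m, w k m) * (threshold δ T + N)) ?_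
  · refine hpath.trans ?_
    rw [Finset.sum_disjSum]
    simp only [Sum.elim_inl, Sum.elim_inr]
    have h1 : ∑ p ∈ I ×ˢ (Finset.univ : Finset (Fin K)),
        (N : ℝ) * P.real (Undersampled X G R δ c S pc p.1 p.2) ≤ N * K := by
      calc _ ≤ ∑ _p ∈ I ×ˢ (Finset.univ : Finset (Fin K)), (N : ℝ) * (1 / T) := by
            refine Finset.sum_le_sum fun p hp => ?_
            obtain ⟨hp1, hp2⟩ := Finset.mem_filter.mp (Finset.mem_product.mp hp).1
            gcongr
            exact measure_undersampled_le hB hX hδ hδ1 hN hK hs hcard (Finset.mem_range.mp hp1)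
              ((Nat.le_ceil a).trans (Nat.cast_le.mpr hp2)) p.2
        _ = (I.card : ℝ) * (1 / T) * (N * K) := by
            rw [Finset.sum_const, nsmul_eq_mul, Finset.card_product, Finset.card_univ,
              Fintype.card_fin]
            push_cast
            ring
        _ ≤ 1 * (N * K) := by
            gcongr
            rw [mul_one_div]
            refine div_le_one_of_le₀ ?_ (Nat.cast_nonneg _)
            exact_mod_cast (Finset.card_filter_le _ _).trans (Finset.card_range T).le
        _ = _ := one_mul _
    have h2 : ∑ p ∈ Finset.range T ×ˢ (Finset.univ : Finset (Fin K × Fin M)),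
        N * w p.2.1 p.2.2 * P.real (Deviates X G R D δ c S pc p.1 p.2.1 p.2.2) ≤
          N * (K * s + K * L) * 4 := by
      calc _ ≤ ∑ p ∈ Finset.range T ×ˢ (Finset.univ : Finset (Fin K × Fin M)),
            N * w p.2.1 p.2.2 * (2 / ((p.1 : ℝ) + 1) ^ 2) := by
            refine Finset.sum_le_sum fun p _ => ?_
            exact mul_le_mul_of_nonneg_left (measure_deviates_le hB hD hδ _ _ _)
              (mul_nonneg (by positivity) (hw0 _ _))
        _ = N * (∑ k, ∑ m, w k m) * ∑ t ∈ Finset.range T, 2 / ((t : ℝ) + 1) ^ 2 := by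
            rw [Finset.sum_product, Finset.mul_sum]
            refine Finset.sum_congr rfl fun t _ => ?_
            simp only [Fintype.sum_prod_type, Finset.mul_sum, Finset.sum_mul]
        _ ≤ N * (∑ k, ∑ m, w k m) * 4 := by
            refine mul_le_mul_of_nonneg_left (sum_inv_sq_le T) ?_
            rw [hwsum]
            positivity
        _ = _ := by rw [hwsum]
    rw [hwsum]
    linarith
  · have hg : ∀ᵐ ω ∂P, ∀ t s, (Finset.univ.filter fun n => G t ω n = s).card * N = N :=
      ae_all_iff.mpr hB.ae_group_card
    filter_upwards [hg] with ω hω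
    have hgrp : ∀ t s, (Finset.univ.filter fun n => G t ω n = s).card = 1 := fun t s =>
      Nat.eq_of_mul_eq_mul_right hN (by rw [hω, one_mul])
    rw [Finset.sum_disjSum, Finset.sum_product, Finset.sum_product]
    simp only [Sum.elim_inl, Sum.elim_inr]
    have hN0 : (0 : ℝ) ≤ N := Nat.cast_nonneg _
    have hind : ∀ E : Set Ω, 0 ≤ E.indicator (1 : Ω → ℝ) ω := fun E =>
      Set.indicator_nonneg (fun _ _ => zero_le_one) _
    have hslot : ∀ t ∈ Finset.range T, ∑ n, gap π X G R D t n ω ≤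
        (if t < n₀ then (N : ℝ) else 0) +
        (∑ k, ∑ m, w k m * (lowPlays π X G R (threshold δ T) k m t ω : ℝ)) +
        (if n₀ ≤ t then
          ∑ k, (N : ℝ) * (Undersampled X G R δ c S pc t k).indicator (1 : Ω → ℝ) ω else 0) +
        ∑ q : Fin K × Fin M, N * w q.1 q.2 *
          (Deviates X G R D δ c S pc t q.1 q.2).indicator (1 : Ω → ℝ) ω := by
      intro t ht
      have s1 : 0 ≤ ∑ k, ∑ m, w k m * (lowPlays π X G R (threshold δ T) k m t ω : ℝ) :=
        Finset.sum_nonneg fun k _ => Finset.sum_nonneg fun m _ =>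
          mul_nonneg (hw0 k m) (Nat.cast_nonneg _)
      have s3 : 0 ≤ ∑ q : Fin K × Fin M, N * w q.1 q.2 *
          (Deviates X G R D δ c S pc t q.1 q.2).indicator (1 : Ω → ℝ) ω :=
        Finset.sum_nonneg fun q _ => mul_nonneg (mul_nonneg hN0 (hw0 _ _)) (hind _)
      rcases Nat.lt_or_ge t n₀ with h | h
      · rw [if_pos h, if_neg (by omega)]
        have hle := sum_gap_le (π := π) (X := X) (G := G) (R := R) hD t ω
        linarith
      · rw [if_neg (by omega), if_pos h, zero_add]
        refine (Finset.sum_le_sum fun n _ => gap_latent_le hD hδ hS (Finset.mem_range.mp ht)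
          (hgrp t) n hA).trans (le_of_eq ?_)
        rw [Finset.sum_add_distrib, Finset.sum_add_distrib]
        refine congrArg₂ (· + ·) (congrArg₂ (· + ·) ?_ ?_) ?_
        · rw [Finset.sum_comm]
          refine Finset.sum_congr rfl fun k _ => ?_
          rw [Finset.sum_comm]
          refine Finset.sum_congr rfl fun m _ => ?_
          rw [← Finset.mul_sum, lowPlays, Finset.card_filter]
          push_cast
          simp only [hw]
          congr!
        · rw [Finset.sum_const, Finset.card_univ, Fintype.card_fin, nsmul_eq_mul, Finset.mul_sum]
        · rw [Finset.sum_const, Finset.card_univ, Fintype.card_fin, nsmul_eq_mul,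
            Fintype.sum_prod_type, Finset.mul_sum]
          refine Finset.sum_congr rfl fun k _ => ?_
          rw [Finset.mul_sum]
          refine Finset.sum_congr rfl fun m _ => ?_
          simp only [hw]
          ring
    refine (Finset.sum_le_sum hslot).trans ?_
    rw [Finset.sum_add_distrib, Finset.sum_add_distrib, Finset.sum_add_distrib,
      ← Finset.sum_filter, ← Finset.sum_filter, Finset.sum_const, nsmul_eq_mul]
    have hcard : (((Finset.range T).filter fun t => t < n₀).card : ℝ) ≤ n₀ := by
      have : ((Finset.range T).filter fun t => t < n₀).card ≤ n₀ := by
        refine (Finset.card_le_card fun t ht => ?_).trans (Finset.card_range n₀).le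
        exact Finset.mem_range.mpr (Finset.mem_filter.mp ht).2
      exact_mod_cast this
    have h5 := mul_le_mul_of_nonneg_right hcard hN0
    have h6 := sum_sum_mul_lowPlays_le (X := X) (G := G) (R := R) w hw0 hthr π T ω
    linarith

/-- The hypothesis `2 ^ N ≤ T` makes the overshoot `N` at most `2 log T`, so threshold and overshoot
together are of order `log T`. -/
theorem latent_regret (hδ : 0 < δ) {T : ℕ} (hN : 1 ≤ N) (hK : 1 ≤ K) (hT : 2 ^ N ≤ T)
    (hS : IsAllocation S pc) (hD : IsLatentPayoff δ D typ) (hB : IsBroadcastModel P D X G R)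
    (hX : UniformUsers P X) :
    regret P (latentPolicy N K M N δ c S pc) (meanPayoff D) X G R T ≤
      (10 * (17 * (64 / δ ^ 2 + 2) + 8) + (64 / δ ^ 2 + 2) + 12) *
        ((K * M * Real.sqrt (Real.log (M * K) / K) + K * L) * Real.log T) := by
  have hK' : (1 : ℝ) ≤ K := by exact_mod_cast hK
  have hM : 1 ≤ M := NeZero.one_le
  have hT2 : 2 ≤ T := le_trans (by simpa using Nat.pow_le_pow_right two_pos hN) hT
  have hT' : (2 : ℝ) ≤ T := by exact_mod_cast hT2
  have hlogT : 0 < Real.log T := Real.log_pos (by linarith)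
  rcases Nat.lt_or_ge 1 M with hM1 | hM1
  swap
  · have : Subsingleton (Fin M) := Fin.subsingleton_iff_le_one.mpr hM1
    exact (regret_nonpos_of_subsingleton hB hD
      (usesStatistics_latentPolicy X G R δ c S pc)).trans (by positivity)
  obtain ⟨s, hs, hsle⟩ := hS.card_le hK
  have hs1 : 1 ≤ s := by
    have hne : (⟨0, by omega⟩ : Fin M) ≠ ⟨1, hM1⟩ := by simp
    obtain ⟨k, hk, -⟩ := hS.covers _ _ hne
    rw [← hs k]
    exact Finset.card_pos.mpr ⟨_, hk⟩
  have hL : (1 : ℝ) ≤ L := by exact_mod_cast (Fin.pos (typ 0) : 1 ≤ L)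
  have hM2 : (2 : ℝ) ≤ M := by exact_mod_cast hM1
  set ℓ := Real.log T with hℓ
  have hlog2 : (1 / 2 : ℝ) ≤ Real.log 2 := by
    have := Real.log_two_gt_d9
    linarith
  have hNℓ : (N : ℝ) ≤ 2 * ℓ := by
    have h1 : Real.log ((2 : ℝ) ^ N) ≤ ℓ :=
      Real.log_le_log (by positivity) (by exact_mod_cast hT)
    rw [Real.log_pow] at h1
    have h2 : (N : ℝ) * (1 / 2) ≤ N * Real.log 2 := by gcongr
    linarith
  have hthr : threshold δ T ≤ 64 / δ ^ 2 * ℓ := by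
    have h1 : Real.log ((T : ℝ) + 1) ≤ 2 * ℓ := by
      have h2 : Real.log ((T : ℝ) + 1) ≤ Real.log ((T : ℝ) ^ 2) :=
        Real.log_le_log (by positivity) (by nlinarith)
      rw [Real.log_pow] at h2
      exact_mod_cast h2
    calc threshold δ T ≤ 32 / δ ^ 2 * (2 * ℓ) := by rw [threshold]; gcongr
      _ = _ := by ring
  set κ : ℝ := 64 / δ ^ 2 + 2 with hκ
  have hκ0 : 0 ≤ κ := by positivity
  have hthrN : threshold δ T + N ≤ κ * ℓ := by rw [hκ]; linarith
  have hlogMK : (1 / 2 : ℝ) ≤ Real.log (M * K) :=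
    hlog2.trans (Real.log_le_log (by norm_num) (by nlinarith))
  set Q : ℝ := K * M * Real.sqrt (Real.log (M * K) / K) with hQ
  -- Since `log (M K) ≥ 1 / 2`, the extra logarithm in the stated bound only weakens the estimate by
  -- a constant.
  have hsq : 1 / Real.sqrt K ≤ 2 * Real.sqrt (Real.log (M * K) / K) := by
    rw [Real.sqrt_div (by linarith), ← mul_div_assoc]
    gcongr
    have h1 : (1 / 2 : ℝ) ≤ Real.sqrt (Real.log (M * K)) := by
      apply Real.le_sqrt_of_sq_le
      nlinarith
    linarith
  have hKs : (K : ℝ) * s ≤ 8 * Q + 2 * (K * L) := by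
    have h1 : (M : ℝ) / Real.sqrt K ≤ 2 * (M * Real.sqrt (Real.log (M * K) / K)) := by
      calc (M : ℝ) / Real.sqrt K = M * (1 / Real.sqrt K) := by ring
        _ ≤ M * (2 * Real.sqrt (Real.log (M * K) / K)) := by gcongr
        _ = _ := by ring
    calc (K : ℝ) * s ≤ K * (4 * (2 * (M * Real.sqrt (Real.log (M * K) / K))) + 2 * L) := by
          gcongr
          linarith
      _ = _ := by rw [hQ]; ring
  have hQ0 : 0 ≤ Q := by positivity
  have hmain := regret_latent_le (c := c) hB hD hX hδ hN hK hS hs1 hs T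
  have hKL1 : (1 : ℝ) ≤ K * L := by nlinarith
  have e1 : 16 * K * (s * (threshold δ T + N)) ≤ 16 * ((K * s) * (κ * ℓ)) := by
    calc 16 * K * (s * (threshold δ T + N)) = 16 * ((K * s) * (threshold δ T + N)) := by ring
      _ ≤ _ := by gcongr
  have e2 : (K * s + K * L) * (threshold δ T + N) ≤ (K * s + K * L) * (κ * ℓ) := by gcongr
  have e3 : (N : ℝ) * K ≤ 2 * ((K * L) * ℓ) := by
    calc (N : ℝ) * K ≤ 2 * ℓ * (K * L) := by
          gcongr
          exact le_mul_of_one_le_right (by positivity) hL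
      _ = _ := by ring
  have e4 : (N : ℝ) ≤ 2 * ((K * L) * ℓ) := by nlinarith
  have e5 : (N : ℝ) * (K * s + K * L) * 4 ≤ 8 * ((K * s + K * L) * ℓ) := by
    calc (N : ℝ) * (K * s + K * L) * 4 ≤ 2 * ℓ * (K * s + K * L) * 4 := by gcongr
      _ = _ := by ring
  -- The coefficient of `K s` is `16 κ + κ + 8`. Replacing `K s` by `8 Q + 2 K L` gives the factor
  -- `10`, and the remaining terms contribute `κ + 12`.
  have e6 : (17 * κ + 8) * ((K * s) * ℓ) ≤ (17 * κ + 8) * ((8 * Q + 2 * (K * L)) * ℓ) := by gcongr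
  have e7 : 0 ≤ Q * ℓ := by positivity
  have e8 : 0 ≤ κ * (Q * ℓ) := by positivity
  have e9 : 0 ≤ (K * L : ℝ) * ℓ := by positivity
  have e10 : 0 ≤ κ * ((K * L : ℝ) * ℓ) := by positivity
  nlinarith

end

end LatentBandit

theorem mainTheorem5 :
    -- one transmission per timeslot
    (∀ δ : ℝ, 0 < δ → ∃ C : ℝ, 0 < C ∧
      ∀ (N K M L T : ℕ) [NeZero M] (c : LatentBandit.Choices M) (k₀ : Fin K)
        (D : Fin K → Fin M → Measure ℝ) (typ : Fin M → Fin L)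
        (Ω : Type*) [MeasurableSpace Ω] (P : Measure Ω) (X : ℕ → Ω → Fin N → Fin K)
        (G : ℕ → Ω → Fin N → Fin 1) (R : ℕ → Ω → Fin N → Fin K → Fin M → ℝ),
        1 ≤ N → 1 ≤ T →
        LatentBandit.IsLatentPayoff δ D typ → LatentBandit.IsBroadcastModel P D X G R →
        LatentBandit.UniformRates P X →
        Integrable (LatentBandit.regretSum (LatentBandit.broadcastPolicy N K M 1 T δ c k₀)
          (LatentBandit.meanPayoff D) X G R T) P ∧
        LatentBandit.regret P (LatentBandit.broadcastPolicy N K M 1 T δ c k₀)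
            (LatentBandit.meanPayoff D) X G R T
          ≤ C * (((N * K * M + L * N ^ 2 * K : ℕ) : ℝ) * Real.log (N * M * K * T))) ∧
    -- one transmission for every user
    (∀ δ : ℝ, 0 < δ → ∃ C : ℝ, 0 < C ∧
      ∀ (N K M L T : ℕ) [NeZero M] (c : LatentBandit.Choices M) (S : Fin K → Finset (Fin M))
        (pc : Sym2 (Fin M) → Fin K) (D : Fin K → Fin M → Measure ℝ) (typ : Fin M → Fin L)
        (Ω : Type*) [MeasurableSpace Ω] (P : Measure Ω) (X : ℕ → Ω → Fin N → Fin K)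
        (G : ℕ → Ω → Fin N → Fin N) (R : ℕ → Ω → Fin N → Fin K → Fin M → ℝ),
        1 ≤ N → 1 ≤ K → 2 ^ N ≤ T → LatentBandit.IsAllocation S pc →
        LatentBandit.IsLatentPayoff δ D typ → LatentBandit.IsBroadcastModel P D X G R →
        LatentBandit.UniformUsers P X →
        Integrable (LatentBandit.regretSum (LatentBandit.latentPolicy N K M N δ c S pc)
          (LatentBandit.meanPayoff D) X G R T) P ∧
        LatentBandit.regret P (LatentBandit.latentPolicy N K M N δ c S pc)
            (LatentBandit.meanPayoff D) X G R T
          ≤ C * ((K * M * Real.sqrt (Real.log (M * K) / K) + K * L) * Real.log T)) ∧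
    -- an arbitrary number of transmissions
    (∃ C : ℝ, 0 < C ∧
      ∀ (N K M L τ T : ℕ) [NeZero M] (δ : ℝ) (c : LatentBandit.Choices M) (k₀ : Fin K)
        (D : Fin K → Fin M → Measure ℝ) (typ : Fin M → Fin L)
        (Ω : Type*) [MeasurableSpace Ω] (P : Measure Ω) (X : ℕ → Ω → Fin N → Fin K)
        (G : ℕ → Ω → Fin N → Fin τ) (R : ℕ → Ω → Fin N → Fin K → Fin M → ℝ),
        1 ≤ N → 1 ≤ T → τ ∣ N → 0 < δ →
        (τ : ℝ) ≤ K * M / δ ^ 2 * Real.log (N * T * M) →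
        LatentBandit.IsLatentPayoff δ D typ → LatentBandit.IsBroadcastModel P D X G R →
        LatentBandit.UniformUsers P X →
        Integrable (LatentBandit.regretSum (LatentBandit.broadcastPolicy N K M τ T δ c k₀)
          (LatentBandit.meanPayoff D) X G R T) P ∧
        LatentBandit.regret P (LatentBandit.broadcastPolicy N K M τ T δ c k₀)
            (LatentBandit.meanPayoff D) X G R T
          ≤ C * (N * K * M / (τ * δ ^ 2) * Real.log (N * T * M)
              + L * N ^ 2 * K / (τ ^ 2 * δ ^ 2) * Real.log (L * N * K * T))) := by
  refine ⟨fun δ hδ => ⟨48 / δ ^ 2 + 12, by positivity, ?_⟩, fun δ hδ =>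
    ⟨10 * (17 * (64 / δ ^ 2 + 2) + 8) + (64 / δ ^ 2 + 2) + 12, by positivity, ?_⟩,
    ⟨38, by norm_num, ?_⟩⟩
  · intro N K M L T _ c k₀ D typ Ω _ P X G R hN hT hD hB hX
    exact ⟨LatentBandit.integrable_regretSum hB hD
      (LatentBandit.usesStatistics_broadcastPolicy X G R T δ c k₀) T,
      LatentBandit.broadcast_single_regret hδ hN hT hD hB hX⟩
  · intro N K M L T _ c S pc D typ Ω _ P X G R hN hK hT hS hD hB hX
    exact ⟨LatentBandit.integrable_regretSum hB hD
      (LatentBandit.usesStatistics_latentPolicy X G R δ c S pc) T,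
      LatentBandit.latent_regret hδ hN hK hT hS hD hB hX⟩
  · intro N K M L τ T _ δ c k₀ D typ Ω _ P X G R hN hT hτN hδ hτ hD hB hX
    exact ⟨LatentBandit.integrable_regretSum hB hD
      (LatentBandit.usesStatistics_broadcastPolicy X G R T δ c k₀) T,
      LatentBandit.broadcast_regret hδ hN hT hτN hτ hD hB hX⟩
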